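/- **Setting.** Let $a,b>0$ and let $(\gamma)$ be a continuous curve in the first quadrant of the $st$-plane, parametrized by arc length $\mu\in[0,\ell]$ as $s=L_1(\mu)$, $t=L_2(\mu)$, running from $(a,0)$ to $(0,b)$, with $L_1$ non-increasing and $L_2$ non-decreasing, meeting the coordinate axes only at its endpoints. Let $P_0=(a,0),P_1,\dots,P_N,P_{N+1}=(0,b)$ be points on $(\gamma)$ (the vertices), in the order of increasing arc length, such that $(\gamma)$ is $C^2$, up to the endpoints, on each arc between consecutive vertices. Let $G$ be the open domain bounded by $[0,a]\times\{0\}$, $\{0\}\times[0,b]$ and $(\gamma)$, and $\bar G$ its closure. Put $n_1=L_2'$, $n_2=-L_1'$ (the unit outward normal) and, for a function $\varphi$, $\varphi_\mu=-n_2\varphi_s+n_1\varphi_t$ on $(\gamma)$. Assume that $n_2\ne0$ at each point of $(\gamma)$ whose $s$-coordinate is not that of a vertex, and that $n_1\neq 0$ at each point of $(\gamma)$ whose $t$-coordinate is not that of a vertex. The regular part of $G$ is $$G_R=\{(s,t)\in G:\ s\ne s(P_r)\ \text{and}\ t\ne t(P_r)\ \text{for } r=0,\dots,N+1\}.$$ Put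 $W(s,t)=[0,s]\times[0,t]$, $E(s,t)=\{(\sigma,\tau)\in G:(s,t)\in W(\sigma,\tau)\}$ and $\gamma(s,t)=\{(\sigma,\tau)\in(\gamma):(s,t)\in W(\sigma,\tau)\}$. Let $f(s,t,x,p,q,u)\in\mathbb R^n$ and $\Phi(s,t,x,p,q,u)\in\mathbb R$, with $x,p,q\in\mathbb R^n$ and $u\in\mathbb R^m$, be $C^2$ for $(s,t)$ in an open set $O\supseteq\bar G$; let $\Phi_1(s,t,x,\eta)\in\mathbb R$, for $(s,t)\in(\gamma)$ and $x,\eta\in\mathbb R^n$, be $C^2$ on each open arc of $(\gamma)$ between consecutive vertices, with a $C^2$ extension to the closed arc (as a function of $\mu,x,\eta$; it may jump at a vertex); and let $\Phi_0(P_r,x)\in\mathbb R$ be $C^1$ in $x\in\mathbb R^n$ for each $r$. Let $x:O\to\mathbb R^n$ be $C^2$ and $u:O\to\mathbb R^m$ be $C^1$, such that $x_{st}=f(s,t,x,x_s,x_t,u)$ on $G\cup(\gamma)$, with $x(s,0)=x_1(s)$ for $0\le s\le a$ and $x(0,t)=x_2(t)$ for $0\le t\le b$. Below, "$\dots$" stands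 for evaluation along the state and the control, i.e. at $x(s,t),x_s(s,t),x_t(s,t),u(s,t)$ (for $\Phi_1$: at $x$ and $x_\mu$); $\frac{D}{Ds},\frac{D}{Dt},\frac{D}{D\mu}$ are total derivatives, i.e. derivatives of the resulting functions of $(s,t)$, resp. of $\mu$; repeated indices are summed. Let $R^i_j(s,t,\sigma,\tau)$ be the matrix-valued Riemann function of the linearized equation: for each $(\sigma,\tau)\in\bar G$, as functions of $(s,t)$, the $R^i_j$ are continuous on $\{(s,t)\in\bar G: s\ge\sigma,t\ge\tau\}$, are $C^1$ on $\{(s,t)\in G:s>\sigma,t>\tau\}$, and satisfy $$\tfrac{\partial^2}{\partial s\partial t}R^i_j=f^i_{x^k}(s,t,\dots)R^k_j+f^i_{p^k}(s,t,\dots)\tfrac{\partial}{\partial s}R^k_j+f^i_{q^k}(s,t,\dots)\tfrac{\partial}{\partial t}R^k_j\quad\text{for }(s,t)\in G,\ s>\sigma,\ t>\tau,$$ $$\tfrac{\partial}{\partial s}R^i_j(s,\tau,\sigma,\tau)=f^i_{q^k}(s,\tau,\dots)R^k_j(s,\tau,\sigma,\tau),\qquad \tfrac{\partial}{\partial t}R^i_j(\sigma,t,\sigma,\tau)=f^i_{p^k}(\sigma,t,\dots)R^k_j(\sigma,t,\sigma,\tau),\qquad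 R^i_j(\sigma,\tau,\sigma,\tau)=\delta^i_j.$$ Define the co-state $\psi=(\psi_1,\dots,\psi_n)$ by $$\begin{aligned}\psi_j(s,t)=&\iint_{E(s,t)}\Big\{\Phi_{x^i}-\tfrac{D}{D\sigma}\Phi_{p^i}-\tfrac{D}{D\tau}\Phi_{q^i}\Big\}(\sigma,\tau,\dots)\,R^i_j(\sigma,\tau,s,t)\,d\sigma\,d\tau\\&+\int_{\gamma(s,t)}\Big\{n_1\Phi_{p^i}+n_2\Phi_{q^i}+\Phi_{1,x^i}-\tfrac{D}{D\mu}\Phi_{1,\eta^i}\Big\}(\sigma,\tau,\dots)\,R^i_j(\sigma,\tau,s,t)\,d\mu(\sigma,\tau)\\&+\sum_{r=1}^N\big\{\Phi_{0,x^i}(P_r,x(P_r))-V_r(\Phi_{1,\eta^i})\big\}R^i_j(P_r,s,t)\,\chi\big((s,t)\in W(P_r)\big),\end{aligned}$$ where $\chi$ of a true (false) assertion is $1$ ($0$), and $V_r(\varphi)$ is the jump of $\varphi$ at $P_r$ along $(\gamma)$: its one-sided limit at $P_r$ from larger values of $\mu$ minus its one-sided limit from smaller values of $\mu$. Let $$H(s,t,x,p,q,\psi,u)=\Phi(s,t,x,p,q,u)+\psi_jf^j(s,t,x,p,q,u).$$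 **Theorem 3.1.** At every point $(s,t)\in G_R$ and for every $i$, the partial derivatives $\partial\psi_i/\partial s$, $\partial\psi_i/\partial t$, both mixed second derivatives of $\psi_i$, and the total derivatives $\frac{D}{Ds}\frac{\partial H}{\partial p^i}$, $\frac{D}{Dt}\frac{\partial H}{\partial q^i}$ exist, the two mixed derivatives are equal, and $$\frac{\partial^2\psi_i}{\partial s\,\partial t}=\frac{\partial H}{\partial x^i}-\frac{D}{Ds}\frac{\partial H}{\partial p^i}-\frac{D}{Dt}\frac{\partial H}{\partial q^i},$$ with the derivatives of $H$ evaluated along $(s,t,x(s,t),x_s(s,t),x_t(s,t),\psi(s,t),u(s,t))$. -/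

import Mathlib

open Set MeasureTheory

noncomputable section

namespace Goursat

/-- The `st`-plane; a point `P` has coordinates `s = P.1`, `t = P.2`. -/
abbrev Plane := ℝ × ℝ

/-- Real `n`-vectors. -/
abbrev Vec (n : ℕ) := Fin n → ℝ

/-- The derivative in `s` of a function on the plane. Applied to a composite such as
`P ↦ Φ (P, x P, ...)` it is the total derivative `D/Ds`. -/
def dS {F : Type*} [NormedAddCommGroup F] [NormedSpace ℝ F] (g : Plane → F) (P : Plane) : F :=
  deriv (fun s => g (s, P.2)) P.1

/-- The derivative in `t`; on composites it is the total derivative `D/Dt`. -/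
def dT {F : Type*} [NormedAddCommGroup F] [NormedSpace ℝ F] (g : Plane → F) (P : Plane) : F :=
  deriv (fun t => g (P.1, t)) P.2

/-- `∂g/∂y^i` for a function `g` of a vector `y`. -/
def pd {n : ℕ} (g : Vec n → ℝ) (i : Fin n) (y : Vec n) : ℝ :=
  fderiv ℝ g y (Pi.single i 1)

/-- `W(s,t)`: the rectangle `0 ≤ σ ≤ s`, `0 ≤ τ ≤ t`. -/
def W (P : Plane) : Set Plane := {Q | 0 ≤ Q.1 ∧ Q.1 ≤ P.1 ∧ 0 ≤ Q.2 ∧ Q.2 ≤ P.2}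

/-- The geometric data: a non-increasing curve `γ`, parametrized by arc length
`μ ∈ [0, ℓ]` as `s = L₁ μ`, `t = L₂ μ`, running from `(a, 0)` to `(0, b)`, together with its
vertices `P_0, ..., P_{N+1}`, given through their arc length parameters. -/
structure CurvilinearDomain where
  (a b ℓ : ℝ)
  (L₁ L₂ : ℝ → ℝ)
  N : ℕ
  /-- arc length parameters of the vertices -/
  vpar : Fin (N + 2) → ℝ
  a_pos : 0 < a
  b_pos : 0 < b
  vpar_strictMono : StrictMono vpar
  vpar_zero : vpar 0 = 0
  vpar_last : vpar (Fin.last (N + 1)) = ℓ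
  start₁ : L₁ 0 = a
  start₂ : L₂ 0 = 0
  stop₁ : L₁ ℓ = 0
  stop₂ : L₂ ℓ = b
  /-- apart from its endpoints the curve does not meet the axes -/
  pos : ∀ μ ∈ Ioo 0 ℓ, 0 < L₁ μ ∧ 0 < L₂ μ
  antitone₁ : AntitoneOn L₁ (Icc 0 ℓ)
  monotone₂ : MonotoneOn L₂ (Icc 0 ℓ)
  /-- between consecutive vertices the curve is `C²`, up to the endpoints of the arc -/
  smooth₁ : ∀ r : Fin (N + 1), ContDiffOn ℝ 2 L₁ (Icc (vpar r.castSucc) (vpar r.succ))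
  smooth₂ : ∀ r : Fin (N + 1), ContDiffOn ℝ 2 L₂ (Icc (vpar r.castSucc) (vpar r.succ))
  arcLength : ∀ r : Fin (N + 1), ∀ μ ∈ Ioo (vpar r.castSucc) (vpar r.succ),
    deriv L₁ μ ^ 2 + deriv L₂ μ ^ 2 = 1
  /-- A vertical line that does not pass through a vertex crosses `γ` at a point with
  `n₂ ≠ 0` ... -/
  transversal₁ : ∀ μ ∈ Icc 0 ℓ, (∀ r, L₁ μ ≠ L₁ (vpar r)) → deriv L₁ μ ≠ 0
  /-- ... and a horizontal line that does not pass through a vertex crosses `γ` at a point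
  with `n₁ ≠ 0`. -/
  transversal₂ : ∀ μ ∈ Icc 0 ℓ, (∀ r, L₂ μ ≠ L₂ (vpar r)) → deriv L₂ μ ≠ 0

namespace CurvilinearDomain

variable (D : CurvilinearDomain)

/-- The point of `γ` with arc length parameter `μ`. -/
def pt (μ : ℝ) : Plane := (D.L₁ μ, D.L₂ μ)

/-- The curve `γ`. -/
def curve : Set Plane := D.pt '' Icc 0 D.ℓ

/-- The vertices. -/
def vertex (r : Fin (D.N + 2)) : Plane := D.pt (D.vpar r)

/-- The closed region bounded by the two axes and `γ`. -/
def closedRegion : Set Plane := {P | ∃ μ ∈ Icc 0 D.ℓ, P ∈ W (D.pt μ)}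

/-- The domain `G`. -/
def G : Set Plane := interior D.closedRegion

/-- The regular part `G_R` of `G`. -/
def regularPart : Set Plane :=
  {P ∈ D.G | ∀ r, P.1 ≠ (D.vertex r).1 ∧ P.2 ≠ (D.vertex r).2}

/-- `E(s,t)`: the points `(σ,τ)` of `G` with `(s,t) ∈ W(σ,τ)`. -/
def E (P : Plane) : Set Plane := {Q ∈ D.G | P ∈ W Q}

/-- The arc `γ(s,t)`, as a set of arc length parameters: `(σ,τ) ∈ γ(s,t)` iff
`(s,t) ∈ W(σ,τ)`. -/
def arc (P : Plane) : Set ℝ := {μ ∈ Icc 0 D.ℓ | P ∈ W (D.pt μ)}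

/-- The components of the unit normal of `γ` that points out of `G`. -/
def n₁ (μ : ℝ) : ℝ := deriv D.L₂ μ

/-- See `n₁`. -/
def n₂ (μ : ℝ) : ℝ := -deriv D.L₁ μ

/-- The tangential derivative `φ_μ = -n₂ φ_s + n₁ φ_t` on `γ`. -/
def tangential {F : Type*} [NormedAddCommGroup F] [NormedSpace ℝ F] (φ : Plane → F) (μ : ℝ) : F :=
  -D.n₂ μ • dS φ (D.pt μ) + D.n₁ μ • dT φ (D.pt μ)

end CurvilinearDomain

/-- The data of the control problem: the dynamics `f(s,t,x,p,q,u)`, the running cost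
`Φ(s,t,x,p,q,u)`, the boundary cost `Φ₁(s,t,x,η)` and the vertex cost `Φ₀(P,x)`. -/
structure ControlProblem (n m : ℕ) where
  f : Plane → Vec n → Vec n → Vec n → Vec m → Vec n
  Φ : Plane → Vec n → Vec n → Vec n → Vec m → ℝ
  Φ₁ : Plane → Vec n → Vec n → ℝ
  Φ₀ : Plane → Vec n → ℝ

/-- `h(s,t,x,p,q,u)` is `C²` for `(s,t)` in `O`, jointly in all variables. -/
def SmoothOver {n m : ℕ} {F : Type*} [NormedAddCommGroup F] [NormedSpace ℝ F] (O : Set Plane)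
    (h : Plane → Vec n → Vec n → Vec n → Vec m → F) : Prop :=
  ContDiffOn ℝ 2
    (fun z : Plane × Vec n × Vec n × Vec n × Vec m => h z.1 z.2.1 z.2.2.1 z.2.2.2.1 z.2.2.2.2)
    (O ×ˢ univ)

/-- `Φ₁` is `C²` along each arc of `γ` between consecutive vertices, up to the endpoints of the
arc (it may jump at a vertex). -/
def SmoothAlongArcs {n : ℕ} (D : CurvilinearDomain) (Φ₁ : Plane → Vec n → Vec n → ℝ) : Prop :=
  ∀ r : Fin (D.N + 1), ∃ g : ℝ × Vec n × Vec n → ℝ,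
    ContDiffOn ℝ 2 g (Icc (D.vpar r.castSucc) (D.vpar r.succ) ×ˢ univ) ∧
    ∀ μ ∈ Ioo (D.vpar r.castSucc) (D.vpar r.succ), ∀ y η, Φ₁ (D.pt μ) y η = g (μ, y, η)

/-- `x` is the state that belongs to the control `u` and the Goursat data `x₁`, `x₂`. -/
structure IsState {n m : ℕ} (D : CurvilinearDomain) (C : ControlProblem n m)
    (x₁ x₂ : ℝ → Vec n) (x : Plane → Vec n) (u : Plane → Vec m) : Prop where
  dynamics : ∀ P ∈ D.G ∪ D.curve, dT (dS x) P = C.f P (x P) (dS x P) (dT x P) (u P)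
  data₁ : ∀ s ∈ Icc 0 D.a, x (s, 0) = x₁ s
  data₂ : ∀ t ∈ Icc 0 D.b, x (0, t) = x₂ t

section Partials

variable {n m : ℕ} (h : Plane → Vec n → Vec n → Vec n → Vec m → ℝ)
  (x : Plane → Vec n) (u : Plane → Vec m)

/-- `∂h/∂x^i` at `(s, t, x(s,t), x_s(s,t), x_t(s,t), u(s,t))`. -/
def alongX (i : Fin n) (P : Plane) : ℝ :=
  pd (fun y => h P y (dS x P) (dT x P) (u P)) i (x P)

/-- `∂h/∂p^i` at `(s, t, x(s,t), x_s(s,t), x_t(s,t), u(s,t))`. -/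
def alongP (i : Fin n) (P : Plane) : ℝ :=
  pd (fun p => h P (x P) p (dT x P) (u P)) i (dS x P)

/-- `∂h/∂q^i` at `(s, t, x(s,t), x_s(s,t), x_t(s,t), u(s,t))`. -/
def alongQ (i : Fin n) (P : Plane) : ℝ :=
  pd (fun q => h P (x P) (dS x P) q (u P)) i (dT x P)

end Partials

section Riemann

variable {n m : ℕ} (D : CurvilinearDomain) (C : ControlProblem n m)
  (x : Plane → Vec n) (u : Plane → Vec m)

/-- The component `f^i` of the dynamics. -/
def ControlProblem.fc (i : Fin n) : Plane → Vec n → Vec n → Vec n → Vec m → ℝ :=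
  fun P y p q v => C.f P y p q v i

/-- `R P Q i j`, with `P = (s,t)` and `Q = (σ,τ)`, is the matrix-valued Riemann function
`R^i_j(s,t,σ,τ)` of the linearized equation along `(x, u)`: for each `Q`, as a function of `P`,
it is the solution of the Goursat problem with vertex `Q`. -/
structure IsRiemannFunction (R : Plane → Plane → Fin n → Fin n → ℝ) : Prop where
  continuousOn : ∀ Q ∈ D.closedRegion, ∀ i j,
    ContinuousOn (fun P => R P Q i j) {P ∈ D.closedRegion | Q.1 ≤ P.1 ∧ Q.2 ≤ P.2}
  contDiffOn : ∀ Q ∈ D.closedRegion, ∀ i j,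
    ContDiffOn ℝ 1 (fun P => R P Q i j) {P ∈ D.G | Q.1 < P.1 ∧ Q.2 < P.2}
  equation : ∀ Q ∈ D.closedRegion, ∀ i j, ∀ P ∈ D.G, Q.1 < P.1 → Q.2 < P.2 →
    HasDerivAt (fun t => dS (fun P' => R P' Q i j) (P.1, t))
      (∑ k, (alongX (C.fc i) x u k P * R P Q k j
        + alongP (C.fc i) x u k P * dS (fun P' => R P' Q k j) P
        + alongQ (C.fc i) x u k P * dT (fun P' => R P' Q k j) P)) P.2
  edge_s : ∀ Q ∈ D.closedRegion, ∀ i j, ∀ s, Q.1 ≤ s → (s, Q.2) ∈ D.closedRegion →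
    HasDerivWithinAt (fun s' => R (s', Q.2) Q i j)
      (∑ k, alongQ (C.fc i) x u k (s, Q.2) * R (s, Q.2) Q k j)
      {s' | Q.1 ≤ s' ∧ (s', Q.2) ∈ D.closedRegion} s
  edge_t : ∀ Q ∈ D.closedRegion, ∀ i j, ∀ t, Q.2 ≤ t → (Q.1, t) ∈ D.closedRegion →
    HasDerivWithinAt (fun t' => R (Q.1, t') Q i j)
      (∑ k, alongP (C.fc i) x u k (Q.1, t) * R (Q.1, t) Q k j)
      {t' | Q.2 ≤ t' ∧ (Q.1, t') ∈ D.closedRegion} t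
  diagonal : ∀ Q ∈ D.closedRegion, ∀ i j, R Q Q i j = if i = j then 1 else 0

/-- `Φ_{1,x^i}` at the point of `γ` with parameter `μ`, along the state. -/
def bdryX (i : Fin n) (μ : ℝ) : ℝ :=
  pd (fun y => C.Φ₁ (D.pt μ) y (D.tangential x μ)) i (x (D.pt μ))

/-- `Φ_{1,η^i}` at the point of `γ` with parameter `μ`, along the state. -/
def bdryEta (i : Fin n) (μ : ℝ) : ℝ :=
  pd (fun η => C.Φ₁ (D.pt μ) (x (D.pt μ)) η) i (D.tangential x μ)

/-- `V_r(φ)`: the jump at the vertex `P_r` of a function `φ` on `γ`, in the direction of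
increasing arc length. -/
def vertexJump (r : Fin (D.N + 2)) (φ : ℝ → ℝ) : ℝ :=
  Function.rightLim φ (D.vpar r) - Function.leftLim φ (D.vpar r)

/-- `Φ_{x^i} - (D/Ds) Φ_{p^i} - (D/Dt) Φ_{q^i}`. -/
def sourceG (i : Fin n) (Q : Plane) : ℝ :=
  alongX C.Φ x u i Q - dS (alongP C.Φ x u i) Q - dT (alongQ C.Φ x u i) Q

/-- `n₁ Φ_{p^i} + n₂ Φ_{q^i} + Φ_{1,x^i} - (D/Dμ) Φ_{1,η^i}` on `γ`. -/
def sourceCurve (i : Fin n) (μ : ℝ) : ℝ :=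
  D.n₁ μ * alongP C.Φ x u i (D.pt μ) + D.n₂ μ * alongQ C.Φ x u i (D.pt μ)
    + bdryX D C x i μ - deriv (bdryEta D C x i) μ

/-- `Φ_{0,x^i}(P_r, x(P_r)) - V_r(Φ_{1,η^i})`. -/
def sourceVertex (i : Fin n) (r : Fin (D.N + 2)) : ℝ :=
  pd (C.Φ₀ (D.vertex r)) i (x (D.vertex r)) - vertexJump D r (bdryEta D C x i)

/-- The co-state `ψ_j(s,t)`. The vertex sum runs over `P_1, ..., P_N`. -/
def costate (R : Plane → Plane → Fin n → Fin n → ℝ) (j : Fin n) (P : Plane) : ℝ :=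
  (∫ Q in D.E P, ∑ i, sourceG C x u i Q * R Q P i j)
    + (∫ μ in D.arc P, ∑ i, sourceCurve D C x u i μ * R (D.pt μ) P i j)
    + ∑ r : Fin D.N, ∑ i, sourceVertex D C x i r.succ.castSucc
        * R (D.vertex r.succ.castSucc) P i j
        * (W (D.vertex r.succ.castSucc)).indicator (fun _ => (1 : ℝ)) P

end Riemann

/-- The Hamiltonian `H(s,t,x,p,q,ψ,u) = Φ(s,t,x,p,q,u) + ψ_j f^j(s,t,x,p,q,u)`. -/
def ControlProblem.H {n m : ℕ} (C : ControlProblem n m) (P : Plane) (y p q ψ : Vec n)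
    (v : Vec m) : ℝ :=
  C.Φ P y p q v + ∑ j, ψ j * C.f P y p q v j

section HamiltonianPartials

variable {n m : ℕ} (C : ControlProblem n m) (x : Plane → Vec n) (ψ : Plane → Vec n)
  (u : Plane → Vec m)

/-- `∂H/∂x^i` at `(s, t, x(s,t), x_s(s,t), x_t(s,t), ψ(s,t), u(s,t))`. -/
def HX (i : Fin n) (P : Plane) : ℝ :=
  pd (fun y => C.H P y (dS x P) (dT x P) (ψ P) (u P)) i (x P)

/-- `∂H/∂p^i` at `(s, t, x(s,t), x_s(s,t), x_t(s,t), ψ(s,t), u(s,t))`. -/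
def HP (i : Fin n) (P : Plane) : ℝ :=
  pd (fun p => C.H P (x P) p (dT x P) (ψ P) (u P)) i (dS x P)

/-- `∂H/∂q^i` at `(s, t, x(s,t), x_s(s,t), x_t(s,t), ψ(s,t), u(s,t))`. -/
def HQ (i : Fin n) (P : Plane) : ℝ :=
  pd (fun q => C.H P (x P) (dS x P) q (ψ P) (u P)) i (dT x P)

end HamiltonianPartials

end Goursat

end

/-! ### Weighted contractions and parametric integrals -/

noncomputable section

namespace Goursat

open Filter Topology

section Volterra

/-! The co-state differentiates the Riemann function `R P Q` in its second argument `Q`, whereas the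
defining Goursat problem gives information only in the first argument `P`. The proof therefore
produces a kernel whose dependence on `Q` is under control. With `B`, `C` the coefficients `f_p`,
`f_q` along the state and `K = f_x - D_s f_p - D_t f_q`, all extended to the plane by a cutoff, let
`S P Q` solve the adjoint equation `S_{στ} = S K - S_σ B - S_τ C` in `Q = (σ, τ)`, with `S_σ = -S C`
and `S_τ = -S B` on the horizontal and vertical lines through `P`, and `S P P = 1`. The jet `(S,
S_σ, S_τ)` is the fixed point of a Volterra operator that contracts in an exponentially weighted
norm (`exists_isAdjointRiemann`), and it is jointly continuous in `(P, Q)`.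

Green's identity on the rectangle spanned by `Q` and `P` gives `R P Q = S P Q` strictly above the
diagonal (`IsGoursatSolution.apply_eq`). At a regular point the remaining pairs `P`, `Q` with a
common coordinate do not contribute to the co-state, so `ψ` is the pairing of the sources in the
domain, on the curve and at the vertices with `S` (`costate_eq_vecPairing`).

This pairing is differentiated by Leibniz rules. Moving `Q` horizontally gives `ψ_s = ⟨S_σ⟩ -
F₁(S)`, where `⟨·⟩` is the pairing and `F₁` collects the sources on the vertical line through `Q`:
an integral over a segment and one point of the curve, which is crossed transversally because `Q` is
regular. Likewise `ψ_t = ⟨S_τ⟩ - F₂(S)`. A second differentiation gives `ψ_{st} = ⟨S_{στ}⟩ - F₁(S_τ)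
- F₂(S_σ) + g(Q)`, in which the source density `g(Q)` comes from the corner, where `S` is the
identity. The data on the characteristic lines turn `F₁(S_τ)` into `-F₁(S) B` and `F₂(S_σ)` into
`-F₂(S) C`, so everything regroups into `ψ_{st} = g + ψ K - ψ_s B - ψ_t C`
(`hasDerivAt_mixed_vecPairing`). The two orders of differentiation give the same expression. By the
product rule the right-hand side is `H_x - D_s H_p - D_t H_q`. -/

/-- A fixed point theorem for maps that contract with respect to an exponential weight. -/
theorem exists_continuous_fixedPoint_of_weight {X E : Type*} [TopologicalSpace X]
    [NormedAddCommGroup E] [NormedSpace ℝ E] [CompleteSpace E] (ω : X → ℝ) (hω : Continuous ω)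
    (T : (X → E) → X → E) (hT : ∀ y, Continuous y → Continuous (T y))
    (hT₀ : ∃ M, ∀ x, ‖T 0 x‖ ≤ M * Real.exp (ω x))
    (hTd : ∀ y z, Continuous y → Continuous z → ∀ M, 0 ≤ M →
      (∀ x, ‖y x - z x‖ ≤ M * Real.exp (ω x)) →
      ∀ x, ‖T y x - T z x‖ ≤ M / 2 * Real.exp (ω x)) :
    ∃ y, Continuous y ∧ T y = y := by
  obtain ⟨M₀, hM₀⟩ := hT₀
  -- Multiplication by the weight turns the weighted norm into the sup norm, so that Banach's
  -- theorem applies to the conjugated map on bounded continuous functions, with constant 1/2.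
  let up : BoundedContinuousFunction X E → X → E := fun y x => Real.exp (ω x) • y x
  have hup : ∀ y, Continuous (up y) := fun y =>
    (Real.continuous_exp.comp hω).smul y.continuous
  have hcancel : ∀ x (e : E), Real.exp (ω x) • (Real.exp (-ω x) • e) = e := fun x e => by
    rw [smul_smul, ← Real.exp_add, add_neg_cancel, Real.exp_zero, one_smul]
  have hdown : ∀ (x : X) (e : E) (M : ℝ), ‖e‖ ≤ M * Real.exp (ω x) →
      ‖Real.exp (-ω x) • e‖ ≤ M := fun x e M h => by
    rw [norm_smul, Real.norm_of_nonneg (Real.exp_pos _).le]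
    calc Real.exp (-ω x) * ‖e‖ ≤ Real.exp (-ω x) * (M * Real.exp (ω x)) := by gcongr
      _ = M * (Real.exp (-ω x) * Real.exp (ω x)) := by ring
      _ = M := by rw [← Real.exp_add, neg_add_cancel, Real.exp_zero, mul_one]
  have hnorm : ∀ (y z : BoundedContinuousFunction X E) x,
      ‖up y x - up z x‖ ≤ dist y z * Real.exp (ω x) := fun y z x => by
    change ‖Real.exp (ω x) • y x - Real.exp (ω x) • z x‖ ≤ _
    rw [← smul_sub, norm_smul, Real.norm_of_nonneg (Real.exp_pos _).le, mul_comm, ← dist_eq_norm]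
    gcongr
    exact BoundedContinuousFunction.dist_coe_le_dist x
  have hbd : ∀ (y : BoundedContinuousFunction X E) x,
      ‖Real.exp (-ω x) • T (up y) x‖ ≤ dist y 0 / 2 + M₀ := fun y x => by
    apply hdown
    have h0 : up 0 = 0 := by ext x; simp [up]
    have h1 := hTd (up y) 0 (hup y) continuous_zero (dist y 0) dist_nonneg
      (fun x => by rw [← h0]; exact hnorm y 0 x) x
    calc ‖T (up y) x‖ = ‖(T (up y) x - T 0 x) + T 0 x‖ := by rw [sub_add_cancel]
      _ ≤ _ := norm_add_le _ _
      _ ≤ dist y 0 / 2 * Real.exp (ω x) + M₀ * Real.exp (ω x) := add_le_add h1 (hM₀ x)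
      _ = _ := by ring
  let S : BoundedContinuousFunction X E → BoundedContinuousFunction X E := fun y =>
    BoundedContinuousFunction.ofNormedAddCommGroup (fun x => Real.exp (-ω x) • T (up y) x)
      ((Real.continuous_exp.comp hω.neg).smul (hT _ (hup y))) _ (hbd y)
  have hS : ContractingWith (1 / 2) S := by
    refine ⟨one_half_lt_one, LipschitzWith.of_dist_le_mul fun y z => ?_⟩
    rw [BoundedContinuousFunction.dist_le (by positivity)]
    intro x
    rw [dist_eq_norm]
    change ‖Real.exp (-ω x) • T (up y) x - Real.exp (-ω x) • T (up z) x‖ ≤ _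
    rw [← smul_sub]
    apply hdown
    refine (hTd _ _ (hup y) (hup z) (dist y z) dist_nonneg (hnorm y z) x).trans (le_of_eq ?_)
    push_cast
    ring
  have hfix : S (hS.fixedPoint S) = hS.fixedPoint S := hS.fixedPoint_isFixedPt
  refine ⟨up (hS.fixedPoint S), hup _, ?_⟩
  ext x
  have h2 : Real.exp (-ω x) • T (up (hS.fixedPoint S)) x = hS.fixedPoint S x :=
    DFunLike.congr_fun hfix x
  change _ = Real.exp (ω x) • (hS.fixedPoint S) x
  rw [← h2, hcancel]

/-- Integrating the weight gains a factor `1 / l`. This gain is what makes Volterra operators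
contract for large `l`, without any smallness of the domain. -/
theorem abs_integral_exp_abs_sub_le {l : ℝ} (hl : 0 < l) (a b d : ℝ) :
    |∫ x in a..b, Real.exp (l * (|x - a| + d))| ≤ Real.exp (l * (|b - a| + d)) / l := by
  -- The sign `ε` of `b - a` removes the absolute value in the exponent and treats both orientations
  -- at once, since the Volterra integrals run in all directions from the vertex.
  have key : ∀ ε : ℝ, ε = 1 ∨ ε = -1 → 0 ≤ ε * (b - a) →
      |∫ x in a..b, Real.exp (l * (|x - a| + d))| ≤ Real.exp (l * (|b - a| + d)) / l := by
    intro ε hε hab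
    have hεε : ε * ε = 1 := by rcases hε with rfl | rfl <;> norm_num
    have habs : |ε| = 1 := by rcases hε with rfl | rfl <;> norm_num
    have h1 : ∀ x ∈ uIcc a b, |x - a| = ε * (x - a) := by
      intro x hx
      rcases hε with rfl | rfl
      · rw [uIcc_of_le (by linarith)] at hx
        rw [abs_of_nonneg (by linarith [hx.1])]; ring
      · rw [uIcc_of_ge (by linarith)] at hx
        rw [abs_of_nonpos (by linarith [hx.2])]; ring
    have h2 : ∫ x in a..b, Real.exp (l * (|x - a| + d)) =
        ε / l * Real.exp (l * (ε * (b - a) + d)) - ε / l * Real.exp (l * (ε * (a - a) + d)) := by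
      rw [intervalIntegral.integral_congr
        (g := fun x => Real.exp (l * (ε * (x - a) + d))) (fun x hx => by simp only [h1 x hx])]
      refine intervalIntegral.integral_eq_sub_of_hasDerivAt
        (f := fun x => ε / l * Real.exp (l * (ε * (x - a) + d))) (fun x _ => ?_)
        (Continuous.intervalIntegrable (by fun_prop) _ _)
      have h3 : HasDerivAt (fun x => l * (ε * (x - a) + d)) (l * (ε * 1)) x :=
        ((((hasDerivAt_id x).sub_const a).const_mul ε).add_const d).const_mul l
      have h4 : ∀ y : ℝ, ε / l * (y * (l * (ε * 1))) = ε * ε * y := fun y => by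
        have := hl.ne'
        field_simp
      have h5 := h3.exp.const_mul (ε / l)
      rwa [h4, hεε, one_mul] at h5
    rw [h2, ← mul_sub, abs_mul, abs_div, habs, abs_of_pos hl, h1 b right_mem_uIcc, sub_self,
      mul_zero, zero_add, one_div, div_eq_inv_mul]
    gcongr
    rw [abs_of_nonneg]
    · linarith [Real.exp_pos (l * d)]
    · rw [sub_nonneg]
      apply Real.exp_le_exp.2
      nlinarith
  rcases le_total a b with h | h
  · exact key 1 (Or.inl rfl) (by linarith)
  · exact key (-1) (Or.inr rfl) (by linarith)

theorem norm_integral_le_of_norm_le_exp {E : Type*} [NormedAddCommGroup E] [NormedSpace ℝ E]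
    {l : ℝ} (hl : 0 < l) {a b d M : ℝ} (hM : 0 ≤ M) {f : ℝ → E}
    (hf : ∀ x, ‖f x‖ ≤ M * Real.exp (l * (|x - a| + d))) :
    ‖∫ x in a..b, f x‖ ≤ M / l * Real.exp (l * (|b - a| + d)) := by
  refine (intervalIntegral.norm_integral_le_abs_of_norm_le (Eventually.of_forall hf)
    (Continuous.intervalIntegrable (by fun_prop) _ _)).trans ?_
  rw [intervalIntegral.integral_const_mul, abs_mul, abs_of_nonneg hM]
  calc M * _ ≤ M * (Real.exp (l * (|b - a| + d)) / l) := by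
        gcongr; exact abs_integral_exp_abs_sub_le hl a b d
    _ = _ := by ring

/-- Continuity of a parametric integral both of whose endpoints depend on the parameter. -/
theorem continuous_parametric_integral_endpoints {X E : Type*} [TopologicalSpace X]
    [FirstCountableTopology X] [LocallyCompactSpace X] [NormedAddCommGroup E] [NormedSpace ℝ E]
    {f : X → ℝ → E} (hf : Continuous (Function.uncurry f)) {p q : X → ℝ} (hp : Continuous p)
    (hq : Continuous q) : Continuous fun x => ∫ r in p x..q x, f x r := by
  have h : (fun x => ∫ r in p x..q x, f x r)
      = fun x => (∫ r in (0 : ℝ)..q x, f x r) - ∫ r in (0 : ℝ)..p x, f x r := by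
    ext x
    have hc : Continuous (f x) := hf.comp (Continuous.prodMk_right x)
    rw [intervalIntegral.integral_interval_sub_left] <;> exact hc.intervalIntegrable _ _
  rw [h]
  exact (intervalIntegral.continuous_parametric_intervalIntegral_of_continuous hf hq).sub
    (intervalIntegral.continuous_parametric_intervalIntegral_of_continuous hf hp)

end Volterra

end Goursat

end

/-! ### The adjoint Goursat problem -/

noncomputable section

namespace Goursat

open Filter Topology

section Volterra

/-- The right-hand side of the adjoint equation `S_{στ} = S K - S_σ B - S_τ C`, as a function of
the first order jet `(S, S_σ, S_τ)`. -/
def adjointRHS {𝔸 : Type*} [NormedRing 𝔸] (B C K : Plane → 𝔸) (Q : Plane) (y : 𝔸 × 𝔸 × 𝔸) : 𝔸 :=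
  y.1 * K Q - y.2.1 * B Q - y.2.2 * C Q

theorem continuous_adjointRHS {𝔸 : Type*} [NormedRing 𝔸] {B C K : Plane → 𝔸}
    (hB : Continuous B) (hC : Continuous C) (hK : Continuous K) :
    Continuous fun z : Plane × 𝔸 × 𝔸 × 𝔸 => adjointRHS B C K z.1 z.2 := by
  unfold adjointRHS
  fun_prop

variable {𝔸 : Type*} [NormedRing 𝔸] [NormedAlgebra ℝ 𝔸]

/-- The Volterra operator whose fixed points are the jets `(S, S_σ, S_τ)` of the solution of the
adjoint Goursat problem with vertex `P`. -/
def adjointVolterra (B C K : Plane → 𝔸) (y : Plane × Plane → 𝔸 × 𝔸 × 𝔸) (z : Plane × Plane) :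
    𝔸 × 𝔸 × 𝔸 :=
  ((1 - ∫ r in z.1.1..z.2.1, (y (z.1, (r, z.1.2))).1 * C (r, z.1.2))
      + ∫ r in z.1.2..z.2.2, (y (z.1, (z.2.1, r))).2.2,
    (∫ r in z.1.2..z.2.2, adjointRHS B C K (z.2.1, r) (y (z.1, (z.2.1, r))))
      - (1 - ∫ r in z.1.1..z.2.1, (y (z.1, (r, z.1.2))).1 * C (r, z.1.2)) * C (z.2.1, z.1.2),
    (∫ r in z.1.1..z.2.1, adjointRHS B C K (r, z.2.2) (y (z.1, (r, z.2.2))))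
      - (1 + ∫ r in z.1.2..z.2.2, (y (z.1, (z.1.1, r))).2.2) * B (z.1.1, z.2.2))

variable {B C K : Plane → 𝔸}

theorem continuous_adjointVolterra (hB : Continuous B) (hC : Continuous C) (hK : Continuous K)
    {y : Plane × Plane → 𝔸 × 𝔸 × 𝔸} (hy : Continuous y) :
    Continuous (adjointVolterra B C K y) := by
  have hF := continuous_adjointRHS hB hC hK
  have h1 : Continuous fun z : Plane × Plane =>
      ∫ r in z.1.1..z.2.1, (y (z.1, (r, z.1.2))).1 * C (r, z.1.2) :=
    continuous_parametric_integral_endpoints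
      (f := fun (z : Plane × Plane) r => (y (z.1, (r, z.1.2))).1 * C (r, z.1.2))
      (by unfold Function.uncurry; fun_prop) (by fun_prop) (by fun_prop)
  have h2 : Continuous fun z : Plane × Plane =>
      ∫ r in z.1.2..z.2.2, (y (z.1, (z.2.1, r))).2.2 :=
    continuous_parametric_integral_endpoints
      (f := fun (z : Plane × Plane) r => (y (z.1, (z.2.1, r))).2.2)
      (by unfold Function.uncurry; fun_prop) (by fun_prop) (by fun_prop)
  have h3 : Continuous fun z : Plane × Plane =>
      ∫ r in z.1.2..z.2.2, (y (z.1, (z.1.1, r))).2.2 :=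
    continuous_parametric_integral_endpoints
      (f := fun (z : Plane × Plane) r => (y (z.1, (z.1.1, r))).2.2)
      (by unfold Function.uncurry; fun_prop) (by fun_prop) (by fun_prop)
  have h4 : Continuous fun z : Plane × Plane =>
      ∫ r in z.1.2..z.2.2, adjointRHS B C K (z.2.1, r) (y (z.1, (z.2.1, r))) := by
    refine continuous_parametric_integral_endpoints
      (f := fun (z : Plane × Plane) r => adjointRHS B C K (z.2.1, r) (y (z.1, (z.2.1, r))))
      ?_ (by fun_prop) (by fun_prop)
    exact hF.comp (f := fun w : (Plane × Plane) × ℝ =>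
      ((w.1.2.1, w.2), y (w.1.1, (w.1.2.1, w.2)))) (by fun_prop)
  have h5 : Continuous fun z : Plane × Plane =>
      ∫ r in z.1.1..z.2.1, adjointRHS B C K (r, z.2.2) (y (z.1, (r, z.2.2))) := by
    refine continuous_parametric_integral_endpoints
      (f := fun (z : Plane × Plane) r => adjointRHS B C K (r, z.2.2) (y (z.1, (r, z.2.2))))
      ?_ (by fun_prop) (by fun_prop)
    exact hF.comp (f := fun w : (Plane × Plane) × ℝ =>
      ((w.2, w.1.2.2), y (w.1.1, (w.2, w.1.2.2)))) (by fun_prop)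
  unfold adjointVolterra
  fun_prop

/-- Every difference contains one integration, hence a factor `1 / l` with `l = 8 c²`. The
coefficients multiply it by at most `c + 1`, `3 c + c²` and `4 c` in the three components. For `c ≥
1` all of these are at most `4 c²`, which leaves the factor 1/2. -/
theorem norm_adjointVolterra_sub_le (hB : Continuous B) (hC : Continuous C) (hK : Continuous K)
    {c : ℝ} (hc : 1 ≤ c) (hBc : ∀ Q, ‖B Q‖ ≤ c) (hCc : ∀ Q, ‖C Q‖ ≤ c) (hKc : ∀ Q, ‖K Q‖ ≤ c)
    {y w : Plane × Plane → 𝔸 × 𝔸 × 𝔸} (hy : Continuous y) (hw : Continuous w) {M : ℝ}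
    (hM : 0 ≤ M) (hyw : ∀ z, ‖y z - w z‖
      ≤ M * Real.exp (8 * c ^ 2 * (|z.2.1 - z.1.1| + |z.2.2 - z.1.2|))) (z : Plane × Plane) :
    ‖adjointVolterra B C K y z - adjointVolterra B C K w z‖
      ≤ M / 2 * Real.exp (8 * c ^ 2 * (|z.2.1 - z.1.1| + |z.2.2 - z.1.2|)) := by
  obtain ⟨⟨s, t⟩, ⟨σ, τ⟩⟩ := z
  set l := 8 * c ^ 2 with hl
  have hl0 : 0 < l := by positivity
  have hF := continuous_adjointRHS hB hC hK
  have hv : ∀ z, ‖(y z).1 - (w z).1‖ ≤ M * Real.exp (l * (|z.2.1 - z.1.1| + |z.2.2 - z.1.2|)) :=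
    fun z => (norm_fst_le (y z - w z)).trans (hyw z)
  have hv2 : ∀ z, ‖(y z).2.1 - (w z).2.1‖
      ≤ M * Real.exp (l * (|z.2.1 - z.1.1| + |z.2.2 - z.1.2|)) :=
    fun z => ((norm_fst_le (y z - w z).2).trans (norm_snd_le (y z - w z))).trans (hyw z)
  have hv3 : ∀ z, ‖(y z).2.2 - (w z).2.2‖
      ≤ M * Real.exp (l * (|z.2.1 - z.1.1| + |z.2.2 - z.1.2|)) :=
    fun z => ((norm_snd_le (y z - w z).2).trans (norm_snd_le (y z - w z))).trans (hyw z)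
  have hmul : ∀ {a b : 𝔸} {m : ℝ}, ‖a‖ ≤ m → ‖b‖ ≤ c → ‖a * b‖ ≤ c * m := fun ha hb => by
    refine (norm_mul_le _ _).trans ?_
    rw [mul_comm]
    have := (norm_nonneg _).trans ha
    gcongr
  have hRHS : ∀ P Q, ‖adjointRHS B C K Q (y (P, Q)) - adjointRHS B C K Q (w (P, Q))‖
      ≤ 3 * c * M * Real.exp (l * (|Q.1 - P.1| + |Q.2 - P.2|)) := fun P Q => by
    have h : adjointRHS B C K Q (y (P, Q)) - adjointRHS B C K Q (w (P, Q))
        = ((y (P, Q)).1 - (w (P, Q)).1) * K Q - ((y (P, Q)).2.1 - (w (P, Q)).2.1) * B Q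
          - ((y (P, Q)).2.2 - (w (P, Q)).2.2) * C Q := by
      unfold adjointRHS; noncomm_ring
    rw [h]
    have e1 := hmul (hv (P, Q)) (hKc Q)
    have e2 := hmul (hv2 (P, Q)) (hBc Q)
    have e3 := hmul (hv3 (P, Q)) (hCc Q)
    refine (norm_sub_le _ _).trans ?_
    refine (add_le_add_left (norm_sub_le _ _) _).trans ?_
    simp only at e1 e2 e3 ⊢
    linarith
  set X := Real.exp (l * (|σ - s| + |τ - t|)) with hX
  have hX0 : 0 < X := Real.exp_pos _
  have hs : Real.exp (l * (|σ - s| + |t - t|)) ≤ X := by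
    refine Real.exp_le_exp.2 (mul_le_mul_of_nonneg_left ?_ hl0.le)
    rw [sub_self, abs_zero]
    linarith [abs_nonneg (τ - t)]
  have i1 : ‖(∫ r in s..σ, (y ((s, t), (r, t))).1 * C (r, t))
      - ∫ r in s..σ, (w ((s, t), (r, t))).1 * C (r, t)‖ ≤ c * M / l * X := by
    rw [← intervalIntegral.integral_sub (Continuous.intervalIntegrable (by fun_prop) _ _)
      (Continuous.intervalIntegrable (by fun_prop) _ _)]
    refine (norm_integral_le_of_norm_le_exp hl0 (M := c * M) (d := |t - t|) (by positivity)
      fun r => ?_).trans (by gcongr)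
    rw [← sub_mul, mul_assoc]
    exact hmul (hv ((s, t), (r, t))) (hCc _)
  have i2 : ∀ s', |s' - s| ≤ |σ - s| → ‖(∫ r in t..τ, (y ((s, t), (s', r))).2.2)
      - ∫ r in t..τ, (w ((s, t), (s', r))).2.2‖ ≤ M / l * X := fun s' hs' => by
    rw [← intervalIntegral.integral_sub (Continuous.intervalIntegrable (by fun_prop) _ _)
      (Continuous.intervalIntegrable (by fun_prop) _ _)]
    refine (norm_integral_le_of_norm_le_exp hl0 (M := M) (d := |s' - s|) hM
      fun r => ?_).trans ?_
    · rw [add_comm |r - t|]; exact hv3 ((s, t), (s', r))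
    · gcongr
      rw [add_comm]
      apply Real.exp_le_exp.2
      gcongr
  have hFt : ∀ {y : Plane × Plane → 𝔸 × 𝔸 × 𝔸}, Continuous y →
      Continuous fun r => adjointRHS B C K (σ, r) (y ((s, t), (σ, r))) := fun {y} hy =>
    hF.comp (f := fun r : ℝ => ((σ, r), y ((s, t), (σ, r)))) (by fun_prop)
  have hFs : ∀ {y : Plane × Plane → 𝔸 × 𝔸 × 𝔸}, Continuous y →
      Continuous fun r => adjointRHS B C K (r, τ) (y ((s, t), (r, τ))) := fun {y} hy =>
    hF.comp (f := fun r : ℝ => ((r, τ), y ((s, t), (r, τ)))) (by fun_prop)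
  have i3 : ‖(∫ r in t..τ, adjointRHS B C K (σ, r) (y ((s, t), (σ, r))))
      - ∫ r in t..τ, adjointRHS B C K (σ, r) (w ((s, t), (σ, r)))‖ ≤ 3 * c * M / l * X := by
    rw [← intervalIntegral.integral_sub ((hFt hy).intervalIntegrable _ _)
      ((hFt hw).intervalIntegrable _ _)]
    refine (norm_integral_le_of_norm_le_exp hl0 (M := 3 * c * M) (d := |σ - s|) (by positivity)
      fun r => ?_).trans (by rw [add_comm])
    rw [add_comm |r - t|]; exact hRHS (s, t) (σ, r)
  have i4 : ‖(∫ r in s..σ, adjointRHS B C K (r, τ) (y ((s, t), (r, τ))))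
      - ∫ r in s..σ, adjointRHS B C K (r, τ) (w ((s, t), (r, τ)))‖ ≤ 3 * c * M / l * X := by
    rw [← intervalIntegral.integral_sub ((hFs hy).intervalIntegrable _ _)
      ((hFs hw).intervalIntegrable _ _)]
    exact norm_integral_le_of_norm_le_exp hl0 (M := 3 * c * M) (d := |τ - t|) (by positivity)
      fun r => hRHS (s, t) (r, τ)
  have hcc : c ≤ c ^ 2 := by nlinarith
  have hfin : ∀ m, m ≤ 4 * c ^ 2 → m * M / l * X ≤ M / 2 * X := fun m hm => by
    refine mul_le_mul_of_nonneg_right ?_ hX0.le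
    rw [div_le_div_iff₀ hl0 two_pos, hl]
    nlinarith
  rw [norm_prod_le_iff, norm_prod_le_iff]
  refine ⟨?_, ?_, ?_⟩
  · simp only [adjointVolterra, Prod.fst_sub]
    refine le_trans ?_ (hfin (c + 1) (by nlinarith))
    have := add_le_add i1 (i2 σ le_rfl)
    rw [show (c + 1) * M / l * X = c * M / l * X + M / l * X by ring]
    refine le_trans ?_ this
    rw [add_comm ‖_ - _‖]
    refine le_trans (le_of_eq ?_) (norm_sub_le _ _)
    congr 1
    abel
  · simp only [adjointVolterra, Prod.fst_sub, Prod.snd_sub]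
    refine le_trans ?_ (hfin (3 * c + c * c) (by nlinarith))
    have := add_le_add i3 (hmul i1 (hCc (σ, t)))
    rw [show (3 * c + c * c) * M / l * X = 3 * c * M / l * X + c * (c * M / l * X) by ring]
    refine le_trans ?_ this
    refine le_trans (le_of_eq ?_) (norm_add_le _ _)
    congr 1
    noncomm_ring
  · simp only [adjointVolterra, Prod.snd_sub]
    refine le_trans ?_ (hfin (3 * c + c) (by nlinarith))
    have := add_le_add i4 (hmul (i2 s (by simp)) (hBc (s, τ)))
    rw [show (3 * c + c) * M / l * X = 3 * c * M / l * X + c * (M / l * X) by ring]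
    refine le_trans ?_ this
    refine le_trans (le_of_eq ?_) (norm_sub_le _ _)
    congr 1
    noncomm_ring

/-- The jet of the solution of the adjoint Goursat problem: `S P Q` solves the adjoint equation as
a function of `Q`, with characteristic data on the lines through `P`; `U` and `V` are its
derivatives. -/
structure IsAdjointRiemann (B C K : Plane → 𝔸) (S U V : Plane → Plane → 𝔸) : Prop where
  continuous_S : Continuous (Function.uncurry S)
  continuous_U : Continuous (Function.uncurry U)
  continuous_V : Continuous (Function.uncurry V)
  deriv_s : ∀ P Q, HasDerivAt (fun σ => S P (σ, Q.2)) (U P Q) Q.1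
  deriv_t : ∀ P Q, HasDerivAt (fun τ => S P (Q.1, τ)) (V P Q) Q.2
  deriv_st : ∀ P Q, HasDerivAt (fun τ => U P (Q.1, τ))
    (S P Q * K Q - U P Q * B Q - V P Q * C Q) Q.2
  deriv_ts : ∀ P Q, HasDerivAt (fun σ => V P (σ, Q.2))
    (S P Q * K Q - U P Q * B Q - V P Q * C Q) Q.1
  edge_s : ∀ P σ, U P (σ, P.2) = -(S P (σ, P.2) * C (σ, P.2))
  edge_t : ∀ P τ, V P (P.1, τ) = -(S P (P.1, τ) * B (P.1, τ))
  diagonal : ∀ P, S P P = 1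

/-- Differentiation under an integral over a fixed interval, for a jointly continuous
derivative. -/
theorem hasDerivAt_integral_of_continuous_deriv {E : Type*} [NormedAddCommGroup E]
    [NormedSpace ℝ E] {f f' : ℝ → ℝ → E} (hf : ∀ x, Continuous (f x))
    (hf' : Continuous (Function.uncurry f'))
    (hd : ∀ x r, HasDerivAt (fun x => f x r) (f' x r) x) (a b x : ℝ) :
    HasDerivAt (fun x => ∫ r in a..b, f x r) (∫ r in a..b, f' x r) x := by
  obtain ⟨M, hM⟩ := ((isCompact_Icc (a := x - 1) (b := x + 1)).prod
    (isCompact_uIcc (a := a) (b := b))).exists_bound_of_continuousOn hf'.continuousOn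
  have hfx : ∀ x, Continuous (f' x) := fun x => hf'.comp (Continuous.prodMk_right x)
  refine (intervalIntegral.hasDerivAt_integral_of_dominated_loc_of_deriv_le (bound := fun _ => M)
    (Icc_mem_nhds (by linarith : x - 1 < x) (by linarith : x < x + 1))
    (Eventually.of_forall fun x => (hf x).aestronglyMeasurable)
    ((hf x).intervalIntegrable _ _) (hfx x).aestronglyMeasurable
    (Eventually.of_forall fun r hr y hy => ?_) (by simp)
    (Eventually.of_forall fun r _ y _ => hd y r)).2
  exact hM (y, r) ⟨hy, uIoc_subset_uIcc hr⟩

/-- Existence of the Riemann function of the adjoint equation. -/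
theorem exists_isAdjointRiemann [CompleteSpace 𝔸] (hB : Continuous B) (hC : Continuous C) (hK : Continuous K)
    {c : ℝ} (hBc : ∀ Q, ‖B Q‖ ≤ c) (hCc : ∀ Q, ‖C Q‖ ≤ c) (hKc : ∀ Q, ‖K Q‖ ≤ c) :
    ∃ S U V, IsAdjointRiemann B C K S U V := by
  -- With `c ≥ 1`, both `1` and `c` are bounded by `c ^ 2`, as the contraction estimate needs.
  wlog hc : 1 ≤ c
  · exact this hB hC hK (c := max 1 c) (fun Q => (hBc Q).trans (le_max_right _ _))
      (fun Q => (hCc Q).trans (le_max_right _ _)) (fun Q => (hKc Q).trans (le_max_right _ _))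
      (le_max_left _ _)
  have hF := continuous_adjointRHS hB hC hK
  obtain ⟨y, hy, hfix⟩ := exists_continuous_fixedPoint_of_weight
    (fun z : Plane × Plane => 8 * c ^ 2 * (|z.2.1 - z.1.1| + |z.2.2 - z.1.2|)) (by fun_prop)
    (adjointVolterra B C K) (fun y hy => continuous_adjointVolterra hB hC hK hy)
    ⟨max ‖(1 : 𝔸)‖ (‖(1 : 𝔸)‖ * c), fun z => by
      have h0 : adjointVolterra B C K 0 z = (1, - C (z.2.1, z.1.2), - B (z.1.1, z.2.2)) := by
        simp [adjointVolterra, adjointRHS]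
      have h1 : 1 ≤ Real.exp (8 * c ^ 2 * (|z.2.1 - z.1.1| + |z.2.2 - z.1.2|)) :=
        Real.one_le_exp (by positivity)
      have h2 : ∀ a : 𝔸, ‖a‖ ≤ c → ‖a‖ ≤ ‖(1 : 𝔸)‖ * c := fun a ha => by
        calc ‖a‖ = ‖1 * a‖ := by rw [one_mul]
          _ ≤ ‖(1 : 𝔸)‖ * ‖a‖ := norm_mul_le _ _
          _ ≤ _ := by gcongr
      have h3 : ‖((1, - C (z.2.1, z.1.2), - B (z.1.1, z.2.2)) : 𝔸 × 𝔸 × 𝔸)‖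
          ≤ max ‖(1 : 𝔸)‖ (‖(1 : 𝔸)‖ * c) := by
        rw [norm_prod_le_iff, norm_prod_le_iff, norm_neg, norm_neg]
        exact ⟨le_max_left _ _, (h2 _ (hCc _)).trans (le_max_right _ _),
          (h2 _ (hBc _)).trans (le_max_right _ _)⟩
      rw [h0]
      exact h3.trans (le_mul_of_one_le_right ((norm_nonneg _).trans h3) h1)⟩
    (fun y w hy hw M hM h z => norm_adjointVolterra_sub_le hB hC hK hc hBc hCc hKc hy hw hM h z)
  have e1 : ∀ P Q : Plane, (y (P, Q)).1
      = (1 - ∫ r in P.1..Q.1, (y (P, (r, P.2))).1 * C (r, P.2))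
        + ∫ r in P.2..Q.2, (y (P, (Q.1, r))).2.2 := fun P Q =>
    (congrArg Prod.fst (congrFun hfix (P, Q))).symm
  have e2 : ∀ P Q : Plane, (y (P, Q)).2.1
      = (∫ r in P.2..Q.2, adjointRHS B C K (Q.1, r) (y (P, (Q.1, r))))
        - (1 - ∫ r in P.1..Q.1, (y (P, (r, P.2))).1 * C (r, P.2)) * C (Q.1, P.2) := fun P Q =>
    (congrArg (fun w => w.2.1) (congrFun hfix (P, Q))).symm
  have e3 : ∀ P Q : Plane, (y (P, Q)).2.2
      = (∫ r in P.1..Q.1, adjointRHS B C K (r, Q.2) (y (P, (r, Q.2))))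
        - (1 + ∫ r in P.2..Q.2, (y (P, (P.1, r))).2.2) * B (P.1, Q.2) := fun P Q =>
    (congrArg (fun w => w.2.2) (congrFun hfix (P, Q))).symm
  -- The operator treats the two edges differently: `S` is rebuilt from `S C` on the horizontal line
  -- through `P` and from `S_τ` on the vertical one. Both expressions are the first component at the
  -- fixed point, which turns the edge terms of the other components into the Goursat data.
  have t1 : ∀ P : Plane, ∀ σ, (y (P, (σ, P.2))).1
      = 1 - ∫ r in P.1..σ, (y (P, (r, P.2))).1 * C (r, P.2) := fun P σ => by
    rw [e1]; simp
  have t2 : ∀ P : Plane, ∀ τ, (y (P, (P.1, τ))).1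
      = 1 + ∫ r in P.2..τ, (y (P, (P.1, r))).2.2 := fun P σ => by
    rw [e1]; simp
  have hFs : ∀ P τ, Continuous fun r => adjointRHS B C K (r, τ) (y (P, (r, τ))) := fun P τ =>
    hF.comp (f := fun r : ℝ => ((r, τ), y (P, (r, τ)))) (by fun_prop)
  have hFt : ∀ P σ, Continuous fun r => adjointRHS B C K (σ, r) (y (P, (σ, r))) := fun P σ =>
    hF.comp (f := fun r : ℝ => ((σ, r), y (P, (σ, r)))) (by fun_prop)
  have dts : ∀ P Q : Plane, HasDerivAt (fun σ => (y (P, (σ, Q.2))).2.2)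
      (adjointRHS B C K Q (y (P, Q))) Q.1 := fun P Q => by
    rw [funext fun σ => e3 P (σ, Q.2)]
    dsimp only
    exact ((hFs P Q.2).integral_hasStrictDerivAt _ _).hasDerivAt.sub_const _
  refine ⟨fun P Q => (y (P, Q)).1, fun P Q => (y (P, Q)).2.1, fun P Q => (y (P, Q)).2.2,
    hy.fst, hy.snd.fst, hy.snd.snd, fun P Q => ?_, fun P Q => ?_, fun P Q => ?_, dts,
    fun P σ => ?_, fun P τ => ?_, fun P => ?_⟩
  · have h1 : HasDerivAt (fun σ => 1 - ∫ r in P.1..σ, (y (P, (r, P.2))).1 * C (r, P.2))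
        (-((y (P, (Q.1, P.2))).1 * C (Q.1, P.2))) Q.1 :=
      (Continuous.integral_hasStrictDerivAt (by fun_prop) _ _).hasDerivAt.const_sub _
    -- Differentiating the vertical integral of the third component under the integral sign, by
    -- `dts`, produces the vertical integral in the formula `e2` for the second one. Thus the second
    -- component really is the `σ`-derivative of the first.
    have h2 := hasDerivAt_integral_of_continuous_deriv (f := fun σ r => (y (P, (σ, r))).2.2)
      (f' := fun σ r => adjointRHS B C K (σ, r) (y (P, (σ, r)))) (fun σ => by fun_prop)
      (hF.comp (f := fun w : ℝ × ℝ => (w, y (P, w))) (by fun_prop))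
      (fun σ r => dts P (σ, r)) P.2 Q.2 Q.1
    have h3 := h1.add h2
    have h4 : (fun σ => (y (P, (σ, Q.2))).1)
        = fun σ => (1 - ∫ r in P.1..σ, (y (P, (r, P.2))).1 * C (r, P.2))
          + ∫ r in P.2..Q.2, (y (P, (σ, r))).2.2 := funext fun σ => e1 P (σ, Q.2)
    rw [h4]
    refine h3.congr_deriv ?_
    rw [e2, t1]
    abel
  · rw [funext fun τ => e1 P (Q.1, τ)]
    dsimp only
    exact (Continuous.integral_hasStrictDerivAt
      (f := fun r => (y (P, (Q.1, r))).2.2) (by fun_prop) _ _).hasDerivAt.const_add _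
  · rw [funext fun τ => e2 P (Q.1, τ)]
    dsimp only
    exact ((hFt P Q.1).integral_hasStrictDerivAt _ _).hasDerivAt.sub_const _
  · rw [e2, t1]; simp
  · rw [e3, t2]; simp
  · rw [e1]; simp

end Volterra

end Goursat

end

/-! ### Green's identity for the Goursat problem and its adjoint -/

noncomputable section

namespace Goursat

open Filter Topology

section Green

/-- Green's formula on a rectangle: if `X_t = Z = Y_s`, then the circulation vanishes. -/
theorem integral_sub_eq_integral_sub_of_cross_deriv {E : Type*} [NormedAddCommGroup E]
    [NormedSpace ℝ E] [CompleteSpace E] {X Y Z : Plane → E} {s₁ s₂ t₁ t₂ : ℝ} (hs : s₁ ≤ s₂)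
    (ht : t₁ ≤ t₂) (hZ : ContinuousOn Z (Icc s₁ s₂ ×ˢ Icc t₁ t₂))
    (hX : ∀ P ∈ Icc s₁ s₂ ×ˢ Icc t₁ t₂, HasDerivAt (fun t => X (P.1, t)) (Z P) P.2)
    (hY : ∀ P ∈ Icc s₁ s₂ ×ˢ Icc t₁ t₂, HasDerivAt (fun s => Y (s, P.2)) (Z P) P.1) :
    ∫ s in s₁..s₂, (X (s, t₂) - X (s, t₁)) = ∫ t in t₁..t₂, (Y (s₂, t) - Y (s₁, t)) := by
  have hZs : ∀ s ∈ Icc s₁ s₂, ContinuousOn (fun t => Z (s, t)) (Icc t₁ t₂) := fun s hs' =>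
    hZ.comp (by fun_prop) fun t ht' => ⟨hs', ht'⟩
  have hZt : ∀ t ∈ Icc t₁ t₂, ContinuousOn (fun s => Z (s, t)) (Icc s₁ s₂) := fun t ht' =>
    hZ.comp (by fun_prop) fun s hs' => ⟨hs', ht'⟩
  have h1 : ∫ s in s₁..s₂, (X (s, t₂) - X (s, t₁)) = ∫ s in s₁..s₂, ∫ t in t₁..t₂, Z (s, t) := by
    refine intervalIntegral.integral_congr fun s hs' => ?_
    rw [uIcc_of_le hs] at hs'
    refine (intervalIntegral.integral_eq_sub_of_hasDerivAt (f := fun t => X (s, t))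
      (fun t ht' => hX (s, t) ⟨hs', uIcc_of_le ht ▸ ht'⟩) ?_).symm
    exact ContinuousOn.intervalIntegrable (uIcc_of_le ht ▸ hZs s hs')
  have h2 : ∫ t in t₁..t₂, (Y (s₂, t) - Y (s₁, t)) = ∫ t in t₁..t₂, ∫ s in s₁..s₂, Z (s, t) := by
    refine intervalIntegral.integral_congr fun t ht' => ?_
    rw [uIcc_of_le ht] at ht'
    refine (intervalIntegral.integral_eq_sub_of_hasDerivAt (f := fun s => Y (s, t))
      (fun s hs' => hY (s, t) ⟨uIcc_of_le hs ▸ hs', ht'⟩) ?_).symm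
    exact ContinuousOn.intervalIntegrable (uIcc_of_le hs ▸ hZt t ht')
  rw [h1, h2, intervalIntegral_intervalIntegral_swap (F := fun s t => Z (s, t))]
  refine (hZ.integrableOn_compact (isCompact_Icc.prod isCompact_Icc)).mono_set ?_
  rw [uIoc_of_le hs, uIoc_of_le ht]
  exact prod_mono Ioc_subset_Icc_self Ioc_subset_Icc_self

variable {𝔸 : Type*} [NormedRing 𝔸] [NormedAlgebra ℝ 𝔸]

/-- `v` solves, on the rectangle with lower left corner `Q` and upper right corner `P`, the Goursat
problem `v_{st} = A v + B v_s + C v_t`, `v_s = C v` on the lower edge, `v_t = B v` on the left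
edge, `v Q = 1`. -/
structure IsGoursatSolution (A B C : Plane → 𝔸) (P Q : Plane) (v vs vt : Plane → 𝔸) : Prop where
  continuousOn : ContinuousOn v (Icc Q.1 P.1 ×ˢ Icc Q.2 P.2)
  continuousOn_s : ContinuousOn vs (Ioo Q.1 P.1 ×ˢ Ioo Q.2 P.2)
  continuousOn_t : ContinuousOn vt (Ioo Q.1 P.1 ×ˢ Ioo Q.2 P.2)
  deriv_s : ∀ X ∈ Ioo Q.1 P.1 ×ˢ Ioo Q.2 P.2, HasDerivAt (fun s => v (s, X.2)) (vs X) X.1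
  deriv_t : ∀ X ∈ Ioo Q.1 P.1 ×ˢ Ioo Q.2 P.2, HasDerivAt (fun t => v (X.1, t)) (vt X) X.2
  equation : ∀ X ∈ Ioo Q.1 P.1 ×ˢ Ioo Q.2 P.2,
    HasDerivAt (fun t => vs (X.1, t)) (A X * v X + B X * vs X + C X * vt X) X.2
  edge_s : ∀ s ∈ Icc Q.1 P.1,
    HasDerivWithinAt (fun s => v (s, Q.2)) (C (s, Q.2) * v (s, Q.2)) (Icc Q.1 P.1) s
  edge_t : ∀ t ∈ Icc Q.2 P.2,
    HasDerivWithinAt (fun t => v (Q.1, t)) (B (Q.1, t) * v (Q.1, t)) (Icc Q.2 P.2) t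
  corner : v Q = 1

variable {A B C K Bs Ct : Plane → 𝔸} {S U V : Plane → Plane → 𝔸} {P Q : Plane}
  {v vs vt : Plane → 𝔸}

/-- The Green identity for `v` and the adjoint Riemann function on a closed rectangle inside the
open domain. -/
theorem IsGoursatSolution.green [CompleteSpace 𝔸] (hv : IsGoursatSolution A B C P Q v vs vt)
    (hS : IsAdjointRiemann B C K S U V) (hA : Continuous A) (hB : Continuous B) (hC : Continuous C)
    (hCt : Continuous Ct)
    (hBs : ∀ X ∈ Ioo Q.1 P.1 ×ˢ Ioo Q.2 P.2, HasDerivAt (fun s => B (s, X.2)) (Bs X) X.1)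
    (hCt' : ∀ X ∈ Ioo Q.1 P.1 ×ˢ Ioo Q.2 P.2, HasDerivAt (fun t => C (X.1, t)) (Ct X) X.2)
    (hK : ∀ X ∈ Ioo Q.1 P.1 ×ˢ Ioo Q.2 P.2, K X = A X - Bs X - Ct X)
    {s₁ s₂ t₁ t₂ : ℝ} (hs : s₁ ≤ s₂) (ht : t₁ ≤ t₂) (hs₁ : Q.1 < s₁) (hs₂ : s₂ < P.1)
    (ht₁ : Q.2 < t₁) (ht₂ : t₂ < P.2) :
    (S P (s₂, t₂) * v (s₂, t₂) - S P (s₁, t₂) * v (s₁, t₂)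
        - ∫ s in s₁..s₂, (U P (s, t₂) + S P (s, t₂) * C (s, t₂)) * v (s, t₂))
      - (S P (s₂, t₁) * v (s₂, t₁) - S P (s₁, t₁) * v (s₁, t₁)
        - ∫ s in s₁..s₂, (U P (s, t₁) + S P (s, t₁) * C (s, t₁)) * v (s, t₁))
      = (∫ t in t₁..t₂, (V P (s₂, t) + S P (s₂, t) * B (s₂, t)) * v (s₂, t))
        - ∫ t in t₁..t₂, (V P (s₁, t) + S P (s₁, t) * B (s₁, t)) * v (s₁, t) := by
  have hSc : Continuous (S P) := hS.continuous_S.comp (Continuous.prodMk_right P)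
  have hUc : Continuous (U P) := hS.continuous_U.comp (Continuous.prodMk_right P)
  have hVc : Continuous (V P) := hS.continuous_V.comp (Continuous.prodMk_right P)
  have hsub : Icc s₁ s₂ ×ˢ Icc t₁ t₂ ⊆ Ioo Q.1 P.1 ×ˢ Ioo Q.2 P.2 :=
    prod_mono (Icc_subset_Ioo hs₁ hs₂) (Icc_subset_Ioo ht₁ ht₂)
  have hvc : ContinuousOn v (Icc s₁ s₂ ×ˢ Icc t₁ t₂) :=
    hv.continuousOn.mono (hsub.trans (prod_mono Ioo_subset_Icc_self Ioo_subset_Icc_self))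
  have hvsc := hv.continuousOn_s.mono hsub
  have hls : ∀ t ∈ Icc t₁ t₂, ∀ {f : Plane → 𝔸}, ContinuousOn f (Icc s₁ s₂ ×ˢ Icc t₁ t₂) →
      IntervalIntegrable (fun s => f (s, t)) volume s₁ s₂ := fun t ht' f hf => by
    apply ContinuousOn.intervalIntegrable
    rw [uIcc_of_le hs]
    exact hf.comp (by fun_prop) fun s hs' => ⟨hs', ht'⟩
  have hlt : ∀ s ∈ Icc s₁ s₂, ∀ {f : Plane → 𝔸}, ContinuousOn f (Icc s₁ s₂ ×ˢ Icc t₁ t₂) →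
      IntervalIntegrable (fun t => f (s, t)) volume t₁ t₂ := fun s hs' f hf => by
    apply ContinuousOn.intervalIntegrable
    rw [uIcc_of_le ht]
    exact hf.comp (by fun_prop) fun t ht' => ⟨hs', ht'⟩
  -- Integration by parts along the horizontal sides removes `vs`. The identity then involves only
  -- `v`, which is continuous up to the boundary, so it survives a passage to the closed rectangle
  -- where `vs` and `vt` need not extend.
  have hX : ∀ t ∈ Icc t₁ t₂, (S P (s₂, t) * v (s₂, t) - S P (s₁, t) * v (s₁, t)
      - ∫ s in s₁..s₂, (U P (s, t) + S P (s, t) * C (s, t)) * v (s, t))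
      = ∫ s in s₁..s₂, (S P (s, t) * vs (s, t) - S P (s, t) * C (s, t) * v (s, t)) := by
    intro t ht'
    rw [← intervalIntegral.integral_eq_sub_of_hasDerivAt (f := fun s => S P (s, t) * v (s, t))
      (f' := fun s => U P (s, t) * v (s, t) + S P (s, t) * vs (s, t))
      (fun s hs' => (hS.deriv_s P (s, t)).mul
        (hv.deriv_s (s, t) (hsub ⟨uIcc_of_le hs ▸ hs', ht'⟩)))
      (hls t ht' (f := fun X => U P X * v X + S P X * vs X) (by fun_prop)),
      ← intervalIntegral.integral_sub
      (hls t ht' (f := fun X => U P X * v X + S P X * vs X) (by fun_prop))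
      (hls t ht' (f := fun X => (U P X + S P X * C X) * v X) (by fun_prop))]
    refine intervalIntegral.integral_congr fun s _ => ?_
    noncomm_ring
  rw [hX t₂ ⟨ht, le_rfl⟩, hX t₁ ⟨le_rfl, ht⟩, ← intervalIntegral.integral_sub
    (hls t₂ ⟨ht, le_rfl⟩ (f := fun X => S P X * vs X - S P X * C X * v X) (by fun_prop))
    (hls t₁ ⟨le_rfl, ht⟩ (f := fun X => S P X * vs X - S P X * C X * v X) (by fun_prop)),
    ← intervalIntegral.integral_sub
    (hlt s₂ ⟨hs, le_rfl⟩ (f := fun X => (V P X + S P X * B X) * v X) (by fun_prop))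
    (hlt s₁ ⟨le_rfl, hs⟩ (f := fun X => (V P X + S P X * B X) * v X) (by fun_prop))]
  -- The form with components `S v_s - S C v` and `(S_τ + S B) v` is chosen so that the two
  -- equations give equal cross derivatives: `v_t` cancels in the first one, and `S_σ B v` in the
  -- second.
  refine integral_sub_eq_integral_sub_of_cross_deriv
    (X := fun X => S P X * vs X - S P X * C X * v X) (Y := fun X => (V P X + S P X * B X) * v X)
    (Z := fun X => V P X * vs X + S P X * A X * v X + S P X * B X * vs X
      - V P X * C X * v X - S P X * Ct X * v X) hs ht (by fun_prop) ?_ ?_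
  · intro X hX
    have hX' := hsub hX
    refine (((hS.deriv_t P X).mul (hv.equation X hX')).sub
      (((hS.deriv_t P X).mul (hCt' X hX')).mul (hv.deriv_t X hX'))).congr_deriv ?_
    simp only [Pi.mul_apply]
    noncomm_ring
  · intro X hX
    have hX' := hsub hX
    refine (((hS.deriv_ts P X).add ((hS.deriv_s P X).mul (hBs X hX'))).mul
      (hv.deriv_s X hX')).congr_deriv ?_
    simp only [Pi.mul_apply, Pi.add_apply, hK X hX']
    noncomm_ring

/-- The solution of the Goursat problem with vertex `Q`, evaluated at `P`, is the adjoint Riemann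
function with vertex `P`, evaluated at `Q`. -/
theorem IsGoursatSolution.apply_eq [CompleteSpace 𝔸] (hv : IsGoursatSolution A B C P Q v vs vt)
    (hS : IsAdjointRiemann B C K S U V) (hA : Continuous A) (hB : Continuous B) (hC : Continuous C)
    (hCt : Continuous Ct)
    (hBs : ∀ X ∈ Ioo Q.1 P.1 ×ˢ Ioo Q.2 P.2, HasDerivAt (fun s => B (s, X.2)) (Bs X) X.1)
    (hCt' : ∀ X ∈ Ioo Q.1 P.1 ×ˢ Ioo Q.2 P.2, HasDerivAt (fun t => C (X.1, t)) (Ct X) X.2)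
    (hK : ∀ X ∈ Ioo Q.1 P.1 ×ˢ Ioo Q.2 P.2, K X = A X - Bs X - Ct X)
    (h₁ : Q.1 < P.1) (h₂ : Q.2 < P.2) : v P = S P Q := by
  have hSc : Continuous (S P) := hS.continuous_S.comp (Continuous.prodMk_right P)
  have hUc : Continuous (U P) := hS.continuous_U.comp (Continuous.prodMk_right P)
  have hVc : Continuous (V P) := hS.continuous_V.comp (Continuous.prodMk_right P)
  -- Clamping the coordinates extends `v` continuously to the plane, so that the boundary integrals
  -- are continuous in the size of the rectangle.
  let w : Plane → 𝔸 := fun X =>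
    v (projIcc Q.1 P.1 h₁.le X.1, projIcc Q.2 P.2 h₂.le X.2)
  have hw : Continuous w := by
    have : Continuous fun X : Plane =>
      ((projIcc Q.1 P.1 h₁.le X.1 : ℝ), (projIcc Q.2 P.2 h₂.le X.2 : ℝ)) := by fun_prop
    exact hv.continuousOn.comp_continuous this fun X => ⟨Subtype.coe_prop _, Subtype.coe_prop _⟩
  have hwv : ∀ s ∈ Icc Q.1 P.1, ∀ t ∈ Icc Q.2 P.2, w (s, t) = v (s, t) := fun s hs t ht => by
    simp only [w, projIcc_of_mem _ hs, projIcc_of_mem _ ht]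
  -- The two sides of the Green identity on the rectangle shrunk by `e` on every side. They agree
  -- for small `e > 0`, hence also at `e = 0` by continuity.
  let L : ℝ → 𝔸 := fun e =>
    (S P (P.1 - e, P.2 - e) * w (P.1 - e, P.2 - e) - S P (Q.1 + e, P.2 - e) * w (Q.1 + e, P.2 - e)
        - ∫ s in (Q.1 + e)..(P.1 - e),
          (U P (s, P.2 - e) + S P (s, P.2 - e) * C (s, P.2 - e)) * w (s, P.2 - e))
      - (S P (P.1 - e, Q.2 + e) * w (P.1 - e, Q.2 + e)
        - S P (Q.1 + e, Q.2 + e) * w (Q.1 + e, Q.2 + e)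
        - ∫ s in (Q.1 + e)..(P.1 - e),
          (U P (s, Q.2 + e) + S P (s, Q.2 + e) * C (s, Q.2 + e)) * w (s, Q.2 + e))
  let M : ℝ → 𝔸 := fun e =>
    (∫ t in (Q.2 + e)..(P.2 - e),
        (V P (P.1 - e, t) + S P (P.1 - e, t) * B (P.1 - e, t)) * w (P.1 - e, t))
      - ∫ t in (Q.2 + e)..(P.2 - e),
        (V P (Q.1 + e, t) + S P (Q.1 + e, t) * B (Q.1 + e, t)) * w (Q.1 + e, t)
  have hLc : Continuous L := by
    have i1 := continuous_parametric_integral_endpoints (f := fun e s =>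
      (U P (s, P.2 - e) + S P (s, P.2 - e) * C (s, P.2 - e)) * w (s, P.2 - e))
      (by unfold Function.uncurry; fun_prop) (p := fun e => Q.1 + e) (q := fun e => P.1 - e)
      (by fun_prop) (by fun_prop)
    have i2 := continuous_parametric_integral_endpoints (f := fun e s =>
      (U P (s, Q.2 + e) + S P (s, Q.2 + e) * C (s, Q.2 + e)) * w (s, Q.2 + e))
      (by unfold Function.uncurry; fun_prop) (p := fun e => Q.1 + e) (q := fun e => P.1 - e)
      (by fun_prop) (by fun_prop)
    fun_prop
  have hMc : Continuous M := by
    have i1 := continuous_parametric_integral_endpoints (f := fun e t =>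
      (V P (P.1 - e, t) + S P (P.1 - e, t) * B (P.1 - e, t)) * w (P.1 - e, t))
      (by unfold Function.uncurry; fun_prop) (p := fun e => Q.2 + e) (q := fun e => P.2 - e)
      (by fun_prop) (by fun_prop)
    have i2 := continuous_parametric_integral_endpoints (f := fun e t =>
      (V P (Q.1 + e, t) + S P (Q.1 + e, t) * B (Q.1 + e, t)) * w (Q.1 + e, t))
      (by unfold Function.uncurry; fun_prop) (p := fun e => Q.2 + e) (q := fun e => P.2 - e)
      (by fun_prop) (by fun_prop)
    fun_prop
  have hLM : ∀ᶠ e in 𝓝[>] (0 : ℝ), L e = M e := by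
    have hm : 0 < min (P.1 - Q.1) (P.2 - Q.2) / 2 := by
      have := lt_min (sub_pos.2 h₁) (sub_pos.2 h₂); positivity
    filter_upwards [Ioo_mem_nhdsGT hm] with e he
    have h1 : e < (P.1 - Q.1) / 2 := by
      linarith [he.2, min_le_left (P.1 - Q.1) (P.2 - Q.2)]
    have h2 : e < (P.2 - Q.2) / 2 := by
      linarith [he.2, min_le_right (P.1 - Q.1) (P.2 - Q.2)]
    have he0 := he.1
    have hg := hv.green hS hA hB hC hCt hBs hCt' hK (s₁ := Q.1 + e) (s₂ := P.1 - e)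
      (t₁ := Q.2 + e) (t₂ := P.2 - e) (by linarith) (by linarith) (by linarith) (by linarith)
      (by linarith) (by linarith)
    have m1 : Q.1 + e ∈ Icc Q.1 P.1 := ⟨by linarith, by linarith⟩
    have m2 : P.1 - e ∈ Icc Q.1 P.1 := ⟨by linarith, by linarith⟩
    have m3 : Q.2 + e ∈ Icc Q.2 P.2 := ⟨by linarith, by linarith⟩
    have m4 : P.2 - e ∈ Icc Q.2 P.2 := ⟨by linarith, by linarith⟩
    have ms : ∀ s ∈ uIcc (Q.1 + e) (P.1 - e), s ∈ Icc Q.1 P.1 := fun s hs => by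
      rw [uIcc_of_le (by linarith)] at hs
      exact ⟨m1.1.trans hs.1, hs.2.trans m2.2⟩
    have mt : ∀ t ∈ uIcc (Q.2 + e) (P.2 - e), t ∈ Icc Q.2 P.2 := fun t ht => by
      rw [uIcc_of_le (by linarith)] at ht
      exact ⟨m3.1.trans ht.1, ht.2.trans m4.2⟩
    simp only [L, M]
    rw [hwv _ m2 _ m4, hwv _ m1 _ m4, hwv _ m2 _ m3, hwv _ m1 _ m3,
      intervalIntegral.integral_congr (fun s hs => by simp only [hwv s (ms s hs) _ m4]; rfl),
      intervalIntegral.integral_congr (f := fun s =>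
        (U P (s, Q.2 + e) + S P (s, Q.2 + e) * C (s, Q.2 + e)) * w (s, Q.2 + e))
        (fun s hs => by simp only [hwv s (ms s hs) _ m3]; rfl),
      intervalIntegral.integral_congr (f := fun t =>
        (V P (P.1 - e, t) + S P (P.1 - e, t) * B (P.1 - e, t)) * w (P.1 - e, t))
        (fun t ht => by simp only [hwv _ m2 t (mt t ht)]; rfl),
      intervalIntegral.integral_congr (f := fun t =>
        (V P (Q.1 + e, t) + S P (Q.1 + e, t) * B (Q.1 + e, t)) * w (Q.1 + e, t))
        (fun t ht => by simp only [hwv _ m1 t (mt t ht)]; rfl)]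
    exact hg
  have h0 : L 0 = M 0 :=
    tendsto_nhds_unique_of_eventuallyEq (hLc.continuousAt.mono_left nhdsWithin_le_nhds)
      (hMc.continuousAt.mono_left nhdsWithin_le_nhds) hLM
  have q1 : Q.1 ∈ Icc Q.1 P.1 := left_mem_Icc.2 h₁.le
  have q2 : Q.2 ∈ Icc Q.2 P.2 := left_mem_Icc.2 h₂.le
  have p1 : P.1 ∈ Icc Q.1 P.1 := right_mem_Icc.2 h₁.le
  have p2 : P.2 ∈ Icc Q.2 P.2 := right_mem_Icc.2 h₂.le
  -- The sides through `P` vanish by the edge conditions on `S`. On the sides through `Q` the edge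
  -- conditions on `v` make the integrands total derivatives of `S v`. After cancellation only the
  -- corner values at `P` and `Q` survive.
  have top : ∫ s in Q.1..P.1, (U P (s, P.2) + S P (s, P.2) * C (s, P.2)) * w (s, P.2) = 0 := by
    simp [hS.edge_s]
  have right : ∫ t in Q.2..P.2, (V P (P.1, t) + S P (P.1, t) * B (P.1, t)) * w (P.1, t) = 0 := by
    simp [hS.edge_t]
  have bottom : ∫ s in Q.1..P.1, (U P (s, Q.2) + S P (s, Q.2) * C (s, Q.2)) * w (s, Q.2)
      = S P (P.1, Q.2) * w (P.1, Q.2) - S P (Q.1, Q.2) * w (Q.1, Q.2) := by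
    refine intervalIntegral.integral_eq_sub_of_hasDerivAt_of_le
      (f := fun s => S P (s, Q.2) * w (s, Q.2)) h₁.le (by fun_prop) (fun s hs => ?_)
      (Continuous.intervalIntegrable (by fun_prop) _ _)
    have hs' := Ioo_subset_Icc_self hs
    have hn : Icc Q.1 P.1 ∈ 𝓝 s := Icc_mem_nhds hs.1 hs.2
    have h1 : HasDerivAt (fun s => w (s, Q.2)) (C (s, Q.2) * w (s, Q.2)) s := by
      rw [hwv s hs' _ q2]
      refine ((hv.edge_s s hs').hasDerivAt hn).congr_of_eventuallyEq ?_
      filter_upwards [hn] with r hr using hwv r hr _ q2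
    refine ((hS.deriv_s P (s, Q.2)).mul h1).congr_deriv ?_
    noncomm_ring
  have left : ∫ t in Q.2..P.2, (V P (Q.1, t) + S P (Q.1, t) * B (Q.1, t)) * w (Q.1, t)
      = S P (Q.1, P.2) * w (Q.1, P.2) - S P (Q.1, Q.2) * w (Q.1, Q.2) := by
    refine intervalIntegral.integral_eq_sub_of_hasDerivAt_of_le
      (f := fun t => S P (Q.1, t) * w (Q.1, t)) h₂.le (by fun_prop) (fun t ht => ?_)
      (Continuous.intervalIntegrable (by fun_prop) _ _)
    have ht' := Ioo_subset_Icc_self ht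
    have hn : Icc Q.2 P.2 ∈ 𝓝 t := Icc_mem_nhds ht.1 ht.2
    have h1 : HasDerivAt (fun t => w (Q.1, t)) (B (Q.1, t) * w (Q.1, t)) t := by
      rw [hwv _ q1 t ht']
      refine ((hv.edge_t t ht').hasDerivAt hn).congr_of_eventuallyEq ?_
      filter_upwards [hn] with r hr using hwv _ q1 r hr
    refine ((hS.deriv_t P (Q.1, t)).mul h1).congr_deriv ?_
    noncomm_ring
  simp only [L, M, add_zero, sub_zero, top, right, bottom, left] at h0
  rw [hwv _ p1 _ p2, hwv _ q1 _ q2, hv.corner, hS.diagonal P, mul_one, one_mul] at h0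
  rw [← sub_eq_zero]
  rw [← sub_eq_zero] at h0
  rw [← h0]
  abel

end Green

end Goursat

end

/-! ### Leibniz rules for moving cut-offs -/

noncomputable section

namespace Goursat

open Filter Topology

section Leibniz

/-- Leibniz rule for `∫_{x ≤ φ} w(a) κ(a, x) dm(a)`: the derivative that comes from the moving
domain (with frozen integrand) and the one that comes from the integrand add up. -/
theorem hasDerivAt_integral_superlevel {α : Type*} [MeasurableSpace α] {m : Measure α}
    {φ w : α → ℝ} (hφ : AEMeasurable φ m) (hw : Integrable w m) {κ κ' : α → ℝ → ℝ} {x₀ d M : ℝ}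
    (hκ : ∀ x, AEStronglyMeasurable (fun a => κ a x) m)
    (hκd : ∀ a x, HasDerivAt (κ a) (κ' a x) x)
    (hM : ∀ᵐ a ∂m, |κ a x₀| ≤ M) (hM' : ∀ᵐ a ∂m, ∀ x ∈ Icc (x₀ - 1) (x₀ + 1), |κ' a x| ≤ M)
    (hnull : ∀ᵐ a ∂m, φ a ≠ x₀)
    (hfix : HasDerivAt (fun x => ∫ a in {a | x ≤ φ a}, w a * κ a x₀ ∂m) d x₀) :
    HasDerivAt (fun x => ∫ a in {a | x ≤ φ a}, w a * κ a x ∂m)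
      (d + ∫ a in {a | x₀ ≤ φ a}, w a * κ' a x₀ ∂m) x₀ := by
  have hI : Icc (x₀ - 1) (x₀ + 1) ∈ 𝓝 x₀ := Icc_mem_nhds (by linarith) (by linarith)
  have hx₀ : x₀ ∈ Icc (x₀ - 1) (x₀ + 1) := mem_of_mem_nhds hI
  have hset : ∀ x, NullMeasurableSet {a | x ≤ φ a} m := fun x =>
    hφ.nullMeasurableSet_preimage measurableSet_Ici
  have hlip : ∀ᵐ a ∂m, ∀ x ∈ Icc (x₀ - 1) (x₀ + 1), |κ a x - κ a x₀| ≤ M * |x - x₀| := by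
    filter_upwards [hM'] with a ha x hx
    exact (convex_Icc _ _).norm_image_sub_le_of_norm_hasDerivWithin_le
      (fun y _ => (hκd a y).hasDerivWithinAt) (fun y hy => ha y hy) hx₀ hx
  have hint : ∀ x ∈ Icc (x₀ - 1) (x₀ + 1), Integrable (fun a => w a * κ a x) m := by
    intro x hx
    refine hw.mul_bdd (c := M + M * |x - x₀|) (hκ x) ?_
    filter_upwards [hM, hlip] with a h1 h2
    have h3 := h2 x hx
    rw [Real.norm_eq_abs]
    calc |κ a x| = |κ a x₀ + (κ a x - κ a x₀)| := by ring_nf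
      _ ≤ _ := (abs_add_le _ _).trans (add_le_add h1 h3)
  -- Splits off the frozen integrand, which `hfix` covers. The rest is `O(x - x₀)` pointwise, so its
  -- difference quotients are dominated by `|w| * M`.
  let F : ℝ → α → ℝ := fun x => {a | x ≤ φ a}.indicator fun a => w a * κ a x - w a * κ a x₀
  have hF : HasDerivAt (fun x => ∫ a, F x a ∂m) (∫ a in {a | x₀ ≤ φ a}, w a * κ' a x₀ ∂m) x₀ := by
    rw [← integral_indicator₀ (hset x₀), hasDerivAt_iff_tendsto_slope]
    have hF₀ : ∫ a, F x₀ a ∂m = 0 := by simp [F]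
    have hs : ∀ x, slope (fun x => ∫ a, F x a ∂m) x₀ x = ∫ a, (x - x₀)⁻¹ * F x a ∂m := fun x => by
      rw [slope_def_field, hF₀, sub_zero, integral_const_mul, div_eq_inv_mul]
    refine Tendsto.congr (fun x => (hs x).symm) ?_
    refine tendsto_integral_filter_of_dominated_convergence (fun a => |w a| * M) ?_ ?_
      (hw.abs.mul_const M) ?_
    · filter_upwards with x
      refine AEStronglyMeasurable.const_mul ?_ _
      exact ((hw.aestronglyMeasurable.mul (hκ x)).sub
        (hw.aestronglyMeasurable.mul (hκ x₀))).indicator₀ (hset x)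
    · filter_upwards [self_mem_nhdsWithin, mem_nhdsWithin_of_mem_nhds hI] with x hx hxI
      filter_upwards [hlip] with a ha
      have hx' : 0 < |x - x₀| := abs_pos.2 (sub_ne_zero.2 hx)
      have h1 : |w a * κ a x - w a * κ a x₀| ≤ |w a| * M * |x - x₀| := by
        rw [← mul_sub, abs_mul, mul_assoc]
        exact mul_le_mul_of_nonneg_left (ha x hxI) (abs_nonneg _)
      have h2 : |F x a| ≤ |w a| * M * |x - x₀| :=
        (norm_indicator_le_norm_self (fun a => w a * κ a x - w a * κ a x₀) a).trans h1
      rw [Real.norm_eq_abs, abs_mul, abs_inv, inv_mul_le_iff₀ hx', mul_comm |x - x₀|]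
      exact h2
    -- Off the level set `φ = x₀`, membership in the superlevel set is constant for `x` near `x₀`.
    · filter_upwards [hnull] with a ha
      rcases lt_or_gt_of_ne ha with h | h
      · rw [indicator_of_notMem (show a ∉ {a | x₀ ≤ φ a} from not_le.2 h)]
        refine tendsto_const_nhds.congr' ?_
        filter_upwards [mem_nhdsWithin_of_mem_nhds (Ioi_mem_nhds h)] with x hx
        simp only [F]
        rw [indicator_of_notMem (show a ∉ {a | x ≤ φ a} from not_le.2 (mem_Ioi.1 hx)), mul_zero]
      · rw [indicator_of_mem (show a ∈ {a | x₀ ≤ φ a} from h.le)]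
        have h2 := (((hκd a x₀).const_mul (w a))).tendsto_slope
        refine h2.congr' ?_
        filter_upwards [mem_nhdsWithin_of_mem_nhds (Iio_mem_nhds h)] with x hx
        simp only [F]
        rw [indicator_of_mem (show a ∈ {a | x ≤ φ a} from (mem_Iio.1 hx).le), slope_def_field,
          div_eq_inv_mul]
  refine (hfix.add hF).congr_of_eventuallyEq ?_
  filter_upwards [hI] with x hx
  simp only [Pi.add_apply, F]
  rw [integral_indicator₀ (hset x), integral_sub (hint x hx).integrableOn
    (hint x₀ hx₀).integrableOn]
  ring

/-- The derivative of `∫_x^∞ y` at a point of continuity of `y`. -/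
theorem hasDerivAt_integral_Ici {y : ℝ → ℝ} (hy : Integrable y) {x₀ : ℝ}
    (hc : ContinuousAt y x₀) : HasDerivAt (fun x => ∫ t in Ici x, y t) (-y x₀) x₀ := by
  have h1 : HasDerivAt (fun x => ∫ t in x₀..x, y t) (y x₀) x₀ :=
    intervalIntegral.integral_hasDerivAt_right (by simp)
      ⟨univ, univ_mem, hy.aestronglyMeasurable.restrict⟩ hc
  have h2 : (fun x => ∫ t in Ici x, y t) = fun x => (∫ t in Ici x₀, y t) - ∫ t in x₀..x, y t := by
    ext x
    rw [← intervalIntegral.integral_Ici_sub_Ici' hy.integrableOn hy.integrableOn]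
    ring
  rw [h2]
  exact h1.const_sub _

/-- Off the frontier, the indicator is locally either the function or zero. -/
theorem continuousAt_indicator_of_notMem_frontier {X : Type*} [TopologicalSpace X] {Ω : Set X}
    {w : X → ℝ} {p : X} (hw : ContinuousAt w p) (hp : p ∉ frontier Ω) :
    ContinuousAt (Ω.indicator w) p := by
  by_cases h : p ∈ Ω
  · have : p ∈ interior Ω := by
      by_contra h'
      exact hp ⟨subset_closure h, h'⟩
    refine hw.congr ?_
    filter_upwards [mem_interior_iff_mem_nhds.1 this] with x hx
    rw [indicator_of_mem hx]
  · have : p ∉ closure Ω := fun h' => hp ⟨h', fun h'' => h (interior_subset h'')⟩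
    refine continuousAt_const.congr (f := fun _ => (0 : ℝ)) ?_
    filter_upwards [isClosed_closure.isOpen_compl.mem_nhds this] with x hx
    rw [indicator_of_notMem fun h => hx (subset_closure h)]

/-- The derivative of `∫_{Ω ∩ {x ≤ s}} w` is the integral of `-w` over a slice of `Ω`. -/
theorem hasDerivAt_integral_halfPlane {Ω : Set Plane} (hΩ : MeasurableSet Ω)
    (hb : Bornology.IsBounded Ω) {w : Plane → ℝ} (hw : Continuous w) {x₀ : ℝ}
    (hfr : ∀ᵐ t : ℝ, (x₀, t) ∉ frontier Ω) :
    HasDerivAt (fun x => ∫ P in {P : Plane | x ≤ P.1}, w P ∂(volume.restrict Ω))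
      (-∫ t in {t | (x₀, t) ∈ Ω}, w (x₀, t)) x₀ := by
  obtain ⟨r, hr⟩ := hb.subset_closedBall 0
  have hcpt : IsCompact (Metric.closedBall (0 : Plane) r) := isCompact_closedBall 0 r
  obtain ⟨M, hM⟩ := hcpt.exists_bound_of_continuousOn hw.continuousOn
  have hball : ∀ P ∈ Ω, P.2 ∈ Icc (-r) r := fun P hP => by
    have h1 := mem_closedBall_zero_iff.1 (hr hP)
    exact abs_le.1 ((norm_snd_le P).trans h1)
  have hint : Integrable (Ω.indicator w) := by
    rw [integrable_indicator_iff hΩ]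
    exact (hw.continuousOn.integrableOn_compact hcpt).mono_set hr
  let y : ℝ → ℝ := fun s => ∫ t, Ω.indicator w (s, t)
  have hprod : Integrable (Ω.indicator w) ((volume : Measure ℝ).prod volume) := hint
  have hy : Integrable y := hprod.integral_prod_left
  -- The slice integral is continuous at `x₀` because the line over `x₀` meets the frontier of `Ω`
  -- in a null set: for almost every `t` the indicator is continuous at `(x₀, t)`.
  have hyc : ContinuousAt y x₀ := by
    refine tendsto_integral_filter_of_dominated_convergence
      ((Icc (-r) r).indicator fun _ => M) ?_ ?_ ?_ ?_
    · filter_upwards with s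
      exact ((hw.measurable.indicator hΩ).comp measurable_prodMk_left).aestronglyMeasurable
    · filter_upwards with s
      filter_upwards with t
      by_cases h : (s, t) ∈ Ω
      · rw [indicator_of_mem h, indicator_of_mem (hball _ h)]
        exact hM _ (hr h)
      · rw [indicator_of_notMem h, norm_zero]
        by_cases h' : t ∈ Icc (-r) r
        · rw [indicator_of_mem h']
          exact (norm_nonneg _).trans (hM 0 (Metric.mem_closedBall_self (by
            linarith [h'.1, h'.2])))
        · rw [indicator_of_notMem h']
    · exact (integrable_indicator_iff measurableSet_Icc).2 (by simp)
    · filter_upwards [hfr] with t ht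
      have h1 := continuousAt_indicator_of_notMem_frontier hw.continuousAt ht
      exact ContinuousAt.comp (f := fun s : ℝ => (s, t)) (g := Ω.indicator w) h1 (by fun_prop)
  have h1 : (fun x => ∫ P in {P : Plane | x ≤ P.1}, w P ∂(volume.restrict Ω))
      = fun x => ∫ s in Ici x, y s := by
    ext x
    have hm : MeasurableSet {P : Plane | x ≤ P.1} := measurableSet_le measurable_const measurable_fst
    have h2 : {P : Plane | x ≤ P.1} = Ici x ×ˢ univ := by ext P; simp
    rw [Measure.restrict_restrict hm, ← setIntegral_indicator hΩ, h2, Measure.volume_eq_prod,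
      setIntegral_prod _ hprod.integrableOn]
    simp [y]
  have h3 : ∫ t in {t | (x₀, t) ∈ Ω}, w (x₀, t) = y x₀ := by
    have hm : MeasurableSet {t | (x₀, t) ∈ Ω} := measurable_prodMk_left hΩ
    rw [← integral_indicator hm]
    rfl
  rw [h1, h3]
  exact hasDerivAt_integral_Ici hy hyc

/-- The derivative of `∫_{x ≤ L} w` for a decreasing function `L` with nonzero slope at the
crossing. -/
theorem hasDerivAt_integral_antitone {L w : ℝ → ℝ} {a b μ₀ L' : ℝ} (hL : AntitoneOn L (Icc a b))
    (hμ₀ : μ₀ ∈ Ioo a b) (hL' : HasStrictDerivAt L L' μ₀) (hne : L' ≠ 0)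
    (hw : IntegrableOn w (Icc a b)) (hwc : ContinuousAt w μ₀) :
    HasDerivAt (fun x => ∫ μ in {μ | x ≤ L μ}, w μ ∂(volume.restrict (Icc a b)))
      (w μ₀ / L') (L μ₀) := by
  have hab : a ≤ b := (hμ₀.1.trans hμ₀.2).le
  set α := hL'.localInverse L L' μ₀ hne with hα
  have hαd : HasDerivAt α L'⁻¹ (L μ₀) := (hL'.to_localInverse hne).hasDerivAt
  have hleft : ∀ᶠ μ in 𝓝 μ₀, α (L μ) = μ := hL'.eventually_left_inverse hne
  have hright : ∀ᶠ x in 𝓝 (L μ₀), L (α x) = x := hL'.eventually_right_inverse hne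
  have hα₀ : α (L μ₀) = μ₀ := hleft.self_of_nhds
  obtain ⟨ε, hε, hball⟩ := Metric.eventually_nhds_iff_ball.1
    (hleft.and (Ioo_mem_nhds hμ₀.1 hμ₀.2))
  have hαt : Tendsto α (𝓝 (L μ₀)) (𝓝 μ₀) := by
    have := hαd.continuousAt.tendsto
    rwa [hα₀] at this
  -- By monotonicity the superlevel set is an initial interval ending at the local inverse `α x`.
  -- The claim then follows from the fundamental theorem of calculus and the chain rule.
  have hev : ∀ᶠ x in 𝓝 (L μ₀), (∫ μ in {μ | x ≤ L μ}, w μ ∂(volume.restrict (Icc a b)))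
      = ∫ μ in a..α x, w μ := by
    filter_upwards [hright, hαt.eventually (Metric.ball_mem_nhds μ₀ hε)] with x hx hxb
    have hxI := (hball _ hxb).2
    rw [intervalIntegral.integral_of_le hxI.1.le, ← integral_Icc_eq_integral_Ioc,
      Measure.restrict_restrict₀' measurableSet_Icc.nullMeasurableSet]
    congr 2
    ext μ
    simp only [mem_inter_iff, mem_ofPred_eq, mem_Icc]
    constructor
    · rintro ⟨h1, h2⟩
      refine ⟨h2.1, ?_⟩
      -- If `L` were still at least `x` beyond `α x`, it would equal `x` on a stretch to the right
      -- of `α x`. There `α` inverts `L`, so each such point would equal `α x`.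
      by_contra! h3
      have hlt : α x < μ₀ + ε := by
        have := Metric.mem_ball.1 hxb
        rw [Real.dist_eq] at this
        linarith [(abs_lt.1 this).2]
      obtain ⟨ν, hν1, hν2⟩ := exists_between (lt_min h3 hlt)
      have hνb : ν ∈ Metric.ball μ₀ ε := by
        have := Metric.mem_ball.1 hxb
        rw [Real.dist_eq] at this
        rw [Metric.mem_ball, Real.dist_eq, abs_lt]
        exact ⟨by linarith [(abs_lt.1 this).1], by linarith [min_le_right μ (μ₀ + ε)]⟩
      have hνI := Ioo_subset_Icc_self (hball _ hνb).2
      have e1 : L ν ≤ x := by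
        have := hL (Ioo_subset_Icc_self hxI) hνI hν1.le
        rwa [hx] at this
      have e2 : x ≤ L ν := h1.trans (hL hνI h2 (hν2.le.trans (min_le_left _ _)))
      have e3 : ν = α x := by rw [← (hball _ hνb).1, le_antisymm e1 e2]
      exact hν1.ne' e3
    · rintro ⟨h1, h2⟩
      have hμI : μ ∈ Icc a b := ⟨h1, h2.trans hxI.2.le⟩
      refine ⟨?_, hμI⟩
      have := hL hμI (Ioo_subset_Icc_self hxI) h2
      rwa [hx] at this
  have hFTC : HasDerivAt (fun u => ∫ μ in a..u, w μ) (w μ₀) μ₀ := by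
    refine intervalIntegral.integral_hasDerivAt_right ?_ ?_ hwc
    · rw [intervalIntegrable_iff_integrableOn_Icc_of_le hμ₀.1.le]
      exact hw.mono_set (Icc_subset_Icc_right hμ₀.2.le)
    · exact ⟨Icc a b, Icc_mem_nhds hμ₀.1 hμ₀.2, hw.aestronglyMeasurable⟩
  rw [← hα₀] at hFTC
  have h := hFTC.comp (L μ₀) hαd
  rw [hα₀] at h
  exact h.congr_of_eventuallyEq hev

/-- The counterpart of `hasDerivAt_integral_antitone` for an increasing function. -/
theorem hasDerivAt_integral_monotone {L w : ℝ → ℝ} {a b μ₀ L' : ℝ} (hL : MonotoneOn L (Icc a b))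
    (hμ₀ : μ₀ ∈ Ioo a b) (hL' : HasStrictDerivAt L L' μ₀) (hne : L' ≠ 0)
    (hw : IntegrableOn w (Icc a b)) (hwc : ContinuousAt w μ₀) :
    HasDerivAt (fun x => ∫ μ in {μ | x ≤ L μ}, w μ ∂(volume.restrict (Icc a b)))
      (-(w μ₀ / L')) (L μ₀) := by
  have hmem : ∀ μ, μ ∈ Icc (-b) (-a) ↔ -μ ∈ Icc a b := fun μ => by
    simp only [mem_Icc]; constructor <;> rintro ⟨h1, h2⟩ <;> constructor <;> linarith
  -- The reflection `μ ↦ -μ` preserves the measure and reduces the increasing case to the decreasing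
  -- one.
  have hmp : MeasurePreserving (fun μ : ℝ => -μ) (volume.restrict (Icc (-b) (-a)))
      (volume.restrict (Icc a b)) := by
    have h := (Measure.measurePreserving_neg (volume : Measure ℝ)).restrict_preimage
      (s := Icc a b) measurableSet_Icc
    have h' : Neg.neg ⁻¹' Icc a b = Icc (-b) (-a) := by ext μ; exact (hmem μ).symm
    rw [h'] at h
    exact h
  have hd : HasStrictDerivAt (fun μ => L (-μ)) (-L') (-μ₀) := by
    have h1 : HasStrictDerivAt (fun μ : ℝ => -μ) (-1) (-μ₀) := (hasStrictDerivAt_id _).neg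
    have h2 : HasStrictDerivAt L L' (- -μ₀) := by rwa [neg_neg]
    have := h2.comp (-μ₀) h1
    rwa [mul_neg_one] at this
  have h := hasDerivAt_integral_antitone (L := fun μ => L (-μ)) (w := fun μ => w (-μ))
    (a := -b) (b := -a) (μ₀ := -μ₀) (L' := -L')
    (fun μ hμ ν hν h => hL ((hmem ν).1 hν) ((hmem μ).1 hμ) (neg_le_neg h))
    ⟨neg_lt_neg hμ₀.2, neg_lt_neg hμ₀.1⟩ hd (neg_ne_zero.2 hne)
    (hmp.integrable_comp_of_integrable hw)
    (ContinuousAt.comp (f := fun μ : ℝ => -μ) (by simpa using hwc) (by fun_prop))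
  simp only [neg_neg, div_neg] at h
  refine h.congr_of_eventuallyEq (Eventually.of_forall fun x => ?_)
  have he : MeasurableEmbedding (fun μ : ℝ => -μ) := (MeasurableEquiv.neg ℝ).measurableEmbedding
  simp only
  rw [← hmp.setIntegral_preimage_emb he]
  rfl

end Leibniz

end Goursat

end

/-! ### Geometry of the curvilinear domain -/

noncomputable section

namespace Goursat

open Filter Topology

theorem mem_W {P Q : Plane} : Q ∈ W P ↔ 0 ≤ Q.1 ∧ Q.1 ≤ P.1 ∧ 0 ≤ Q.2 ∧ Q.2 ≤ P.2 := Iff.rfl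

/-- A function with nonzero derivative at `μ₀` is not constant between `μ₀` and another point. -/
theorem eq_of_const_of_hasDerivAt_ne_zero {L : ℝ → ℝ} {μ μ₀ L' : ℝ} (hd : HasDerivAt L L' μ₀)
    (hne : L' ≠ 0) (hc : ∀ ν ∈ uIcc μ₀ μ, L ν = L μ₀) : μ = μ₀ := by
  by_contra h
  have hu : UniqueDiffWithinAt ℝ (uIcc μ₀ μ) μ₀ :=
    uniqueDiffOn_Icc (min_lt_max.2 (Ne.symm h)) μ₀ left_mem_uIcc
  have h1 : HasDerivWithinAt L 0 (uIcc μ₀ μ) μ₀ :=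
    (hasDerivWithinAt_const μ₀ _ (L μ₀)).congr hc rfl
  exact hne (hu.eq_deriv _ hd.hasDerivWithinAt h1)

namespace CurvilinearDomain

variable (D : CurvilinearDomain)

theorem ell_pos : 0 < D.ℓ := by
  rw [← D.vpar_zero, ← D.vpar_last]
  exact D.vpar_strictMono (Fin.last_pos)

theorem vpar_mem (r : Fin (D.N + 2)) : D.vpar r ∈ Icc 0 D.ℓ := by
  rw [← D.vpar_zero, ← D.vpar_last]
  exact ⟨D.vpar_strictMono.monotone (Fin.zero_le r), D.vpar_strictMono.monotone (Fin.le_last r)⟩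

theorem zero_mem : (0 : ℝ) ∈ Icc 0 D.ℓ := left_mem_Icc.2 D.ell_pos.le

theorem ell_mem : D.ℓ ∈ Icc 0 D.ℓ := right_mem_Icc.2 D.ell_pos.le

theorem arc_subset (r : Fin (D.N + 1)) : Icc (D.vpar r.castSucc) (D.vpar r.succ) ⊆ Icc 0 D.ℓ :=
  Icc_subset_Icc (D.vpar_mem _).1 (D.vpar_mem _).2

theorem openArc_subset (r : Fin (D.N + 1)) :
    Ioo (D.vpar r.castSucc) (D.vpar r.succ) ⊆ Ioo 0 D.ℓ :=
  Ioo_subset_Ioo (D.vpar_mem _).1 (D.vpar_mem _).2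

theorem vpar_lt (r : Fin (D.N + 1)) : D.vpar r.castSucc < D.vpar r.succ :=
  D.vpar_strictMono Fin.castSucc_lt_succ

/-- If no arc contained `μ`, induction would place every vertex at or before `μ`, and then the last
arc would contain it. -/
theorem exists_arc {μ : ℝ} (hμ : μ ∈ Icc 0 D.ℓ) :
    ∃ r : Fin (D.N + 1), μ ∈ Icc (D.vpar r.castSucc) (D.vpar r.succ) := by
  by_contra! h
  have key : ∀ r : Fin (D.N + 2), D.vpar r ≤ μ := by
    intro r
    induction r using Fin.induction with
    | zero => rw [D.vpar_zero]; exact hμ.1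
    | succ i ih =>
      by_contra! h'
      exact h i ⟨ih, h'.le⟩
  refine h (Fin.last D.N) ⟨key _, ?_⟩
  rw [Fin.succ_last, D.vpar_last]
  exact hμ.2

theorem exists_openArc {μ : ℝ} (hμ : μ ∈ Icc 0 D.ℓ) (hv : ∀ r, μ ≠ D.vpar r) :
    ∃ r : Fin (D.N + 1), μ ∈ Ioo (D.vpar r.castSucc) (D.vpar r.succ) := by
  obtain ⟨r, hr⟩ := D.exists_arc hμ
  exact ⟨r, lt_of_le_of_ne hr.1 (hv _).symm, lt_of_le_of_ne hr.2 (hv _)⟩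

theorem Icc_eq_iUnion :
    Icc 0 D.ℓ = ⋃ r : Fin (D.N + 1), Icc (D.vpar r.castSucc) (D.vpar r.succ) := by
  ext μ
  rw [mem_iUnion]
  exact ⟨fun h => D.exists_arc h, fun ⟨r, hr⟩ => D.arc_subset r hr⟩

theorem continuousOn_of_arcs {E : Type*} [TopologicalSpace E] {g : ℝ → E}
    (h : ∀ r : Fin (D.N + 1), ContinuousOn g (Icc (D.vpar r.castSucc) (D.vpar r.succ))) :
    ContinuousOn g (Icc 0 D.ℓ) := by
  rw [D.Icc_eq_iUnion]
  exact (locallyFinite_of_finite _).continuousOn_iUnion (fun r => isClosed_Icc) h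

theorem continuousOn_L₁ : ContinuousOn D.L₁ (Icc 0 D.ℓ) :=
  D.continuousOn_of_arcs fun r => (D.smooth₁ r).continuousOn

theorem continuousOn_L₂ : ContinuousOn D.L₂ (Icc 0 D.ℓ) :=
  D.continuousOn_of_arcs fun r => (D.smooth₂ r).continuousOn

theorem continuousOn_pt : ContinuousOn D.pt (Icc 0 D.ℓ) :=
  D.continuousOn_L₁.prodMk D.continuousOn_L₂

theorem L₁_mem {μ : ℝ} (hμ : μ ∈ Icc 0 D.ℓ) : D.L₁ μ ∈ Icc 0 D.a := by
  have h1 := D.antitone₁ D.zero_mem hμ hμ.1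
  have h2 := D.antitone₁ hμ D.ell_mem hμ.2
  rw [D.start₁] at h1
  rw [D.stop₁] at h2
  exact ⟨h2, h1⟩

theorem L₂_mem {μ : ℝ} (hμ : μ ∈ Icc 0 D.ℓ) : D.L₂ μ ∈ Icc 0 D.b := by
  have h1 := D.monotone₂ D.zero_mem hμ hμ.1
  have h2 := D.monotone₂ hμ D.ell_mem hμ.2
  rw [D.start₂] at h1
  rw [D.stop₂] at h2
  exact ⟨h1, h2⟩

/-- The region consists of the points of the curve with each coordinate scaled by a factor in `[0,
1]`, so it is a continuous image of a compact box. -/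
theorem isCompact_closedRegion : IsCompact D.closedRegion := by
  have h : D.closedRegion = (fun z : ℝ × ℝ × ℝ => (z.2.1 * D.L₁ z.1, z.2.2 * D.L₂ z.1)) ''
      (Icc 0 D.ℓ ×ˢ Icc 0 1 ×ˢ Icc 0 1) := by
    have hq : ∀ x y : ℝ, 0 ≤ x → x ≤ y → ∃ θ ∈ Icc (0 : ℝ) 1, θ * y = x := fun x y h0 h1 => by
      rcases (h0.trans h1).eq_or_lt with h | h
      · exact ⟨0, by simp, by rw [zero_mul]; linarith⟩
      · exact ⟨x / y, ⟨by positivity, (div_le_one h).2 h1⟩, div_mul_cancel₀ _ h.ne'⟩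
    ext P
    constructor
    · rintro ⟨μ, hμ, h1, h2, h3, h4⟩
      obtain ⟨θ, hθ, e1⟩ := hq _ _ h1 h2
      obtain ⟨θ', hθ', e2⟩ := hq _ _ h3 h4
      exact ⟨(μ, θ, θ'), ⟨hμ, hθ, hθ'⟩, Prod.ext e1 e2⟩
    · rintro ⟨⟨μ, θ, θ'⟩, ⟨hμ, hθ, hθ'⟩, rfl⟩
      have h1 := D.L₁_mem hμ
      have h2 := D.L₂_mem hμ
      exact ⟨μ, hμ, mul_nonneg hθ.1 h1.1, mul_le_of_le_one_left h1.1 hθ.2,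
        mul_nonneg hθ'.1 h2.1, mul_le_of_le_one_left h2.1 hθ'.2⟩
  rw [h]
  refine (isCompact_Icc.prod (isCompact_Icc.prod isCompact_Icc)).image_of_continuousOn ?_
  have c1 : ContinuousOn (fun z : ℝ × ℝ × ℝ => D.L₁ z.1) (Icc 0 D.ℓ ×ˢ Icc 0 1 ×ˢ Icc 0 1) :=
    D.continuousOn_L₁.comp continuousOn_fst fun z hz => hz.1
  have c2 : ContinuousOn (fun z : ℝ × ℝ × ℝ => D.L₂ z.1) (Icc 0 D.ℓ ×ˢ Icc 0 1 ×ˢ Icc 0 1) :=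
    D.continuousOn_L₂.comp continuousOn_fst fun z hz => hz.1
  fun_prop

theorem G_subset : D.G ⊆ D.closedRegion := interior_subset

theorem isOpen_G : IsOpen D.G := isOpen_interior

theorem isBounded_G : Bornology.IsBounded D.G := D.isCompact_closedRegion.isBounded.subset D.G_subset

theorem closure_G_subset : closure D.G ⊆ D.closedRegion :=
  closure_minimal D.G_subset D.isCompact_closedRegion.isClosed

theorem pt_mem {μ : ℝ} (hμ : μ ∈ Icc 0 D.ℓ) : D.pt μ ∈ D.closedRegion :=
  ⟨μ, hμ, (D.L₁_mem hμ).1, le_rfl, (D.L₂_mem hμ).1, le_rfl⟩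

/-- The closed region is a lower set in the quadrant. -/
theorem mem_closedRegion_of_le {P X : Plane} (hP : P ∈ D.closedRegion) (h1 : 0 ≤ X.1)
    (h2 : 0 ≤ X.2) (h3 : X.1 ≤ P.1) (h4 : X.2 ≤ P.2) : X ∈ D.closedRegion := by
  obtain ⟨μ, hμ, hW⟩ := hP
  exact ⟨μ, hμ, h1, h3.trans hW.2.1, h2, h4.trans hW.2.2.2⟩

theorem nonneg_of_mem {P : Plane} (hP : P ∈ D.closedRegion) : 0 ≤ P.1 ∧ 0 ≤ P.2 := by
  obtain ⟨μ, hμ, hW⟩ := hP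
  exact ⟨hW.1, hW.2.2.1⟩

/-- The open rectangle between the origin and `P` lies in the closed region, which is a lower set of
the quadrant. -/
theorem mem_G_of_lt {P X : Plane} (hP : P ∈ D.closedRegion) (h1 : 0 < X.1) (h2 : 0 < X.2)
    (h3 : X.1 < P.1) (h4 : X.2 < P.2) : X ∈ D.G := by
  refine mem_interior.2 ⟨Ioo 0 P.1 ×ˢ Ioo 0 P.2, fun Y hY => ?_, isOpen_Ioo.prod isOpen_Ioo,
    ⟨h1, h3⟩, h2, h4⟩
  exact D.mem_closedRegion_of_le hP hY.1.1.le hY.2.1.le hY.1.2.le hY.2.2.le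

/-- Being interior, `P` can be shifted along the diagonal in both directions: the shift down makes
the coordinates positive, the shift up makes a point of the curve dominate `P` strictly. -/
theorem exists_lt_of_mem_G {P : Plane} (hP : P ∈ D.G) :
    0 < P.1 ∧ 0 < P.2 ∧ ∃ μ ∈ Icc 0 D.ℓ, P.1 < D.L₁ μ ∧ P.2 < D.L₂ μ := by
  obtain ⟨ε, hε, hball⟩ := Metric.isOpen_iff.1 D.isOpen_G P hP
  have hm : ∀ e, |e| < ε → (P.1 + e, P.2 + e) ∈ D.closedRegion := fun e he => by
    refine D.G_subset (hball ?_)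
    rw [Metric.mem_ball, Prod.dist_eq]
    simpa [Real.dist_eq] using he
  have h1 := D.nonneg_of_mem (hm (-(ε / 2)) (by rw [abs_neg, abs_of_pos] <;> linarith))
  obtain ⟨μ, hμ, hW⟩ := hm (ε / 2) (by rw [abs_of_pos] <;> linarith)
  simp only [mem_W, pt] at hW h1
  exact ⟨by linarith, by linarith, μ, hμ, by linarith, by linarith⟩

variable {D}

/-- A vertical line that does not pass through a vertex crosses the curve exactly once, with
nonzero slope. -/
theorem exists_crossing₁ {s : ℝ} (hs : s ∈ Icc 0 D.a) (hv : ∀ r, s ≠ D.L₁ (D.vpar r)) :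
    ∃ r : Fin (D.N + 1), ∃ μ ∈ Ioo (D.vpar r.castSucc) (D.vpar r.succ), D.L₁ μ = s ∧
      deriv D.L₁ μ ≠ 0 ∧ HasStrictDerivAt D.L₁ (deriv D.L₁ μ) μ ∧
      ∀ ν ∈ Icc 0 D.ℓ, D.L₁ ν = s → ν = μ := by
  obtain ⟨μ, hμ, rfl⟩ := intermediate_value_Icc' D.ell_pos.le D.continuousOn_L₁
    (by rwa [D.start₁, D.stop₁])
  obtain ⟨r, hr⟩ := D.exists_openArc hμ fun r h => hv r (by rw [h])
  have hne : deriv D.L₁ μ ≠ 0 := D.transversal₁ μ hμ hv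
  have hd : HasStrictDerivAt D.L₁ (deriv D.L₁ μ) μ :=
    ((D.smooth₁ r).contDiffAt (Icc_mem_nhds hr.1 hr.2)).hasStrictDerivAt (by norm_num)
  refine ⟨r, μ, hr, rfl, hne, hd, fun ν hν h => ?_⟩
  -- Monotonicity makes `L₁` constant between two parameters on the same vertical line, which the
  -- nonzero slope forbids.
  refine eq_of_const_of_hasDerivAt_ne_zero hd.hasDerivAt hne fun κ hκ => ?_
  have hκ' : κ ∈ Icc 0 D.ℓ := ordConnected_Icc.uIcc_subset hμ hν hκ
  rcases mem_uIcc.1 hκ with hκ | hκ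
  · exact le_antisymm (D.antitone₁ hμ hκ' hκ.1) (h ▸ D.antitone₁ hκ' hν hκ.2)
  · exact le_antisymm (h ▸ D.antitone₁ hν hκ' hκ.1) (D.antitone₁ hκ' hμ hκ.2)

/-- A horizontal line that does not pass through a vertex crosses the curve exactly once, with
nonzero slope. -/
theorem exists_crossing₂ {t : ℝ} (ht : t ∈ Icc 0 D.b) (hv : ∀ r, t ≠ D.L₂ (D.vpar r)) :
    ∃ r : Fin (D.N + 1), ∃ μ ∈ Ioo (D.vpar r.castSucc) (D.vpar r.succ), D.L₂ μ = t ∧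
      deriv D.L₂ μ ≠ 0 ∧ HasStrictDerivAt D.L₂ (deriv D.L₂ μ) μ ∧
      ∀ ν ∈ Icc 0 D.ℓ, D.L₂ ν = t → ν = μ := by
  obtain ⟨μ, hμ, rfl⟩ := intermediate_value_Icc D.ell_pos.le D.continuousOn_L₂
    (by rwa [D.start₂, D.stop₂])
  obtain ⟨r, hr⟩ := D.exists_openArc hμ fun r h => hv r (by rw [h])
  have hne : deriv D.L₂ μ ≠ 0 := D.transversal₂ μ hμ hv
  have hd : HasStrictDerivAt D.L₂ (deriv D.L₂ μ) μ :=
    ((D.smooth₂ r).contDiffAt (Icc_mem_nhds hr.1 hr.2)).hasStrictDerivAt (by norm_num)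
  refine ⟨r, μ, hr, rfl, hne, hd, fun ν hν h => ?_⟩
  refine eq_of_const_of_hasDerivAt_ne_zero hd.hasDerivAt hne fun κ hκ => ?_
  have hκ' : κ ∈ Icc 0 D.ℓ := ordConnected_Icc.uIcc_subset hμ hν hκ
  rcases mem_uIcc.1 hκ with hκ | hκ
  · exact le_antisymm (h ▸ D.monotone₂ hκ' hν hκ.2) (D.monotone₂ hμ hκ' hκ.1)
  · exact le_antisymm (D.monotone₂ hκ' hμ hκ.2) (h ▸ D.monotone₂ hν hκ' hκ.1)

/-- The line meets the frontier at most on the axis and at the crossing. Below the crossing, a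
slightly smaller parameter gives a point of the curve that dominates `(s, t)` strictly, so `(s, t)`
is interior. Above it, no point of the curve dominates `(s, t)`. -/
theorem ae_notMem_frontier₁ {s : ℝ} (hs : 0 < s) {μ : ℝ} (hμ : μ ∈ Ioo 0 D.ℓ) (hs' : D.L₁ μ = s)
    (huniq : ∀ ν ∈ Icc 0 D.ℓ, D.L₁ ν = s → ν = μ) : ∀ᵐ t : ℝ, (s, t) ∉ frontier D.G := by
  have hnull : (volume : Measure ℝ) {0, D.L₂ μ} = 0 := (Set.toFinite _).measure_zero _
  filter_upwards [compl_mem_ae_iff.2 hnull] with t ht hfr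
  have hmem := D.closure_G_subset (frontier_subset_closure hfr)
  have ht0 : t ≠ 0 := fun h => ht (by simp [h])
  have htL : t ≠ D.L₂ μ := fun h => ht (by simp [h])
  have hnG : (s, t) ∉ D.G := by
    have := hfr.2
    rwa [D.isOpen_G.interior_eq] at this
  have htpos : 0 < t := lt_of_le_of_ne (D.nonneg_of_mem hmem).2 ht0.symm
  have hμI := Ioo_subset_Icc_self hμ
  rcases lt_or_gt_of_ne htL with h | h
  · have hc : ContinuousAt D.L₂ μ := D.continuousOn_L₂.continuousAt (Icc_mem_nhds hμ.1 hμ.2)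
    have hev : ∀ᶠ ν in 𝓝[<] μ, t < D.L₂ ν ∧ ν ∈ Ioo 0 D.ℓ ∧ ν < μ := by
      filter_upwards [mem_nhdsWithin_of_mem_nhds (hc.eventually (lt_mem_nhds h)),
        mem_nhdsWithin_of_mem_nhds (Ioo_mem_nhds hμ.1 hμ.2), self_mem_nhdsWithin]
        with ν h1 h2 h3 using ⟨h1, h2, h3⟩
    obtain ⟨ν, h1, h2, h3⟩ := hev.exists
    have hνI := Ioo_subset_Icc_self h2
    have h4 : s < D.L₁ ν := by
      refine lt_of_le_of_ne ?_ fun h' => h3.ne (huniq ν hνI h'.symm)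
      rw [← hs']
      exact D.antitone₁ hνI hμI h3.le
    exact hnG (D.mem_G_of_lt (D.pt_mem hνI) hs htpos h4 h1)
  · obtain ⟨ν, hν, h1, h2, h3, h4⟩ := hmem
    simp only [pt] at h2 h4
    rcases le_total ν μ with h5 | h5
    · linarith [D.monotone₂ hν hμI h5]
    · have h6 : D.L₁ ν = s := le_antisymm (hs' ▸ D.antitone₁ hμI hν h5) h2
      rw [huniq ν hν h6] at h4
      linarith

theorem ae_notMem_frontier₂ {t : ℝ} (ht : 0 < t) {μ : ℝ} (hμ : μ ∈ Ioo 0 D.ℓ) (ht' : D.L₂ μ = t)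
    (huniq : ∀ ν ∈ Icc 0 D.ℓ, D.L₂ ν = t → ν = μ) : ∀ᵐ s : ℝ, (s, t) ∉ frontier D.G := by
  have hnull : (volume : Measure ℝ) {0, D.L₁ μ} = 0 := (Set.toFinite _).measure_zero _
  filter_upwards [compl_mem_ae_iff.2 hnull] with s hs hfr
  have hmem := D.closure_G_subset (frontier_subset_closure hfr)
  have hs0 : s ≠ 0 := fun h => hs (by simp [h])
  have hsL : s ≠ D.L₁ μ := fun h => hs (by simp [h])
  have hnG : (s, t) ∉ D.G := by
    have := hfr.2
    rwa [D.isOpen_G.interior_eq] at this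
  have hspos : 0 < s := lt_of_le_of_ne (D.nonneg_of_mem hmem).1 hs0.symm
  have hμI := Ioo_subset_Icc_self hμ
  rcases lt_or_gt_of_ne hsL with h | h
  · have hc : ContinuousAt D.L₁ μ := D.continuousOn_L₁.continuousAt (Icc_mem_nhds hμ.1 hμ.2)
    have hev : ∀ᶠ ν in 𝓝[>] μ, s < D.L₁ ν ∧ ν ∈ Ioo 0 D.ℓ ∧ μ < ν := by
      filter_upwards [mem_nhdsWithin_of_mem_nhds (hc.eventually (lt_mem_nhds h)),
        mem_nhdsWithin_of_mem_nhds (Ioo_mem_nhds hμ.1 hμ.2), self_mem_nhdsWithin]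
        with ν h1 h2 h3 using ⟨h1, h2, h3⟩
    obtain ⟨ν, h1, h2, h3⟩ := hev.exists
    have hνI := Ioo_subset_Icc_self h2
    have h4 : t < D.L₂ ν := by
      refine lt_of_le_of_ne ?_ fun h' => h3.ne' (huniq ν hνI h'.symm)
      rw [← ht']
      exact D.monotone₂ hμI hνI h3.le
    exact hnG (D.mem_G_of_lt (D.pt_mem hνI) hspos ht h1 h4)
  · obtain ⟨ν, hν, h1, h2, h3, h4⟩ := hmem
    simp only [pt] at h2 h4
    rcases le_total μ ν with h5 | h5
    · linarith [D.antitone₁ hμI hν h5]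
    · have h6 : D.L₂ ν = t := le_antisymm (ht' ▸ D.monotone₂ hν hμI h5) h4
      rw [huniq ν hν h6] at h2
      linarith

theorem isOpen_regularPart : IsOpen D.regularPart := by
  have h : D.regularPart = D.G ∩ ⋂ r, {P : Plane | P.1 ≠ (D.vertex r).1} ∩
      {P : Plane | P.2 ≠ (D.vertex r).2} := by
    ext P
    simp only [regularPart, mem_inter_iff, mem_iInter]
    exact Iff.rfl
  rw [h]
  refine D.isOpen_G.inter (isOpen_iInter_of_finite fun r => ?_)
  exact (isOpen_ne_fun continuous_fst continuous_const).inter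
    (isOpen_ne_fun continuous_snd continuous_const)

theorem fst_mem_of_mem_G {P : Plane} (hP : P ∈ D.G) : P.1 ∈ Icc 0 D.a := by
  obtain ⟨h1, h2, μ, hμ, h3, h4⟩ := D.exists_lt_of_mem_G hP
  exact ⟨h1.le, h3.le.trans (D.L₁_mem hμ).2⟩

theorem snd_mem_of_mem_G {P : Plane} (hP : P ∈ D.G) : P.2 ∈ Icc 0 D.b := by
  obtain ⟨h1, h2, μ, hμ, h3, h4⟩ := D.exists_lt_of_mem_G hP
  exact ⟨h2.le, h4.le.trans (D.L₂_mem hμ).2⟩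

/-- Strictness is the point: at the crossing the other constraint that defines the arc holds with
room to spare, hence for all nearby parameters. -/
theorem snd_lt_of_crossing₁ {P : Plane} (hP : P ∈ D.G) {μ : ℝ} (hμ : μ ∈ Icc 0 D.ℓ)
    (h : D.L₁ μ = P.1) : P.2 < D.L₂ μ := by
  obtain ⟨h1, h2, ν, hν, h3, h4⟩ := D.exists_lt_of_mem_G hP
  rcases le_total ν μ with h5 | h5
  · exact h4.trans_le (D.monotone₂ hν hμ h5)
  · linarith [D.antitone₁ hμ hν h5]

theorem fst_lt_of_crossing₂ {P : Plane} (hP : P ∈ D.G) {μ : ℝ} (hμ : μ ∈ Icc 0 D.ℓ)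
    (h : D.L₂ μ = P.2) : P.1 < D.L₁ μ := by
  obtain ⟨h1, h2, ν, hν, h3, h4⟩ := D.exists_lt_of_mem_G hP
  rcases le_total μ ν with h5 | h5
  · exact h3.trans_le (D.antitone₁ hμ hν h5)
  · linarith [D.monotone₂ hν hμ h5]

theorem mem_E {P Q : Plane} (h1 : 0 ≤ P.1) (h2 : 0 ≤ P.2) :
    Q ∈ D.E P ↔ Q ∈ D.G ∧ P.1 ≤ Q.1 ∧ P.2 ≤ Q.2 :=
  ⟨fun h => ⟨h.1, h.2.2.1, h.2.2.2.2⟩, fun h => ⟨h.1, h1, h.2.1, h2, h.2.2⟩⟩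

theorem mem_arc {P : Plane} (h1 : 0 ≤ P.1) (h2 : 0 ≤ P.2) {μ : ℝ} :
    μ ∈ D.arc P ↔ μ ∈ Icc 0 D.ℓ ∧ P.1 ≤ D.L₁ μ ∧ P.2 ≤ D.L₂ μ :=
  ⟨fun h => ⟨h.1, h.2.2.1, h.2.2.2.2⟩, fun h => ⟨h.1, h1, h.2.1, h2, h.2.2⟩⟩

end CurvilinearDomain

end Goursat

end

/-! ### Leibniz rules for regions, lines and curves with a moving kernel -/

noncomputable section

namespace Goursat

open Filter Topology

section MovingRegion

variable {Ω : Set Plane} {g : Plane → ℝ} {κ κ' : Plane → ℝ → ℝ} {x₀ : ℝ}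

/-- Leibniz rule for the integral over the part of a plane region to the right of a moving vertical
line. -/
theorem hasDerivAt_integral_region₁ (hΩ : MeasurableSet Ω) (hb : Bornology.IsBounded Ω)
    (hg : Continuous g) (hκ : Continuous (Function.uncurry κ))
    (hκ' : Continuous (Function.uncurry κ')) (hκd : ∀ P x, HasDerivAt (κ P) (κ' P x) x)
    (hfr : ∀ᵐ t : ℝ, (x₀, t) ∉ frontier Ω) :
    HasDerivAt (fun x => ∫ P in {P : Plane | x ≤ P.1}, g P * κ P x ∂(volume.restrict Ω))
      (-(∫ t in {t | (x₀, t) ∈ Ω}, g (x₀, t) * κ (x₀, t) x₀)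
        + ∫ P in {P : Plane | x₀ ≤ P.1}, g P * κ' P x₀ ∂(volume.restrict Ω)) x₀ := by
  obtain ⟨r, hr⟩ := hb.subset_closedBall 0
  have hcpt : IsCompact (Metric.closedBall (0 : Plane) r) := isCompact_closedBall 0 r
  obtain ⟨M₁, hM₁⟩ := (hcpt.prod (isCompact_Icc (a := x₀ - 1) (b := x₀ + 1))).exists_bound_of_continuousOn
    hκ.continuousOn
  obtain ⟨M₂, hM₂⟩ := (hcpt.prod (isCompact_Icc (a := x₀ - 1) (b := x₀ + 1))).exists_bound_of_continuousOn
    hκ'.continuousOn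
  have hx : ∀ x, Continuous fun P => κ P x := fun x => hκ.comp (Continuous.prodMk_left x)
  refine hasDerivAt_integral_superlevel (m := volume.restrict Ω) (φ := Prod.fst) (M := max M₁ M₂)
    measurable_fst.aemeasurable ?_ (fun x => (hx x).aestronglyMeasurable) hκd ?_ ?_ ?_ ?_
  · exact (hg.continuousOn.integrableOn_compact hcpt).mono_set hr
  · filter_upwards [ae_restrict_mem hΩ] with P hP
    exact (hM₁ (P, x₀) ⟨hr hP, by constructor <;> linarith⟩).trans (le_max_left _ _)
  · filter_upwards [ae_restrict_mem hΩ] with P hP x hx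
    exact (hM₂ (P, x) ⟨hr hP, hx⟩).trans (le_max_right _ _)
  · refine ae_restrict_of_ae ?_
    rw [ae_iff]
    have h : {P : Plane | ¬ P.1 ≠ x₀} = {x₀} ×ˢ (univ : Set ℝ) := by ext P; simp
    rw [h, Measure.volume_eq_prod, Measure.prod_prod]
    simp
  · exact hasDerivAt_integral_halfPlane hΩ hb (w := fun P => g P * κ P x₀) (hg.mul (hx x₀)) hfr

/-- Leibniz rule for the integral over the part of a plane region above a moving horizontal
line. -/
theorem hasDerivAt_integral_region₂ (hΩ : MeasurableSet Ω) (hb : Bornology.IsBounded Ω)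
    (hg : Continuous g) (hκ : Continuous (Function.uncurry κ))
    (hκ' : Continuous (Function.uncurry κ')) (hκd : ∀ P x, HasDerivAt (κ P) (κ' P x) x)
    (hfr : ∀ᵐ s : ℝ, (s, x₀) ∉ frontier Ω) :
    HasDerivAt (fun x => ∫ P in {P : Plane | x ≤ P.2}, g P * κ P x ∂(volume.restrict Ω))
      (-(∫ s in {s | (s, x₀) ∈ Ω}, g (s, x₀) * κ (s, x₀) x₀)
        + ∫ P in {P : Plane | x₀ ≤ P.2}, g P * κ' P x₀ ∂(volume.restrict Ω)) x₀ := by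
  -- Exchanging the coordinates reduces this to the vertical case.
  have hmp : MeasurePreserving (Prod.swap : Plane → Plane) (volume.restrict (Prod.swap ⁻¹' Ω))
      (volume.restrict Ω) :=
    (Measure.measurePreserving_swap (μ := (volume : Measure ℝ))
      (ν := (volume : Measure ℝ))).restrict_preimage hΩ
  have he : MeasurableEmbedding (Prod.swap : Plane → Plane) :=
    (MeasurableEquiv.prodComm (α := ℝ) (β := ℝ)).measurableEmbedding
  have hint : ∀ (F : Plane → ℝ) (x : ℝ), ∫ P in {P : Plane | x ≤ P.2}, F P ∂(volume.restrict Ω)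
      = ∫ P in {P : Plane | x ≤ P.1}, F P.swap ∂(volume.restrict (Prod.swap ⁻¹' Ω)) := fun F x => by
    rw [← hmp.setIntegral_preimage_emb he]
    rfl
  have hfr' : ∀ᵐ t : ℝ, (x₀, t) ∉ frontier (Prod.swap ⁻¹' Ω) := by
    have h := (Homeomorph.prodComm ℝ ℝ).preimage_frontier Ω
    filter_upwards [hfr] with t ht ht'
    apply ht
    have h2 : (x₀, t) ∈ (Homeomorph.prodComm ℝ ℝ) ⁻¹' frontier Ω := by rw [h]; exact ht'
    exact h2
  have hbd : Bornology.IsBounded (Prod.swap ⁻¹' Ω : Set Plane) := by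
    obtain ⟨r, hr⟩ := hb.subset_closedBall 0
    refine (Metric.isBounded_closedBall (x := (0 : Plane)) (r := r)).subset fun P hP => ?_
    have h1 := mem_closedBall_zero_iff.1 (hr hP)
    rw [mem_closedBall_zero_iff]
    rw [Prod.norm_def] at h1 ⊢
    rwa [max_comm]
  have h := hasDerivAt_integral_region₁ (Ω := Prod.swap ⁻¹' Ω) (g := fun P => g P.swap)
    (κ := fun P => κ P.swap) (κ' := fun P => κ' P.swap) (x₀ := x₀) (measurable_swap hΩ) hbd
    (hg.comp continuous_swap) (hκ.comp (f := fun z : Plane × ℝ => (z.1.swap, z.2)) (by fun_prop))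
    (hκ'.comp (f := fun z : Plane × ℝ => (z.1.swap, z.2)) (by fun_prop))
    (fun P x => hκd P.swap x) hfr'
  simp only [hint]
  exact h

/-- Leibniz rule on the line. -/
theorem hasDerivAt_integral_halfLine {Θ : Set ℝ} (hΘ : IsOpen Θ) (hb : Bornology.IsBounded Θ)
    {g : ℝ → ℝ} {κ κ' : ℝ → ℝ → ℝ} (hg : Continuous g) (hκ : Continuous (Function.uncurry κ))
    (hκ' : Continuous (Function.uncurry κ')) (hκd : ∀ t x, HasDerivAt (κ t) (κ' t x) x)
    (hx₀ : x₀ ∈ Θ) :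
    HasDerivAt (fun x => ∫ t in {t : ℝ | t ∈ Θ ∧ x ≤ t}, g t * κ t x)
      (-(g x₀ * κ x₀ x₀) + ∫ t in {t : ℝ | t ∈ Θ ∧ x₀ ≤ t}, g t * κ' t x₀) x₀ := by
  obtain ⟨r, hr⟩ := hb.subset_closedBall 0
  have hcpt : IsCompact (Metric.closedBall (0 : ℝ) r) := isCompact_closedBall 0 r
  obtain ⟨M₁, hM₁⟩ := (hcpt.prod (isCompact_Icc (a := x₀ - 1) (b := x₀ + 1))).exists_bound_of_continuousOn
    hκ.continuousOn
  obtain ⟨M₂, hM₂⟩ := (hcpt.prod (isCompact_Icc (a := x₀ - 1) (b := x₀ + 1))).exists_bound_of_continuousOn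
    hκ'.continuousOn
  have hx : ∀ x, Continuous fun t => κ t x := fun x => hκ.comp (Continuous.prodMk_left x)
  have hset : ∀ (F : ℝ → ℝ) x, ∫ t in {t : ℝ | t ∈ Θ ∧ x ≤ t}, F t
      = ∫ t in {t : ℝ | x ≤ id t}, F t ∂(volume.restrict Θ) := fun F x => by
    rw [Measure.restrict_restrict (measurableSet_le measurable_const measurable_id)]
    congr 2
    ext t
    exact and_comm
  have hfix : HasDerivAt (fun x => ∫ t in {t : ℝ | x ≤ id t}, g t * κ t x₀ ∂(volume.restrict Θ))
      (-(g x₀ * κ x₀ x₀)) x₀ := by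
    have hint : Integrable (Θ.indicator fun t => g t * κ t x₀) := by
      rw [integrable_indicator_iff hΘ.measurableSet]
      exact ((hg.mul (hx x₀)).continuousOn.integrableOn_compact hcpt).mono_set hr
    have hfr : x₀ ∉ frontier Θ := fun h => h.2 (by rwa [hΘ.interior_eq])
    have h := hasDerivAt_integral_Ici hint
      (continuousAt_indicator_of_notMem_frontier (hg.mul (hx x₀)).continuousAt hfr)
    rw [indicator_of_mem hx₀] at h
    refine h.congr_of_eventuallyEq (Eventually.of_forall fun x => ?_)
    simp only
    rw [setIntegral_indicator hΘ.measurableSet,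
      Measure.restrict_restrict (measurableSet_le measurable_const measurable_id)]
    rfl
  simp only [hset]
  refine hasDerivAt_integral_superlevel (m := volume.restrict Θ) (φ := id) (M := max M₁ M₂)
    measurable_id.aemeasurable ?_ (fun x => (hx x).aestronglyMeasurable) hκd ?_ ?_ ?_ hfix
  · exact (hg.continuousOn.integrableOn_compact hcpt).mono_set hr
  · filter_upwards [ae_restrict_mem hΘ.measurableSet] with P hP
    exact (hM₁ (P, x₀) ⟨hr hP, by constructor <;> linarith⟩).trans (le_max_left _ _)
  · filter_upwards [ae_restrict_mem hΘ.measurableSet] with P hP x hx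
    exact (hM₂ (P, x) ⟨hr hP, hx⟩).trans (le_max_right _ _)
  · refine ae_restrict_of_ae ?_
    filter_upwards [compl_mem_ae_iff.2 (measure_singleton x₀)] with t ht using ht

end MovingRegion

/-- Leibniz rule for the integral along the part of a curve cut off by a moving line. -/
theorem hasDerivAt_integral_curve {φ h : ℝ → ℝ} {ℓ μ₀ x₀ e : ℝ} {A : Set ℝ} {κ κ' : ℝ → ℝ → ℝ}
    {M : ℝ} (hφ : ContinuousOn φ (Icc 0 ℓ)) (hA : MeasurableSet A) (hA₀ : A ∈ 𝓝 μ₀)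
    (hμ₀ : μ₀ ∈ Ioo 0 ℓ) (huniq : ∀ ν ∈ Icc 0 ℓ, φ ν = x₀ → ν = μ₀)
    (hh : IntegrableOn h (Icc 0 ℓ)) (hhc : ContinuousAt h μ₀)
    (hκ : ∀ x, ContinuousOn (fun μ => κ μ x) (Icc 0 ℓ))
    (hκd : ∀ μ x, HasDerivAt (κ μ) (κ' μ x) x)
    (hM : ∀ μ ∈ Icc 0 ℓ, |κ μ x₀| ≤ M)
    (hM' : ∀ μ ∈ Icc 0 ℓ, ∀ x ∈ Icc (x₀ - 1) (x₀ + 1), |κ' μ x| ≤ M)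
    (hfix : ∀ w : ℝ → ℝ, IntegrableOn w (Icc 0 ℓ) → ContinuousAt w μ₀ →
      HasDerivAt (fun x => ∫ μ in {μ | x ≤ φ μ}, w μ ∂(volume.restrict (Icc 0 ℓ)))
        (e * w μ₀) x₀) :
    HasDerivAt (fun x => ∫ μ in {μ | x ≤ φ μ}, A.indicator h μ * κ μ x ∂(volume.restrict (Icc 0 ℓ)))
      (e * (h μ₀ * κ μ₀ x₀)
        + ∫ μ in {μ | x₀ ≤ φ μ}, A.indicator h μ * κ' μ x₀ ∂(volume.restrict (Icc 0 ℓ))) x₀ := by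
  have hκm : ∀ x, AEStronglyMeasurable (fun μ => κ μ x) (volume.restrict (Icc 0 ℓ)) := fun x =>
    (hκ x).aestronglyMeasurable measurableSet_Icc
  have hmem := ae_restrict_mem (μ := (volume : Measure ℝ)) (measurableSet_Icc (a := (0 : ℝ)) (b := ℓ))
  have hAh : Integrable (A.indicator h) (volume.restrict (Icc 0 ℓ)) := Integrable.indicator hh hA
  -- Since `A` is a neighbourhood of the crossing, the fixed constraint does not disturb the density
  -- where the endpoint moves.
  have hev : A.indicator h =ᶠ[𝓝 μ₀] h := by
    filter_upwards [hA₀] with μ hμ using indicator_of_mem hμ h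
  refine hasDerivAt_integral_superlevel (M := M) (hφ.aemeasurable measurableSet_Icc) hAh hκm hκd
    ?_ ?_ ?_ ?_
  · filter_upwards [hmem] with μ hμ using hM μ hμ
  · filter_upwards [hmem] with μ hμ using hM' μ hμ
  · filter_upwards [hmem, ae_restrict_of_ae (compl_mem_ae_iff.2 (measure_singleton μ₀))]
      with μ hμ hμ' h using hμ' (huniq μ hμ h)
  · have h1 := hfix (fun μ => A.indicator h μ * κ μ x₀) ?_ ?_
    · rwa [hev.eq_of_nhds] at h1
    · refine Integrable.mul_bdd (c := M) hAh (hκm x₀) ?_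
      filter_upwards [hmem] with μ hμ using hM μ hμ
    · exact (hhc.congr hev.symm).mul ((hκ x₀).continuousAt (Icc_mem_nhds hμ₀.1 hμ₀.2))

end Goursat

end

/-! ### The pairing of a kernel with the sources -/

noncomputable section

namespace Goursat

open Filter Topology

namespace CurvilinearDomain

section Pairing

variable (D : CurvilinearDomain) (g : Plane → ℝ) (h : ℝ → ℝ) (c : Fin D.N → ℝ)

/-- The pairing of a kernel with the sources `g` in the domain, `h` on the curve and `c` at the
vertices, over the part of the closed region that dominates `Q`. -/
def pairing (k : Plane → Plane → ℝ) (Q : Plane) : ℝ :=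
  (∫ P in D.E Q, g P * k P Q) + (∫ μ in D.arc Q, h μ * k (D.pt μ) Q)
    + ∑ r : Fin D.N, c r * k (D.vertex r.succ.castSucc) Q
        * (W (D.vertex r.succ.castSucc)).indicator (fun _ => (1 : ℝ)) Q

/-- The density of the pairing on the vertical line through `Q`, which meets the curve at the
parameter `μ`. -/
def fiber₁ (μ : ℝ) (k : Plane → Plane → ℝ) (Q : Plane) : ℝ :=
  (∫ t in {t | (Q.1, t) ∈ D.G ∧ Q.2 ≤ t}, g (Q.1, t) * k (Q.1, t) Q)
    - (deriv D.L₁ μ)⁻¹ * (h μ * k (D.pt μ) Q)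

/-- The density of the pairing on the horizontal line through `Q`, which meets the curve at the
parameter `μ`. -/
def fiber₂ (μ : ℝ) (k : Plane → Plane → ℝ) (Q : Plane) : ℝ :=
  (∫ s in {s | (s, Q.2) ∈ D.G ∧ Q.1 ≤ s}, g (s, Q.2) * k (s, Q.2) Q)
    + (deriv D.L₂ μ)⁻¹ * (h μ * k (D.pt μ) Q)

/-- The curve crosses the vertical line through `Q` at the parameter `μ`. -/
structure IsCrossing₁ (Q : Plane) (μ : ℝ) : Prop where
  mem : μ ∈ Ioo 0 D.ℓ
  eq : D.L₁ μ = Q.1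
  deriv_ne : deriv D.L₁ μ ≠ 0
  strict : HasStrictDerivAt D.L₁ (deriv D.L₁ μ) μ
  uniq : ∀ ν ∈ Icc 0 D.ℓ, D.L₁ ν = Q.1 → ν = μ
  notVertex : ∃ r : Fin (D.N + 1), μ ∈ Ioo (D.vpar r.castSucc) (D.vpar r.succ)

/-- The curve crosses the horizontal line through `Q` at the parameter `μ`. -/
structure IsCrossing₂ (Q : Plane) (μ : ℝ) : Prop where
  mem : μ ∈ Ioo 0 D.ℓ
  eq : D.L₂ μ = Q.2
  deriv_ne : deriv D.L₂ μ ≠ 0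
  strict : HasStrictDerivAt D.L₂ (deriv D.L₂ μ) μ
  uniq : ∀ ν ∈ Icc 0 D.ℓ, D.L₂ ν = Q.2 → ν = μ
  notVertex : ∃ r : Fin (D.N + 1), μ ∈ Ioo (D.vpar r.castSucc) (D.vpar r.succ)

variable {D}

theorem exists_isCrossing₁ {Q : Plane} (hQ : Q ∈ D.regularPart) : ∃ μ, D.IsCrossing₁ Q μ := by
  obtain ⟨r, μ, hμ, h1, h2, h3, h4⟩ := exists_crossing₁ (fst_mem_of_mem_G hQ.1)
    fun r => (hQ.2 r).1
  exact ⟨μ, D.openArc_subset r hμ, h1, h2, h3, h4, r, hμ⟩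

theorem exists_isCrossing₂ {Q : Plane} (hQ : Q ∈ D.regularPart) : ∃ μ, D.IsCrossing₂ Q μ := by
  obtain ⟨r, μ, hμ, h1, h2, h3, h4⟩ := exists_crossing₂ (snd_mem_of_mem_G hQ.1)
    fun r => (hQ.2 r).2
  exact ⟨μ, D.openArc_subset r hμ, h1, h2, h3, h4, r, hμ⟩

theorem measurableSet_arc₁ (x : ℝ) : MeasurableSet (Icc 0 D.ℓ ∩ D.L₁ ⁻¹' Ici x) :=
  (D.continuousOn_L₁.preimage_isClosed_of_isClosed isClosed_Icc isClosed_Ici).measurableSet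

theorem measurableSet_arc₂ (x : ℝ) : MeasurableSet (Icc 0 D.ℓ ∩ D.L₂ ⁻¹' Ici x) :=
  (D.continuousOn_L₂.preimage_isClosed_of_isClosed isClosed_Icc isClosed_Ici).measurableSet

/-- Separates the constraint that moves with `Q.1` from the one that stays fixed, in the shape that
`hasDerivAt_integral_region₁` expects. -/
theorem integral_E₁ (F : Plane → ℝ) {Q : Plane} (h1 : 0 ≤ Q.1) (h2 : 0 ≤ Q.2) :
    ∫ P in D.E Q, F P = ∫ P in {P : Plane | Q.1 ≤ P.1}, F P
      ∂(volume.restrict (D.G ∩ {P : Plane | Q.2 ≤ P.2})) := by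
  rw [Measure.restrict_restrict (measurableSet_le measurable_const measurable_fst)]
  congr 2
  ext P
  rw [mem_E h1 h2]
  simp only [mem_inter_iff, mem_ofPred_eq]
  tauto

theorem integral_E₂ (F : Plane → ℝ) {Q : Plane} (h1 : 0 ≤ Q.1) (h2 : 0 ≤ Q.2) :
    ∫ P in D.E Q, F P = ∫ P in {P : Plane | Q.2 ≤ P.2}, F P
      ∂(volume.restrict (D.G ∩ {P : Plane | Q.1 ≤ P.1})) := by
  rw [Measure.restrict_restrict (measurableSet_le measurable_const measurable_snd)]
  congr 2
  ext P
  rw [mem_E h1 h2]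
  simp only [mem_inter_iff, mem_ofPred_eq]
  tauto

/-- The fixed constraint is absorbed into the density as an indicator, so that only the condition on
`L₁` moves. -/
theorem integral_arc₁ (h F : ℝ → ℝ) {Q : Plane} (h1 : 0 ≤ Q.1) (h2 : 0 ≤ Q.2) :
    ∫ μ in D.arc Q, h μ * F μ = ∫ μ in {μ | Q.1 ≤ D.L₁ μ},
      (Icc 0 D.ℓ ∩ D.L₂ ⁻¹' Ici Q.2).indicator h μ * F μ ∂(volume.restrict (Icc 0 D.ℓ)) := by
  simp only [← indicator_mul_left]
  rw [Measure.restrict_restrict₀' measurableSet_Icc.nullMeasurableSet,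
    setIntegral_indicator (measurableSet_arc₂ _)]
  congr 2
  ext μ
  rw [mem_arc h1 h2]
  simp only [mem_inter_iff, mem_ofPred_eq, mem_preimage, mem_Ici]
  tauto

theorem integral_arc₂ (h F : ℝ → ℝ) {Q : Plane} (h1 : 0 ≤ Q.1) (h2 : 0 ≤ Q.2) :
    ∫ μ in D.arc Q, h μ * F μ = ∫ μ in {μ | Q.2 ≤ D.L₂ μ},
      (Icc 0 D.ℓ ∩ D.L₁ ⁻¹' Ici Q.1).indicator h μ * F μ ∂(volume.restrict (Icc 0 D.ℓ)) := by
  simp only [← indicator_mul_left]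
  rw [Measure.restrict_restrict₀' measurableSet_Icc.nullMeasurableSet,
    setIntegral_indicator (measurableSet_arc₁ _)]
  congr 2
  ext μ
  rw [mem_arc h1 h2]
  simp only [mem_inter_iff, mem_ofPred_eq, mem_preimage, mem_Ici]
  tauto

theorem ae_ne_const (x : ℝ) : ∀ᵐ t : ℝ, t ≠ x := compl_mem_ae_iff.2 (measure_singleton x)

/-- Near a regular point, the set of vertices that dominate a point is constant. -/
theorem eventually_indicator_W_eq {Q : Plane} (hQ : Q ∈ D.regularPart) (r : Fin (D.N + 2)) :
    ∀ᶠ X in 𝓝 Q, (W (D.vertex r)).indicator (fun _ => (1 : ℝ)) X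
      = (W (D.vertex r)).indicator (fun _ => (1 : ℝ)) Q := by
  obtain ⟨p1, p2, -⟩ := D.exists_lt_of_mem_G hQ.1
  have e1 : ∀ᶠ X : Plane in 𝓝 Q, 0 < X.1 := continuousAt_fst.eventually (lt_mem_nhds p1)
  have e2 : ∀ᶠ X : Plane in 𝓝 Q, 0 < X.2 := continuousAt_snd.eventually (lt_mem_nhds p2)
  have e3 : ∀ᶠ X : Plane in 𝓝 Q, (X.1 ≤ (D.vertex r).1 ↔ Q.1 ≤ (D.vertex r).1) := by
    rcases lt_or_gt_of_ne (hQ.2 r).1 with h | h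
    · filter_upwards [continuousAt_fst.eventually (gt_mem_nhds h)] with X hX
      exact ⟨fun _ => h.le, fun _ => hX.le⟩
    · filter_upwards [continuousAt_fst.eventually (lt_mem_nhds h)] with X hX
      exact ⟨fun h' => absurd h' (not_le.2 hX), fun h' => absurd h' (not_le.2 h)⟩
  have e4 : ∀ᶠ X : Plane in 𝓝 Q, (X.2 ≤ (D.vertex r).2 ↔ Q.2 ≤ (D.vertex r).2) := by
    rcases lt_or_gt_of_ne (hQ.2 r).2 with h | h
    · filter_upwards [continuousAt_snd.eventually (gt_mem_nhds h)] with X hX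
      exact ⟨fun _ => h.le, fun _ => hX.le⟩
    · filter_upwards [continuousAt_snd.eventually (lt_mem_nhds h)] with X hX
      exact ⟨fun h' => absurd h' (not_le.2 hX), fun h' => absurd h' (not_le.2 h)⟩
  filter_upwards [e1, e2, e3, e4] with X h1 h2 h3 h4
  have hiff : X ∈ W (D.vertex r) ↔ Q ∈ W (D.vertex r) := by
    rw [mem_W, mem_W, h3, h4]
    simp [h1.le, h2.le, p1.le, p2.le]
  by_cases hm : Q ∈ W (D.vertex r)
  · rw [indicator_of_mem hm, indicator_of_mem (hiff.2 hm)]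
  · rw [indicator_of_notMem hm, indicator_of_notMem (mt hiff.1 hm)]

variable {g h c} {k k' : Plane → Plane → ℝ} {Q : Plane} {μ : ℝ}

theorem exists_bound_curve (hk : Continuous (Function.uncurry k)) (Q : Plane) :
    ∃ M, ∀ ν ∈ Icc 0 D.ℓ, ∀ X : Plane, |X.1 - Q.1| ≤ 1 → |X.2 - Q.2| ≤ 1 →
      |k (D.pt ν) X| ≤ M := by
  obtain ⟨M, hM⟩ := (D.isCompact_closedRegion.prod
    (isCompact_closedBall Q 1)).exists_bound_of_continuousOn hk.continuousOn
  refine ⟨M, fun ν hν X h1 h2 => hM (D.pt ν, X) ⟨D.pt_mem hν, ?_⟩⟩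
  rw [Metric.mem_closedBall, Prod.dist_eq]
  exact max_le h1 h2

/-- The `s`-derivative of the pairing at a regular point. -/
theorem hasDerivAt_pairing₁ (hg : Continuous g) (hh : IntegrableOn h (Icc 0 D.ℓ))
    (hhc : ∀ r : Fin (D.N + 1), ContinuousOn h (Ioo (D.vpar r.castSucc) (D.vpar r.succ)))
    (hk : Continuous (Function.uncurry k)) (hk' : Continuous (Function.uncurry k'))
    (hd : ∀ P X, HasDerivAt (fun σ => k P (σ, X.2)) (k' P X) X.1)
    (hQ : Q ∈ D.regularPart) (hμ : D.IsCrossing₁ Q μ) :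
    HasDerivAt (fun σ => D.pairing g h c k (σ, Q.2))
      (D.pairing g h c k' Q - D.fiber₁ g h μ k Q) Q.1 := by
  obtain ⟨p1, p2, -⟩ := D.exists_lt_of_mem_G hQ.1
  have hΩ : MeasurableSet (D.G ∩ {P : Plane | Q.2 ≤ P.2}) :=
    D.isOpen_G.measurableSet.inter (measurableSet_le measurable_const measurable_snd)
  have hfr : ∀ᵐ t : ℝ, (Q.1, t) ∉ frontier (D.G ∩ {P : Plane | Q.2 ≤ P.2}) := by
    filter_upwards [ae_notMem_frontier₁ p1 hμ.mem hμ.eq hμ.uniq, ae_ne_const Q.2] with t h1 h2 h3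
    rcases frontier_inter_subset _ _ h3 with h4 | h4
    · exact h1 h4.1
    · exact h2 (frontier_le_subset_eq continuous_const continuous_snd h4.2).symm
  have hI := hasDerivAt_integral_region₁ (κ := fun P x => k P (x, Q.2))
    (κ' := fun P x => k' P (x, Q.2)) hΩ (D.isBounded_G.subset inter_subset_left) hg
    (hk.comp (f := fun z : Plane × ℝ => (z.1, (z.2, Q.2))) (by fun_prop))
    (hk'.comp (f := fun z : Plane × ℝ => (z.1, (z.2, Q.2))) (by fun_prop))
    (fun P x => hd P (x, Q.2)) hfr
  obtain ⟨M₁, hM₁⟩ := D.exists_bound_curve hk Q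
  obtain ⟨M₂, hM₂⟩ := D.exists_bound_curve hk' Q
  have hμI := Ioo_subset_Icc_self hμ.mem
  obtain ⟨r, hr⟩ := hμ.notVertex
  have hnh : Icc 0 D.ℓ ∈ 𝓝 μ := Icc_mem_nhds hμ.mem.1 hμ.mem.2
  have hA₀ : Icc 0 D.ℓ ∩ D.L₂ ⁻¹' Ici Q.2 ∈ 𝓝 μ :=
    inter_mem hnh ((D.continuousOn_L₂.continuousAt hnh).preimage_mem_nhds
      (Ici_mem_nhds (snd_lt_of_crossing₁ hQ.1 hμI hμ.eq)))
  -- The end of the arc moves with speed `1 / L₁'`, which is negative because `L₁` decreases. This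
  -- is the source of the minus sign in `fiber₁`.
  have hC := hasDerivAt_integral_curve (κ := fun ν x => k (D.pt ν) (x, Q.2))
    (κ' := fun ν x => k' (D.pt ν) (x, Q.2)) (M := max M₁ M₂) (e := (deriv D.L₁ μ)⁻¹)
    D.continuousOn_L₁ (measurableSet_arc₂ Q.2) hA₀ hμ.mem hμ.uniq hh
    ((hhc r).continuousAt (Ioo_mem_nhds hr.1 hr.2))
    (fun x => hk.comp_continuousOn (f := fun ν => (D.pt ν, (x, Q.2)))
      (D.continuousOn_pt.prodMk continuousOn_const))
    (fun ν x => hd (D.pt ν) (x, Q.2))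
    (fun ν hν => (hM₁ ν hν (Q.1, Q.2) (by simp) (by simp)).trans (le_max_left _ _))
    (fun ν hν x hx => (hM₂ ν hν (x, Q.2) (abs_le.2 ⟨by linarith [hx.1], by linarith [hx.2]⟩)
      (by simp)).trans (le_max_right _ _))
    (fun w hw hwc => by
      have := hasDerivAt_integral_antitone D.antitone₁ hμ.mem hμ.strict hμ.deriv_ne hw hwc
      rwa [hμ.eq, div_eq_inv_mul] at this)
  have hV : HasDerivAt (fun σ => ∑ r : Fin D.N, c r * k (D.vertex r.succ.castSucc) (σ, Q.2)
      * (W (D.vertex r.succ.castSucc)).indicator (fun _ => (1 : ℝ)) (σ, Q.2))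
      (∑ r : Fin D.N, c r * k' (D.vertex r.succ.castSucc) Q
      * (W (D.vertex r.succ.castSucc)).indicator (fun _ => (1 : ℝ)) Q) Q.1 := by
    refine HasDerivAt.fun_sum fun r _ => ?_
    refine (((hd _ Q).const_mul (c r)).mul_const _).congr_of_eventuallyEq ?_
    have hc : ContinuousAt (fun σ : ℝ => ((σ, Q.2) : Plane)) Q.1 := by fun_prop
    filter_upwards [hc.eventually (eventually_indicator_W_eq hQ r.succ.castSucc)] with σ hσ
    rw [hσ]
  have hsum := (hI.add hC).add hV
  refine (hsum.congr_of_eventuallyEq ?_).congr_deriv ?_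
  · filter_upwards [lt_mem_nhds p1] with σ hσ
    simp only [pairing, Pi.add_apply]
    rw [integral_E₁ _ (Q := (σ, Q.2)) hσ.le p2.le,
      integral_arc₁ h (fun ν => k (D.pt ν) (σ, Q.2)) (Q := (σ, Q.2)) hσ.le p2.le]
  · simp only [pairing, fiber₁]
    rw [integral_E₁ _ p1.le p2.le, integral_arc₁ h (fun ν => k' (D.pt ν) Q) p1.le p2.le]
    simp only [mem_inter_iff, mem_ofPred_eq, Prod.mk.eta]
    ring

/-- The `t`-derivative of the pairing at a regular point. -/
theorem hasDerivAt_pairing₂ (hg : Continuous g) (hh : IntegrableOn h (Icc 0 D.ℓ))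
    (hhc : ∀ r : Fin (D.N + 1), ContinuousOn h (Ioo (D.vpar r.castSucc) (D.vpar r.succ)))
    (hk : Continuous (Function.uncurry k)) (hk' : Continuous (Function.uncurry k'))
    (hd : ∀ P X, HasDerivAt (fun τ => k P (X.1, τ)) (k' P X) X.2)
    (hQ : Q ∈ D.regularPart) (hμ : D.IsCrossing₂ Q μ) :
    HasDerivAt (fun τ => D.pairing g h c k (Q.1, τ))
      (D.pairing g h c k' Q - D.fiber₂ g h μ k Q) Q.2 := by
  obtain ⟨p1, p2, -⟩ := D.exists_lt_of_mem_G hQ.1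
  have hΩ : MeasurableSet (D.G ∩ {P : Plane | Q.1 ≤ P.1}) :=
    D.isOpen_G.measurableSet.inter (measurableSet_le measurable_const measurable_fst)
  have hfr : ∀ᵐ s : ℝ, (s, Q.2) ∉ frontier (D.G ∩ {P : Plane | Q.1 ≤ P.1}) := by
    filter_upwards [ae_notMem_frontier₂ p2 hμ.mem hμ.eq hμ.uniq, ae_ne_const Q.1] with t h1 h2 h3
    rcases frontier_inter_subset _ _ h3 with h4 | h4
    · exact h1 h4.1
    · exact h2 (frontier_le_subset_eq continuous_const continuous_fst h4.2).symm
  have hI := hasDerivAt_integral_region₂ (κ := fun P x => k P (Q.1, x))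
    (κ' := fun P x => k' P (Q.1, x)) hΩ (D.isBounded_G.subset inter_subset_left) hg
    (hk.comp (f := fun z : Plane × ℝ => (z.1, (Q.1, z.2))) (by fun_prop))
    (hk'.comp (f := fun z : Plane × ℝ => (z.1, (Q.1, z.2))) (by fun_prop))
    (fun P x => hd P (Q.1, x)) hfr
  obtain ⟨M₁, hM₁⟩ := D.exists_bound_curve hk Q
  obtain ⟨M₂, hM₂⟩ := D.exists_bound_curve hk' Q
  have hμI := Ioo_subset_Icc_self hμ.mem
  obtain ⟨r, hr⟩ := hμ.notVertex
  have hnh : Icc 0 D.ℓ ∈ 𝓝 μ := Icc_mem_nhds hμ.mem.1 hμ.mem.2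
  have hA₀ : Icc 0 D.ℓ ∩ D.L₁ ⁻¹' Ici Q.1 ∈ 𝓝 μ :=
    inter_mem hnh ((D.continuousOn_L₁.continuousAt hnh).preimage_mem_nhds
      (Ici_mem_nhds (fst_lt_of_crossing₂ hQ.1 hμI hμ.eq)))
  have hC := hasDerivAt_integral_curve (κ := fun ν x => k (D.pt ν) (Q.1, x))
    (κ' := fun ν x => k' (D.pt ν) (Q.1, x)) (M := max M₁ M₂) (e := -(deriv D.L₂ μ)⁻¹)
    D.continuousOn_L₂ (measurableSet_arc₁ Q.1) hA₀ hμ.mem hμ.uniq hh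
    ((hhc r).continuousAt (Ioo_mem_nhds hr.1 hr.2))
    (fun x => hk.comp_continuousOn (f := fun ν => (D.pt ν, (Q.1, x)))
      (D.continuousOn_pt.prodMk continuousOn_const))
    (fun ν x => hd (D.pt ν) (Q.1, x))
    (fun ν hν => (hM₁ ν hν (Q.1, Q.2) (by simp) (by simp)).trans (le_max_left _ _))
    (fun ν hν x hx => (hM₂ ν hν (Q.1, x) (by simp)
      (abs_le.2 ⟨by linarith [hx.1], by linarith [hx.2]⟩)).trans (le_max_right _ _))
    (fun w hw hwc => by
      have := hasDerivAt_integral_monotone D.monotone₂ hμ.mem hμ.strict hμ.deriv_ne hw hwc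
      rwa [hμ.eq, div_eq_inv_mul, ← neg_mul] at this)
  have hV : HasDerivAt (fun τ => ∑ r : Fin D.N, c r * k (D.vertex r.succ.castSucc) (Q.1, τ)
      * (W (D.vertex r.succ.castSucc)).indicator (fun _ => (1 : ℝ)) (Q.1, τ))
      (∑ r : Fin D.N, c r * k' (D.vertex r.succ.castSucc) Q
      * (W (D.vertex r.succ.castSucc)).indicator (fun _ => (1 : ℝ)) Q) Q.2 := by
    refine HasDerivAt.fun_sum fun r _ => ?_
    refine (((hd _ Q).const_mul (c r)).mul_const _).congr_of_eventuallyEq ?_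
    have hc : ContinuousAt (fun τ : ℝ => ((Q.1, τ) : Plane)) Q.2 := by fun_prop
    filter_upwards [hc.eventually (eventually_indicator_W_eq hQ r.succ.castSucc)] with τ hτ
    rw [hτ]
  have hsum := (hI.add hC).add hV
  refine (hsum.congr_of_eventuallyEq ?_).congr_deriv ?_
  · filter_upwards [lt_mem_nhds p2] with τ hτ
    simp only [pairing, Pi.add_apply]
    rw [integral_E₂ _ (Q := (Q.1, τ)) p1.le hτ.le,
      integral_arc₂ h (fun ν => k (D.pt ν) (Q.1, τ)) (Q := (Q.1, τ)) p1.le hτ.le]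
  · simp only [pairing, fiber₂]
    rw [integral_E₂ _ p1.le p2.le, integral_arc₂ h (fun ν => k' (D.pt ν) Q) p1.le p2.le]
    simp only [mem_inter_iff, mem_ofPred_eq, Prod.mk.eta]
    ring

/-- The `t`-derivative of the density on a vertical line. -/
theorem hasDerivAt_fiber₁ (hg : Continuous g) (hk : Continuous (Function.uncurry k))
    (hk' : Continuous (Function.uncurry k'))
    (hd : ∀ P X, HasDerivAt (fun τ => k P (X.1, τ)) (k' P X) X.2) (hQ : Q ∈ D.G) :
    HasDerivAt (fun τ => D.fiber₁ g h μ k (Q.1, τ))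
      (D.fiber₁ g h μ k' Q - g Q * k Q Q) Q.2 := by
  have hb : Bornology.IsBounded {t | (Q.1, t) ∈ D.G} :=
    (Metric.isBounded_Icc 0 D.b).subset fun t ht => snd_mem_of_mem_G (P := (Q.1, t)) ht
  have h1 := hasDerivAt_integral_halfLine (x₀ := Q.2) (Θ := {t | (Q.1, t) ∈ D.G})
    (g := fun t => g (Q.1, t)) (κ := fun t x => k (Q.1, t) (Q.1, x))
    (κ' := fun t x => k' (Q.1, t) (Q.1, x))
    (D.isOpen_G.preimage (by fun_prop : Continuous fun t : ℝ => ((Q.1, t) : Plane))) hb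
    (by fun_prop) (hk.comp (f := fun z : ℝ × ℝ => ((Q.1, z.1), (Q.1, z.2))) (by fun_prop))
    (hk'.comp (f := fun z : ℝ × ℝ => ((Q.1, z.1), (Q.1, z.2))) (by fun_prop))
    (fun t x => hd (Q.1, t) (Q.1, x)) hQ
  refine (h1.sub (((hd (D.pt μ) Q).const_mul (h μ)).const_mul (deriv D.L₁ μ)⁻¹)).congr_deriv ?_
  simp only [fiber₁, Prod.mk.eta]
  change _ + (∫ t in {t | (Q.1, t) ∈ D.G ∧ Q.2 ≤ t}, _) - _ = _
  ring

/-- The `s`-derivative of the density on a horizontal line. -/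
theorem hasDerivAt_fiber₂ (hg : Continuous g) (hk : Continuous (Function.uncurry k))
    (hk' : Continuous (Function.uncurry k'))
    (hd : ∀ P X, HasDerivAt (fun σ => k P (σ, X.2)) (k' P X) X.1) (hQ : Q ∈ D.G) :
    HasDerivAt (fun σ => D.fiber₂ g h μ k (σ, Q.2))
      (D.fiber₂ g h μ k' Q - g Q * k Q Q) Q.1 := by
  have hb : Bornology.IsBounded {s | (s, Q.2) ∈ D.G} :=
    (Metric.isBounded_Icc 0 D.a).subset fun s hs => fst_mem_of_mem_G (P := (s, Q.2)) hs
  have h1 := hasDerivAt_integral_halfLine (x₀ := Q.1) (Θ := {s | (s, Q.2) ∈ D.G})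
    (g := fun s => g (s, Q.2)) (κ := fun s x => k (s, Q.2) (x, Q.2))
    (κ' := fun s x => k' (s, Q.2) (x, Q.2))
    (D.isOpen_G.preimage (by fun_prop : Continuous fun s : ℝ => ((s, Q.2) : Plane))) hb
    (by fun_prop) (hk.comp (f := fun z : ℝ × ℝ => ((z.1, Q.2), (z.2, Q.2))) (by fun_prop))
    (hk'.comp (f := fun z : ℝ × ℝ => ((z.1, Q.2), (z.2, Q.2))) (by fun_prop))
    (fun s x => hd (s, Q.2) (x, Q.2)) hQ
  refine (h1.add (((hd (D.pt μ) Q).const_mul (h μ)).const_mul (deriv D.L₂ μ)⁻¹)).congr_deriv ?_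
  simp only [fiber₂, Prod.mk.eta]
  change _ + (∫ s in {s | (s, Q.2) ∈ D.G ∧ Q.1 ≤ s}, _) + _ = _
  ring

end Pairing

end CurvilinearDomain

end Goursat

end

/-! ### Regularity of coefficients and sources along the state, and cutoffs -/

noncomputable section

namespace Goursat

open Filter Topology

section PartialDerivatives

variable {F : Type*} [NormedAddCommGroup F] [NormedSpace ℝ F] {g : Plane → F} {P : Plane}

theorem hasDerivAt_fst (hg : DifferentiableAt ℝ g P) :
    HasDerivAt (fun s => g (s, P.2)) (fderiv ℝ g P (1, 0)) P.1 := by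
  have h1 : HasDerivAt (fun s : ℝ => ((s, P.2) : Plane)) (1, 0) P.1 :=
    (hasDerivAt_id _).prodMk (hasDerivAt_const _ _)
  exact HasFDerivAt.comp_hasDerivAt (f := fun s : ℝ => ((s, P.2) : Plane)) P.1 hg.hasFDerivAt h1

theorem hasDerivAt_snd (hg : DifferentiableAt ℝ g P) :
    HasDerivAt (fun t => g (P.1, t)) (fderiv ℝ g P (0, 1)) P.2 := by
  have h1 : HasDerivAt (fun t : ℝ => ((P.1, t) : Plane)) (0, 1) P.2 :=
    (hasDerivAt_const _ _).prodMk (hasDerivAt_id _)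
  exact HasFDerivAt.comp_hasDerivAt (f := fun t : ℝ => ((P.1, t) : Plane)) P.2 hg.hasFDerivAt h1

theorem dS_eq (hg : DifferentiableAt ℝ g P) : dS g P = fderiv ℝ g P (1, 0) :=
  (hasDerivAt_fst hg).deriv

theorem dT_eq (hg : DifferentiableAt ℝ g P) : dT g P = fderiv ℝ g P (0, 1) :=
  (hasDerivAt_snd hg).deriv

theorem hasDerivAt_dS (hg : DifferentiableAt ℝ g P) :
    HasDerivAt (fun s => g (s, P.2)) (dS g P) P.1 := by
  rw [dS_eq hg]; exact hasDerivAt_fst hg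

theorem hasDerivAt_dT (hg : DifferentiableAt ℝ g P) :
    HasDerivAt (fun t => g (P.1, t)) (dT g P) P.2 := by
  rw [dT_eq hg]; exact hasDerivAt_snd hg

variable {O : Set Plane} {j k : ℕ∞}

theorem contDiffOn_dS (hO : IsOpen O) (hg : ContDiffOn ℝ j g O) (hkj : k + 1 ≤ j) :
    ContDiffOn ℝ k (dS g) O := by
  have h1 : ContDiffOn ℝ k (fun P => fderiv ℝ g P (1, 0)) O :=
    (hg.fderiv_of_isOpen hO (by exact_mod_cast hkj)).clm_apply contDiffOn_const
  refine h1.congr fun P hP => dS_eq ?_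
  exact (hg.contDiffAt (hO.mem_nhds hP)).differentiableAt
    (by exact_mod_cast (lt_of_lt_of_le (by simp) hkj).ne')

theorem contDiffOn_dT (hO : IsOpen O) (hg : ContDiffOn ℝ j g O) (hkj : k + 1 ≤ j) :
    ContDiffOn ℝ k (dT g) O := by
  have h1 : ContDiffOn ℝ k (fun P => fderiv ℝ g P (0, 1)) O :=
    (hg.fderiv_of_isOpen hO (by exact_mod_cast hkj)).clm_apply contDiffOn_const
  refine h1.congr fun P hP => dT_eq ?_
  exact (hg.contDiffAt (hO.mem_nhds hP)).differentiableAt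
    (by exact_mod_cast (lt_of_lt_of_le (by simp) hkj).ne')

end PartialDerivatives

section Along

variable {n m : ℕ} {O : Set Plane} {h : Plane → Vec n → Vec n → Vec n → Vec m → ℝ}
  {x : Plane → Vec n} {u : Plane → Vec m}

/-- The partial derivative in one slot is the full derivative in that direction. -/
theorem pd_comp_eq {E : Type*} [NormedAddCommGroup E] [NormedSpace ℝ E] {G : E → ℝ}
    {ι : Vec n → E} {ι' : Vec n →L[ℝ] E} {y : Vec n} (hι : HasFDerivAt ι ι' y)
    (hG : DifferentiableAt ℝ G (ι y)) (i : Fin n) :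
    pd (fun y => G (ι y)) i y = fderiv ℝ G (ι y) (ι' (Pi.single i 1)) := by
  unfold pd
  have h : HasFDerivAt (fun y => G (ι y)) ((fderiv ℝ G (ι y)).comp ι') y :=
    hG.hasFDerivAt.comp y hι
  rw [h.fderiv]
  rfl

theorem contDiffOn_jet (hO : IsOpen O) (hx : ContDiffOn ℝ 2 x O) (hu : ContDiffOn ℝ 1 u O) :
    ContDiffOn ℝ 1 (fun P => (P, x P, dS x P, dT x P, u P)) O := by
  have h1 : ContDiffOn ℝ 1 (dS x) O := contDiffOn_dS (j := 2) (k := 1) hO hx (by norm_num)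
  have h2 : ContDiffOn ℝ 1 (dT x) O := contDiffOn_dT (j := 2) (k := 1) hO hx (by norm_num)
  exact contDiffOn_id.prodMk ((hx.of_le (by norm_num)).prodMk (h1.prodMk (h2.prodMk hu)))

/-- One derivative of the `C²` data, composed with the `C¹` jet of the state and the control, is
still `C¹`. This is exactly what the total derivatives in the sources and in `K` require. -/
theorem contDiffOn_fderiv_jet (hO : IsOpen O) (hh : SmoothOver O h) (hx : ContDiffOn ℝ 2 x O)
    (hu : ContDiffOn ℝ 1 u O) (e : Plane × Vec n × Vec n × Vec n × Vec m) :
    ContDiffOn ℝ 1 (fun P => fderiv ℝ (fun z : Plane × Vec n × Vec n × Vec n × Vec m =>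
      h z.1 z.2.1 z.2.2.1 z.2.2.2.1 z.2.2.2.2) (P, x P, dS x P, dT x P, u P) e) O := by
  have h1 := (ContDiffOn.fderiv_of_isOpen (m := 1) hh (hO.prod isOpen_univ) (by norm_num)).comp
    (contDiffOn_jet hO hx hu) (fun P hP => ⟨hP, mem_univ _⟩)
  exact h1.clm_apply contDiffOn_const

theorem SmoothOver.differentiableAt (hO : IsOpen O) (hh : SmoothOver O h) {P : Plane} (hP : P ∈ O)
    (z : Vec n × Vec n × Vec n × Vec m) :
    DifferentiableAt ℝ (fun z : Plane × Vec n × Vec n × Vec n × Vec m =>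
      h z.1 z.2.1 z.2.2.1 z.2.2.2.1 z.2.2.2.2) (P, z) :=
  (ContDiffOn.contDiffAt hh ((hO.prod isOpen_univ).mem_nhds ⟨hP, mem_univ _⟩)).differentiableAt
    (by norm_num)

theorem contDiffOn_alongX (hO : IsOpen O) (hh : SmoothOver O h) (hx : ContDiffOn ℝ 2 x O)
    (hu : ContDiffOn ℝ 1 u O) (i : Fin n) : ContDiffOn ℝ 1 (alongX h x u i) O := by
  refine (contDiffOn_fderiv_jet hO hh hx hu (0, Pi.single i 1, 0, 0, 0)).congr fun P hP => ?_
  exact pd_comp_eq (ι := fun y => (P, y, dS x P, dT x P, u P))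
    ((hasFDerivAt_const P _).prodMk ((hasFDerivAt_id _).prodMk ((hasFDerivAt_const _ _).prodMk
      ((hasFDerivAt_const _ _).prodMk (hasFDerivAt_const _ _)))))
    (hh.differentiableAt hO hP _) i

theorem contDiffOn_alongP (hO : IsOpen O) (hh : SmoothOver O h) (hx : ContDiffOn ℝ 2 x O)
    (hu : ContDiffOn ℝ 1 u O) (i : Fin n) : ContDiffOn ℝ 1 (alongP h x u i) O := by
  refine (contDiffOn_fderiv_jet hO hh hx hu (0, 0, Pi.single i 1, 0, 0)).congr fun P hP => ?_
  exact pd_comp_eq (ι := fun y => (P, x P, y, dT x P, u P))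
    ((hasFDerivAt_const P _).prodMk ((hasFDerivAt_const _ _).prodMk ((hasFDerivAt_id _).prodMk
      ((hasFDerivAt_const _ _).prodMk (hasFDerivAt_const _ _)))))
    (hh.differentiableAt hO hP _) i

theorem contDiffOn_alongQ (hO : IsOpen O) (hh : SmoothOver O h) (hx : ContDiffOn ℝ 2 x O)
    (hu : ContDiffOn ℝ 1 u O) (i : Fin n) : ContDiffOn ℝ 1 (alongQ h x u i) O := by
  refine (contDiffOn_fderiv_jet hO hh hx hu (0, 0, 0, Pi.single i 1, 0)).congr fun P hP => ?_
  exact pd_comp_eq (ι := fun y => (P, x P, dS x P, y, u P))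
    ((hasFDerivAt_const P _).prodMk ((hasFDerivAt_const _ _).prodMk
      ((hasFDerivAt_const _ _).prodMk ((hasFDerivAt_id _).prodMk (hasFDerivAt_const _ _)))))
    (hh.differentiableAt hO hP _) i

theorem smoothOver_fc {C : ControlProblem n m} (hf : SmoothOver O C.f) (i : Fin n) :
    SmoothOver O (C.fc i) := contDiffOn_pi.1 hf i

theorem continuousOn_sourceG {C : ControlProblem n m} (hO : IsOpen O) (hΦ : SmoothOver O C.Φ)
    (hx : ContDiffOn ℝ 2 x O) (hu : ContDiffOn ℝ 1 u O) (i : Fin n) :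
    ContinuousOn (sourceG C x u i) O := by
  have h1 := (contDiffOn_alongX hO hΦ hx hu i).continuousOn
  have h2 := (contDiffOn_dS (k := 0) hO (contDiffOn_alongP hO hΦ hx hu i) (by simp)).continuousOn
  have h3 := (contDiffOn_dT (k := 0) hO (contDiffOn_alongQ hO hΦ hx hu i) (by simp)).continuousOn
  exact (h1.sub h2).sub h3

end Along

section SourceCurve

variable {n m : ℕ} {O : Set Plane} {D : CurvilinearDomain} {C : ControlProblem n m}
  {x : Plane → Vec n} {u : Plane → Vec m}

/-- On each arc, the source on the curve has a continuous extension to the closed arc. -/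
theorem exists_continuousOn_sourceCurve (hO : IsOpen O) (hDO : D.closedRegion ⊆ O)
    (hΦ : SmoothOver O C.Φ) (hΦ₁ : SmoothAlongArcs D C.Φ₁) (hx : ContDiffOn ℝ 2 x O)
    (hu : ContDiffOn ℝ 1 u O) (i : Fin n) (r : Fin (D.N + 1)) :
    ∃ H : ℝ → ℝ, ContinuousOn H (Icc (D.vpar r.castSucc) (D.vpar r.succ)) ∧
      EqOn (sourceCurve D C x u i) H (Ioo (D.vpar r.castSucc) (D.vpar r.succ)) := by
  set I := Icc (D.vpar r.castSucc) (D.vpar r.succ) with hI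
  set J := Ioo (D.vpar r.castSucc) (D.vpar r.succ) with hJ
  have hlt := D.vpar_lt r
  have hJI : J ⊆ I := Ioo_subset_Icc_self
  have hud : UniqueDiffOn ℝ I := uniqueDiffOn_Icc hlt
  have hnh : ∀ μ ∈ J, I ∈ 𝓝 μ := fun μ hμ => Icc_mem_nhds hμ.1 hμ.2
  have hud' : UniqueDiffOn ℝ (I ×ˢ (univ : Set (Vec n × Vec n))) := hud.prod uniqueDiffOn_univ
  have hnh' : ∀ μ ∈ J, ∀ z : Vec n × Vec n, I ×ˢ (univ : Set (Vec n × Vec n)) ∈ 𝓝 (μ, z) :=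
    fun μ hμ z => prod_mem_nhds (hnh μ hμ) univ_mem
  have hmaps : MapsTo D.pt I O := fun μ hμ => hDO (D.pt_mem (D.arc_subset r hμ))
  -- One-sided derivatives on the closed arc replace `deriv`, which says nothing useful at a vertex.
  -- The two agree on the open arc.
  have hl₁ : ContDiffOn ℝ 1 (derivWithin D.L₁ I) I := (D.smooth₁ r).derivWithin hud (by norm_num)
  have hl₂ : ContDiffOn ℝ 1 (derivWithin D.L₂ I) I := (D.smooth₂ r).derivWithin hud (by norm_num)
  have hd₁ : ∀ μ ∈ J, derivWithin D.L₁ I μ = deriv D.L₁ μ := fun μ hμ =>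
    derivWithin_of_mem_nhds (hnh μ hμ)
  have hd₂ : ∀ μ ∈ J, derivWithin D.L₂ I μ = deriv D.L₂ μ := fun μ hμ =>
    derivWithin_of_mem_nhds (hnh μ hμ)
  have hpt : ContDiffOn ℝ 1 D.pt I :=
    ((D.smooth₁ r).of_le (by norm_num)).prodMk ((D.smooth₂ r).of_le (by norm_num))
  have hxs : ContDiffOn ℝ 1 (fun μ => dS x (D.pt μ)) I :=
    (contDiffOn_dS (j := 2) (k := 1) hO hx (by norm_num)).comp hpt hmaps
  have hxt : ContDiffOn ℝ 1 (fun μ => dT x (D.pt μ)) I :=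
    (contDiffOn_dT (j := 2) (k := 1) hO hx (by norm_num)).comp hpt hmaps
  have hxp : ContDiffOn ℝ 1 (fun μ => x (D.pt μ)) I :=
    (hx.of_le (by norm_num)).comp hpt hmaps
  let T : ℝ → Vec n := fun μ =>
    derivWithin D.L₁ I μ • dS x (D.pt μ) + derivWithin D.L₂ I μ • dT x (D.pt μ)
  have hT : ContDiffOn ℝ 1 T I := (hl₁.smul hxs).add (hl₂.smul hxt)
  have hTt : ∀ μ ∈ J, D.tangential x μ = T μ := fun μ hμ => by
    simp only [CurvilinearDomain.tangential, CurvilinearDomain.n₁, CurvilinearDomain.n₂, T,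
      hd₁ μ hμ, hd₂ μ hμ, neg_neg]
  obtain ⟨g, hg, hgΦ⟩ := hΦ₁ r
  have hj : ContDiffOn ℝ 1 (fun μ => (μ, x (D.pt μ), T μ)) I := contDiffOn_id.prodMk (hxp.prodMk hT)
  have hfd : ∀ e : ℝ × Vec n × Vec n, ContDiffOn ℝ 1 (fun μ =>
      fderivWithin ℝ g (I ×ˢ univ) (μ, x (D.pt μ), T μ) e) I := fun e =>
    (((hg.fderivWithin (m := 1) hud' (by norm_num)).comp hj
      fun μ hμ => ⟨hμ, mem_univ _⟩)).clm_apply contDiffOn_const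
  have hgd : ∀ μ ∈ J, ∀ z, DifferentiableAt ℝ g (μ, z) := fun μ hμ z =>
    (hg.contDiffAt (hnh' μ hμ z)).differentiableAt (by norm_num)
  have hX : ∀ μ ∈ J, bdryX D C x i μ
      = fderivWithin ℝ g (I ×ˢ univ) (μ, x (D.pt μ), T μ) (0, Pi.single i 1, 0) := by
    intro μ hμ
    rw [fderivWithin_of_mem_nhds (hnh' μ hμ _)]
    unfold bdryX
    rw [hTt μ hμ, funext fun y => hgΦ μ hμ y (T μ)]
    exact pd_comp_eq (G := g) (ι := fun y => (μ, y, T μ)) ((hasFDerivAt_const _ _).prodMk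
      ((hasFDerivAt_id _).prodMk (hasFDerivAt_const _ _))) (hgd μ hμ _) i
  have hE : ∀ μ ∈ J, bdryEta D C x i μ
      = fderivWithin ℝ g (I ×ˢ univ) (μ, x (D.pt μ), T μ) (0, 0, Pi.single i 1) := by
    intro μ hμ
    rw [fderivWithin_of_mem_nhds (hnh' μ hμ _)]
    unfold bdryEta
    rw [hTt μ hμ, funext fun y => hgΦ μ hμ (x (D.pt μ)) y]
    exact pd_comp_eq (G := g) (ι := fun y => (μ, x (D.pt μ), y)) ((hasFDerivAt_const _ _).prodMk
      ((hasFDerivAt_const _ _).prodMk (hasFDerivAt_id _))) (hgd μ hμ _) i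
  have hE' : ∀ μ ∈ J, deriv (bdryEta D C x i) μ = derivWithin (fun μ =>
      fderivWithin ℝ g (I ×ˢ univ) (μ, x (D.pt μ), T μ) (0, 0, Pi.single i 1)) I μ := by
    intro μ hμ
    rw [derivWithin_of_mem_nhds (hnh μ hμ)]
    apply Filter.EventuallyEq.deriv_eq
    filter_upwards [Ioo_mem_nhds hμ.1 hμ.2] with ν hν using hE ν hν
  refine ⟨fun μ => derivWithin D.L₂ I μ * alongP C.Φ x u i (D.pt μ)
      + -derivWithin D.L₁ I μ * alongQ C.Φ x u i (D.pt μ)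
      + fderivWithin ℝ g (I ×ˢ univ) (μ, x (D.pt μ), T μ) (0, Pi.single i 1, 0)
      - derivWithin (fun μ =>
        fderivWithin ℝ g (I ×ˢ univ) (μ, x (D.pt μ), T μ) (0, 0, Pi.single i 1)) I μ, ?_, ?_⟩
  · have c1 := (contDiffOn_alongP hO hΦ hx hu i).continuousOn.comp hpt.continuousOn hmaps
    have c2 := (contDiffOn_alongQ hO hΦ hx hu i).continuousOn.comp hpt.continuousOn hmaps
    exact (((hl₂.continuousOn.mul c1).add (hl₁.continuousOn.neg.mul c2)).add
      (hfd _).continuousOn).sub ((hfd _).continuousOn_derivWithin hud (by norm_num))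
  · intro μ hμ
    simp only [sourceCurve, CurvilinearDomain.n₁, CurvilinearDomain.n₂]
    rw [hX μ hμ, hE' μ hμ, hd₁ μ hμ, hd₂ μ hμ]

theorem continuousOn_sourceCurve (hO : IsOpen O) (hDO : D.closedRegion ⊆ O)
    (hΦ : SmoothOver O C.Φ) (hΦ₁ : SmoothAlongArcs D C.Φ₁) (hx : ContDiffOn ℝ 2 x O)
    (hu : ContDiffOn ℝ 1 u O) (i : Fin n) (r : Fin (D.N + 1)) :
    ContinuousOn (sourceCurve D C x u i) (Ioo (D.vpar r.castSucc) (D.vpar r.succ)) := by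
  obtain ⟨H, hH, hEq⟩ := exists_continuousOn_sourceCurve hO hDO hΦ hΦ₁ hx hu i r
  exact (hH.mono Ioo_subset_Icc_self).congr hEq

/-- On each open arc the density is the restriction of a function continuous on the closed arc. Its
values at the finitely many vertices do not matter. -/
theorem integrableOn_sourceCurve (hO : IsOpen O) (hDO : D.closedRegion ⊆ O)
    (hΦ : SmoothOver O C.Φ) (hΦ₁ : SmoothAlongArcs D C.Φ₁) (hx : ContDiffOn ℝ 2 x O)
    (hu : ContDiffOn ℝ 1 u O) (i : Fin n) :
    IntegrableOn (sourceCurve D C x u i) (Icc 0 D.ℓ) := by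
  rw [D.Icc_eq_iUnion, integrableOn_finite_iUnion]
  intro r
  obtain ⟨H, hH, hEq⟩ := exists_continuousOn_sourceCurve hO hDO hΦ hΦ₁ hx hu i r
  rw [integrableOn_Icc_iff_integrableOn_Ioo]
  exact ((hH.integrableOn_compact isCompact_Icc).mono_set Ioo_subset_Icc_self).congr_fun
    hEq.symm measurableSet_Ioo

end SourceCurve

section Cutoff

/-- A smooth cutoff for a compact set inside an open set. -/
theorem exists_cutoff {K O : Set Plane} (hK : IsCompact K) (hO : IsOpen O) (hKO : K ⊆ O) :
    ∃ ζ : Plane → ℝ, ContDiff ℝ 1 ζ ∧ HasCompactSupport ζ ∧ tsupport ζ ⊆ O ∧ ∀ P ∈ K, ζ P = 1 := by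
  obtain ⟨L, hL, hKL, hLO⟩ := exists_compact_between hK hO hKO
  obtain ⟨f, h1, h0, -⟩ := exists_contMDiffMap_one_nhds_of_subset_interior (n := 1)
    (modelWithCornersSelf ℝ Plane) hK.isClosed hKL
  have hsupp : tsupport f ⊆ L :=
    closure_minimal (fun P hP => by by_contra h; exact hP (h0 P h)) hL.isClosed
  exact ⟨f, f.contMDiff.contDiff, HasCompactSupport.of_support_subset_isCompact hL
    (subset_closure.trans hsupp), hsupp.trans hLO, fun P hP => h1.self_of_nhdsSet P hP⟩

/-- Off the support of `ζ` the product is locally zero, whatever `f` is outside `O`. -/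
theorem contDiff_cutoff_mul {O : Set Plane} (hO : IsOpen O) {ζ f : Plane → ℝ} {k : ℕ∞}
    (hζ : ContDiff ℝ k ζ) (hsupp : tsupport ζ ⊆ O) (hf : ContDiffOn ℝ k f O) :
    ContDiff ℝ k fun P => ζ P * f P := by
  refine contDiff_iff_contDiffAt.2 fun P => ?_
  by_cases hP : P ∈ tsupport ζ
  · exact hζ.contDiffAt.mul (hf.contDiffAt (hO.mem_nhds (hsupp hP)))
  · refine (contDiffAt_const (c := (0 : ℝ))).congr_of_eventuallyEq ?_
    filter_upwards [notMem_tsupport_iff_eventuallyEq.1 hP] with X hX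
    rw [hX, Pi.zero_apply, zero_mul]

end Cutoff

end Goursat

end

/-! ### Identification of the Riemann function with the adjoint kernel -/

noncomputable section

namespace Goursat

open Filter Topology

open scoped Matrix.Norms.Operator

section MatrixValued

variable {n : ℕ}

theorem hasDerivAt_matrix {g : ℝ → Matrix (Fin n) (Fin n) ℝ} {g' : Matrix (Fin n) (Fin n) ℝ} {x : ℝ} :
    HasDerivAt g g' x ↔ ∀ i j, HasDerivAt (fun s => g s i j) (g' i j) x :=
  hasDerivAt_pi.trans (forall_congr' fun _ => hasDerivAt_pi)

theorem hasDerivWithinAt_matrix {g : ℝ → Matrix (Fin n) (Fin n) ℝ}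
    {g' : Matrix (Fin n) (Fin n) ℝ} {s : Set ℝ} {x : ℝ} :
    HasDerivWithinAt g g' s x ↔ ∀ i j, HasDerivWithinAt (fun s => g s i j) (g' i j) s x :=
  hasDerivWithinAt_pi.trans (forall_congr' fun _ => hasDerivWithinAt_pi)

theorem continuousOn_matrix {X : Type*} [TopologicalSpace X] {g : X → Matrix (Fin n) (Fin n) ℝ}
    {s : Set X} (h : ∀ i j, ContinuousOn (fun x => g x i j) s) : ContinuousOn g s :=
  continuousOn_pi.2 fun i => continuousOn_pi.2 fun j => h i j

end MatrixValued

section Riemann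

variable {n m : ℕ} {D : CurvilinearDomain} {C : ControlProblem n m} {x : Plane → Vec n}
  {u : Plane → Vec m} {R : Plane → Plane → Fin n → Fin n → ℝ} {O : Set Plane}

/-- The closed region is a lower set, so it contains the rectangle spanned by `Q` and `P`, and the
open rectangle lies in `G`. The entrywise Goursat problem therefore restricts to a matrix one, with
the coefficients acting from the left. -/
theorem IsRiemannFunction.isGoursatSolution (hR : IsRiemannFunction D C x u R)
    {A' B' C' : Plane → Matrix (Fin n) (Fin n) ℝ}
    (hA : ∀ P ∈ D.closedRegion, ∀ i k, A' P i k = alongX (C.fc i) x u k P)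
    (hB : ∀ P ∈ D.closedRegion, ∀ i k, B' P i k = alongP (C.fc i) x u k P)
    (hC : ∀ P ∈ D.closedRegion, ∀ i k, C' P i k = alongQ (C.fc i) x u k P)
    {P Q : Plane} (hP : P ∈ D.closedRegion) (hQ : Q ∈ D.closedRegion) (h1 : Q.1 < P.1)
    (h2 : Q.2 < P.2) :
    IsGoursatSolution A' B' C' P Q (fun X => Matrix.of fun i j => R X Q i j)
      (fun X => Matrix.of fun i j => dS (fun P' => R P' Q i j) X)
      (fun X => Matrix.of fun i j => dT (fun P' => R P' Q i j) X) := by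
  obtain ⟨q1, q2⟩ := D.nonneg_of_mem hQ
  have hcl : ∀ X ∈ Icc Q.1 P.1 ×ˢ Icc Q.2 P.2, X ∈ D.closedRegion := fun X hX =>
    D.mem_closedRegion_of_le hP (q1.trans hX.1.1) (q2.trans hX.2.1) hX.1.2 hX.2.2
  have hop : ∀ X ∈ Ioo Q.1 P.1 ×ˢ Ioo Q.2 P.2, X ∈ D.G := fun X hX =>
    D.mem_G_of_lt hP (q1.trans_lt hX.1.1) (q2.trans_lt hX.2.1) hX.1.2 hX.2.2
  have hopen : IsOpen {X ∈ D.G | Q.1 < X.1 ∧ Q.2 < X.2} :=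
    D.isOpen_G.inter ((isOpen_lt continuous_const continuous_fst).inter
      (isOpen_lt continuous_const continuous_snd))
  have hsub : Ioo Q.1 P.1 ×ˢ Ioo Q.2 P.2 ⊆ {X ∈ D.G | Q.1 < X.1 ∧ Q.2 < X.2} := fun X hX =>
    ⟨hop X hX, hX.1.1, hX.2.1⟩
  have hdiff : ∀ X ∈ Ioo Q.1 P.1 ×ˢ Ioo Q.2 P.2, ∀ i j,
      DifferentiableAt ℝ (fun P' => R P' Q i j) X := fun X hX i j =>
    ((hR.contDiffOn Q hQ i j).contDiffAt (hopen.mem_nhds (hsub hX))).differentiableAt (by norm_num)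
  refine ⟨?_, ?_, ?_, ?_, ?_, ?_, ?_, ?_, ?_⟩
  · refine continuousOn_matrix fun i j => (hR.continuousOn Q hQ i j).mono fun X hX => ?_
    exact ⟨hcl X hX, hX.1.1, hX.2.1⟩
  · exact continuousOn_matrix fun i j =>
      (contDiffOn_dS (k := 0) hopen (hR.contDiffOn Q hQ i j) (by simp)).continuousOn.mono hsub
  · exact continuousOn_matrix fun i j =>
      (contDiffOn_dT (k := 0) hopen (hR.contDiffOn Q hQ i j) (by simp)).continuousOn.mono hsub
  · exact fun X hX => hasDerivAt_matrix.2 fun i j => hasDerivAt_dS (hdiff X hX i j)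
  · exact fun X hX => hasDerivAt_matrix.2 fun i j => hasDerivAt_dT (hdiff X hX i j)
  · intro X hX
    refine hasDerivAt_matrix.2 fun i j => ?_
    refine (hR.equation Q hQ i j X (hop X hX) hX.1.1 hX.2.1).congr_deriv ?_
    have hX' := D.G_subset (hop X hX)
    simp only [Matrix.add_apply, Matrix.mul_apply, Matrix.of_apply, hA X hX', hB X hX', hC X hX',
      Finset.sum_add_distrib]
  · intro s hs
    have hm : (s, Q.2) ∈ D.closedRegion := hcl (s, Q.2) ⟨hs, le_rfl, h2.le⟩
    refine hasDerivWithinAt_matrix.2 fun i j => ?_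
    refine ((hR.edge_s Q hQ i j s hs.1 hm).mono fun s' hs' => ?_).congr_deriv ?_
    · exact ⟨hs'.1, hcl (s', Q.2) ⟨hs', le_rfl, h2.le⟩⟩
    · simp only [Matrix.mul_apply, Matrix.of_apply, hC _ hm]
  · intro t ht
    have hm : (Q.1, t) ∈ D.closedRegion := hcl (Q.1, t) ⟨⟨le_rfl, h1.le⟩, ht⟩
    refine hasDerivWithinAt_matrix.2 fun i j => ?_
    refine ((hR.edge_t Q hQ i j t ht.1 hm).mono fun t' ht' => ?_).congr_deriv ?_
    · exact ⟨ht'.1, hcl (Q.1, t') ⟨⟨le_rfl, h1.le⟩, ht'⟩⟩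
    · simp only [Matrix.mul_apply, Matrix.of_apply, hB _ hm]
  · ext i j
    simp only [Matrix.of_apply, hR.diagonal Q hQ i j, Matrix.one_apply]

/-- A matrix-valued function whose entries are continuous and vanish outside a common compact set
is continuous and bounded. -/
theorem exists_bound_matrix {L : Set Plane} (hL : IsCompact L)
    {g : Plane → Matrix (Fin n) (Fin n) ℝ} (hg : ∀ i j, Continuous fun P => g P i j)
    (h0 : ∀ P ∉ L, ∀ i j, g P i j = 0) : Continuous g ∧ ∃ c, ∀ P, ‖g P‖ ≤ c := by
  have hc : Continuous g := continuous_matrix hg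
  exact ⟨hc, (HasCompactSupport.intro hL fun P hP => by
    ext i j; exact h0 P hP i j).exists_bound_of_continuous hc⟩

/-- Any Riemann function of the linearized equation agrees, above the diagonal, with a function that
is defined on the whole plane and solves the adjoint equation in its second argument. -/
theorem IsRiemannFunction.exists_isAdjointRiemann (hR : IsRiemannFunction D C x u R)
    (hO : IsOpen O) (hDO : D.closedRegion ⊆ O) (hf : SmoothOver O C.f) (hx : ContDiffOn ℝ 2 x O)
    (hu : ContDiffOn ℝ 1 u O) :
    ∃ (B' C' K : Plane → Matrix (Fin n) (Fin n) ℝ) (S U V : Plane → Plane → Matrix (Fin n) (Fin n) ℝ),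
      IsAdjointRiemann B' C' K S U V ∧ Continuous B' ∧ Continuous C' ∧ Continuous K ∧
      (∀ P ∈ D.closedRegion, ∀ Q ∈ D.closedRegion, Q.1 < P.1 → Q.2 < P.2 →
        ∀ i j, R P Q i j = S P Q i j) ∧
      ∀ P ∈ D.G, ∀ i k, B' P i k = alongP (C.fc i) x u k P ∧ C' P i k = alongQ (C.fc i) x u k P ∧
        K P i k = alongX (C.fc i) x u k P - dS (alongP (C.fc i) x u k) P
          - dT (alongQ (C.fc i) x u k) P := by
  -- The cutoff extends the coefficients to bounded continuous functions on the plane, so that the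
  -- adjoint problem can be solved globally, and leaves them unchanged on the closed region.
  obtain ⟨ζ, hζ, hζc, hζO, hζ1⟩ := exists_cutoff D.isCompact_closedRegion hO hDO
  have hcX : ∀ i k, ContDiff ℝ 1 fun P => ζ P * alongX (C.fc i) x u k P := fun i k =>
    contDiff_cutoff_mul (k := 1) hO hζ hζO (contDiffOn_alongX hO (smoothOver_fc hf i) hx hu k)
  have hcP : ∀ i k, ContDiff ℝ 1 fun P => ζ P * alongP (C.fc i) x u k P := fun i k =>
    contDiff_cutoff_mul (k := 1) hO hζ hζO (contDiffOn_alongP hO (smoothOver_fc hf i) hx hu k)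
  have hcQ : ∀ i k, ContDiff ℝ 1 fun P => ζ P * alongQ (C.fc i) x u k P := fun i k =>
    contDiff_cutoff_mul (k := 1) hO hζ hζO (contDiffOn_alongQ hO (smoothOver_fc hf i) hx hu k)
  have hz : ∀ P ∉ tsupport ζ, ∀ f : Plane → ℝ, (fun X => ζ X * f X) =ᶠ[𝓝 P] fun _ => 0 := by
    intro P hP f
    filter_upwards [notMem_tsupport_iff_eventuallyEq.1 hP] with X hX
    rw [hX, Pi.zero_apply, zero_mul]
  have hnear : ∀ P ∈ D.G, ∀ f : Plane → ℝ, (fun X => ζ X * f X) =ᶠ[𝓝 P] f := by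
    intro P hP f
    filter_upwards [D.isOpen_G.mem_nhds hP] with X hX
    rw [hζ1 X (D.G_subset hX), one_mul]
  have hdS : ∀ {P : Plane} {f g : Plane → ℝ}, f =ᶠ[𝓝 P] g → dS f P = dS g P := fun {P f g} h => by
    have hc : ContinuousAt (fun s : ℝ => ((s, P.2) : Plane)) P.1 := by fun_prop
    exact Filter.EventuallyEq.deriv_eq (hc.eventually h)
  have hdT : ∀ {P : Plane} {f g : Plane → ℝ}, f =ᶠ[𝓝 P] g → dT f P = dT g P := fun {P f g} h => by
    have hc : ContinuousAt (fun t : ℝ => ((P.1, t) : Plane)) P.2 := by fun_prop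
    exact Filter.EventuallyEq.deriv_eq (hc.eventually h)
  have hcd : ∀ {f : Plane → ℝ}, ContDiff ℝ 1 f → Continuous (dS f) ∧ Continuous (dT f) :=
    fun {f} hf => ⟨by
      rw [← continuousOn_univ]
      exact (contDiffOn_dS (k := 0) isOpen_univ hf.contDiffOn (by simp)).continuousOn, by
      rw [← continuousOn_univ]
      exact (contDiffOn_dT (k := 0) isOpen_univ hf.contDiffOn (by simp)).continuousOn⟩
  let A' : Plane → Matrix (Fin n) (Fin n) ℝ := fun P => Matrix.of fun i k => ζ P * alongX (C.fc i) x u k P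
  let B' : Plane → Matrix (Fin n) (Fin n) ℝ := fun P => Matrix.of fun i k => ζ P * alongP (C.fc i) x u k P
  let C' : Plane → Matrix (Fin n) (Fin n) ℝ := fun P => Matrix.of fun i k => ζ P * alongQ (C.fc i) x u k P
  let Bs : Plane → Matrix (Fin n) (Fin n) ℝ := fun P => Matrix.of fun i k =>
    dS (fun X => ζ X * alongP (C.fc i) x u k X) P
  let Ct : Plane → Matrix (Fin n) (Fin n) ℝ := fun P => Matrix.of fun i k =>
    dT (fun X => ζ X * alongQ (C.fc i) x u k X) P
  have hζt : ∀ P ∉ tsupport ζ, ζ P = 0 := fun P hP => image_eq_zero_of_notMem_tsupport hP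
  have bA := exists_bound_matrix (g := A') hζc (fun i k => (hcX i k).continuous)
    fun P hP i k => by simp [A', hζt P hP]
  have bB := exists_bound_matrix (g := B') hζc (fun i k => (hcP i k).continuous)
    fun P hP i k => by simp [B', hζt P hP]
  have bC := exists_bound_matrix (g := C') hζc (fun i k => (hcQ i k).continuous)
    fun P hP i k => by simp [C', hζt P hP]
  have bBs := exists_bound_matrix (g := Bs) hζc (fun i k => (hcd (hcP i k)).1)
    fun P hP i k => by
      simp only [Bs, Matrix.of_apply]
      rw [hdS (hz P hP _)]
      simp [dS]
  have bCt := exists_bound_matrix (g := Ct) hζc (fun i k => (hcd (hcQ i k)).2)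
    fun P hP i k => by
      simp only [Ct, Matrix.of_apply]
      rw [hdT (hz P hP _)]
      simp [dT]
  obtain ⟨hAc, cA, hA'⟩ := bA
  obtain ⟨hBc, cB, hB'⟩ := bB
  obtain ⟨hCc, cC, hC'⟩ := bC
  obtain ⟨hBsc, cBs, hBs'⟩ := bBs
  obtain ⟨hCtc, cCt, hCt'⟩ := bCt
  -- The zeroth order coefficient of the adjoint operator, left over when the first order terms are
  -- moved onto the kernel.
  let K : Plane → Matrix (Fin n) (Fin n) ℝ := fun P => A' P - Bs P - Ct P
  have hKc : Continuous K := (hAc.sub hBsc).sub hCtc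
  have hK' : ∀ P, ‖K P‖ ≤ cA + cBs + cCt := fun P =>
    (norm_sub_le _ _).trans (add_le_add ((norm_sub_le _ _).trans (add_le_add (hA' P) (hBs' P)))
      (hCt' P))
  have : CompleteSpace (Matrix (Fin n) (Fin n) ℝ) := FiniteDimensional.complete ℝ _
  obtain ⟨S, U, V, hS⟩ := Goursat.exists_isAdjointRiemann hBc hCc hKc
    (c := max (max cB cC) (cA + cBs + cCt))
    (fun P => (hB' P).trans ((le_max_left _ _).trans (le_max_left _ _)))
    (fun P => (hC' P).trans ((le_max_right _ _).trans (le_max_left _ _)))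
    (fun P => (hK' P).trans (le_max_right _ _))
  refine ⟨B', C', K, S, U, V, hS, hBc, hCc, hKc, fun P hP Q hQ h1 h2 i j => ?_, fun P hP i k => ?_⟩
  · have hsol := hR.isGoursatSolution (A' := A') (B' := B') (C' := C')
      (fun X hX i k => by simp [A', hζ1 X hX]) (fun X hX i k => by simp [B', hζ1 X hX])
      (fun X hX i k => by simp [C', hζ1 X hX]) hP hQ h1 h2
    have hd : ∀ {f : Plane → ℝ}, ContDiff ℝ 1 f → Differentiable ℝ f := fun hf =>
      hf.differentiable (by norm_num)
    have := hsol.apply_eq hS hAc hBc hCc hCtc (Bs := Bs)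
      (fun X _ => hasDerivAt_matrix.2 fun i k => hasDerivAt_dS (hd (hcP i k) X))
      (fun X _ => hasDerivAt_matrix.2 fun i k => hasDerivAt_dT (hd (hcQ i k) X))
      (fun X _ => rfl) h1 h2
    rw [← this, Matrix.of_apply]
  · have h1 := hζ1 P (D.G_subset hP)
    refine ⟨by simp [B', h1], by simp [C', h1], ?_⟩
    simp only [K, A', Bs, Ct, Matrix.sub_apply, Matrix.of_apply, h1, one_mul]
    rw [hdS (hnear P hP _), hdT (hnear P hP _)]

end Riemann

end Goursat

end

/-! ### Vector-valued pairings and their mixed derivative -/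

noncomputable section

namespace Goursat

open Filter Topology

namespace CurvilinearDomain

section Linearity

variable {D : CurvilinearDomain} {g : Plane → ℝ} {h : ℝ → ℝ} {c : Fin D.N → ℝ} {Q : Plane} {μ : ℝ}
  {κ : Plane → ℝ} {ι : Type*} [Fintype ι] {k : Plane → Plane → ℝ} {a : ι → ℝ}
  {l : ι → Plane → Plane → ℝ}

theorem integrableOn_E (hg : Continuous g) (hκ : Continuous κ) (Q : Plane) :
    IntegrableOn (fun P => g P * κ P) (D.E Q) :=
  ((hg.mul hκ).continuousOn.integrableOn_compact D.isCompact_closedRegion).mono_set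
    fun _ hP => D.G_subset hP.1

theorem integrableOn_arc (hh : IntegrableOn h (Icc 0 D.ℓ)) (hκ : Continuous κ) (Q : Plane) :
    IntegrableOn (fun μ => h μ * κ (D.pt μ)) (D.arc Q) :=
  (hh.mul_continuousOn (hκ.comp_continuousOn D.continuousOn_pt) isCompact_Icc).mono_set
    fun _ hμ => hμ.1

theorem measurableSet_E (h1 : 0 ≤ Q.1) (h2 : 0 ≤ Q.2) : MeasurableSet (D.E Q) := by
  have h : D.E Q = D.G ∩ ({P : Plane | Q.1 ≤ P.1} ∩ {P : Plane | Q.2 ≤ P.2}) := by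
    ext P
    exact mem_E h1 h2
  rw [h]
  exact D.isOpen_G.measurableSet.inter ((measurableSet_le measurable_const measurable_fst).inter
    (measurableSet_le measurable_const measurable_snd))

theorem measurableSet_arc (h1 : 0 ≤ Q.1) (h2 : 0 ≤ Q.2) : MeasurableSet (D.arc Q) := by
  have h : D.arc Q = (Icc 0 D.ℓ ∩ D.L₁ ⁻¹' Ici Q.1) ∩ (Icc 0 D.ℓ ∩ D.L₂ ⁻¹' Ici Q.2) := by
    ext ν
    rw [mem_arc h1 h2]
    simp only [mem_inter_iff, mem_preimage, mem_Ici]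
    tauto
  rw [h]
  exact (measurableSet_arc₁ _).inter (measurableSet_arc₂ _)

theorem integrableOn_line₁ (hg : Continuous g) (hκ : Continuous κ) (Q : Plane) :
    IntegrableOn (fun t => g (Q.1, t) * κ (Q.1, t)) {t | (Q.1, t) ∈ D.G ∧ Q.2 ≤ t} :=
  (Continuous.continuousOn (by fun_prop)).integrableOn_compact (isCompact_Icc (a := 0) (b := D.b))
    |>.mono_set fun t ht => snd_mem_of_mem_G (P := (Q.1, t)) ht.1

theorem integrableOn_line₂ (hg : Continuous g) (hκ : Continuous κ) (Q : Plane) :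
    IntegrableOn (fun s => g (s, Q.2) * κ (s, Q.2)) {s | (s, Q.2) ∈ D.G ∧ Q.1 ≤ s} :=
  (Continuous.continuousOn (by fun_prop)).integrableOn_compact (isCompact_Icc (a := 0) (b := D.a))
    |>.mono_set fun s hs => fst_mem_of_mem_G (P := (s, Q.2)) hs.1

theorem pairing_eq_sum (hg : Continuous g) (hh : IntegrableOn h (Icc 0 D.ℓ))
    (hl : ∀ e, Continuous fun P => l e P Q) (hk : ∀ P, k P Q = ∑ e, a e * l e P Q) :
    D.pairing g h c k Q = ∑ e, a e * D.pairing g h c (l e) Q := by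
  simp only [pairing, hk, mul_add, Finset.sum_add_distrib, Finset.mul_sum, Finset.sum_mul]
  congr 1
  · congr 1
    · rw [integral_finsetSum _ fun e _ => ?_]
      · refine Finset.sum_congr rfl fun e _ => ?_
        rw [← integral_const_mul]
        simp only [mul_left_comm]
      · simp only [mul_left_comm (g _)]
        exact (integrableOn_E hg (hl e) Q).const_mul (a e)
    · rw [integral_finsetSum _ fun e _ => ?_]
      · refine Finset.sum_congr rfl fun e _ => ?_
        rw [← integral_const_mul]
        simp only [mul_left_comm]
      · simp only [mul_left_comm (h _)]
        exact (integrableOn_arc hh (hl e) Q).const_mul (a e)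
  · rw [Finset.sum_comm]
    refine Finset.sum_congr rfl fun e _ => Finset.sum_congr rfl fun r _ => ?_
    ring

/-- The relation between the kernels is needed only for `P` on the vertical line through `Q`, the
only points the density sees. The characteristic data of the adjoint problem hold only there. -/
theorem fiber₁_eq_sum (hg : Continuous g) (hl : ∀ e, Continuous fun P => l e P Q)
    (hμ : D.IsCrossing₁ Q μ) (hk : ∀ P : Plane, P.1 = Q.1 → k P Q = ∑ e, a e * l e P Q) :
    D.fiber₁ g h μ k Q = ∑ e, a e * D.fiber₁ g h μ (l e) Q := by
  have hk' : ∀ t, k (Q.1, t) Q = _ := fun t => hk (Q.1, t) rfl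
  simp only [fiber₁, hk', hk (D.pt μ) hμ.eq, mul_sub, Finset.sum_sub_distrib,
    Finset.mul_sum]
  congr 1
  · rw [integral_finsetSum _ fun e _ => ?_]
    · refine Finset.sum_congr rfl fun e _ => ?_
      rw [← integral_const_mul]
      simp only [mul_left_comm]
    · simp only [mul_left_comm (g _)]
      exact (integrableOn_line₁ hg (hl e) Q).const_mul (a e)
  · refine Finset.sum_congr rfl fun e _ => ?_
    ring

theorem fiber₂_eq_sum (hg : Continuous g) (hl : ∀ e, Continuous fun P => l e P Q)
    (hμ : D.IsCrossing₂ Q μ) (hk : ∀ P : Plane, P.2 = Q.2 → k P Q = ∑ e, a e * l e P Q) :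
    D.fiber₂ g h μ k Q = ∑ e, a e * D.fiber₂ g h μ (l e) Q := by
  have hk' : ∀ s, k (s, Q.2) Q = _ := fun s => hk (s, Q.2) rfl
  simp only [fiber₂, hk', hk (D.pt μ) hμ.eq, mul_add, Finset.sum_add_distrib,
    Finset.mul_sum]
  congr 1
  · rw [integral_finsetSum _ fun e _ => ?_]
    · refine Finset.sum_congr rfl fun e _ => ?_
      rw [← integral_const_mul]
      simp only [mul_left_comm]
    · simp only [mul_left_comm (g _)]
      exact (integrableOn_line₂ hg (hl e) Q).const_mul (a e)
  · refine Finset.sum_congr rfl fun e _ => ?_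
    ring

end Linearity

section VectorPairing

open scoped Matrix.Norms.Operator

variable {n : ℕ} (D : CurvilinearDomain) (g : Fin n → Plane → ℝ) (h : Fin n → ℝ → ℝ)
  (c : Fin n → Fin D.N → ℝ)

/-- The pairing of a matrix-valued kernel with vector-valued sources. -/
def vecPairing (M : Plane → Plane → Matrix (Fin n) (Fin n) ℝ) (Q : Plane) (j : Fin n) : ℝ :=
  ∑ i, D.pairing (g i) (h i) (c i) (fun P X => M P X i j) Q

/-- The vector-valued version of `fiber₁`. -/
def vecFiber₁ (μ : ℝ) (M : Plane → Plane → Matrix (Fin n) (Fin n) ℝ) (Q : Plane) (j : Fin n) : ℝ :=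
  ∑ i, D.fiber₁ (g i) (h i) μ (fun P X => M P X i j) Q

/-- The vector-valued version of `fiber₂`. -/
def vecFiber₂ (μ : ℝ) (M : Plane → Plane → Matrix (Fin n) (Fin n) ℝ) (Q : Plane) (j : Fin n) : ℝ :=
  ∑ i, D.fiber₂ (g i) (h i) μ (fun P X => M P X i j) Q

/-- Sources for which the pairing with smooth kernels can be differentiated at regular points. -/
structure IsSource : Prop where
  continuous : ∀ i, Continuous (g i)
  integrableOn : ∀ i, IntegrableOn (h i) (Icc 0 D.ℓ)
  continuousOn : ∀ i, ∀ r : Fin (D.N + 1),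
    ContinuousOn (h i) (Ioo (D.vpar r.castSucc) (D.vpar r.succ))

variable {D g h c} {M M' S U V : Plane → Plane → Matrix (Fin n) (Fin n) ℝ}
  {B C K : Plane → Matrix (Fin n) (Fin n) ℝ} {Q : Plane} {μ ν : ℝ}

theorem continuous_entry (hM : Continuous (Function.uncurry M)) (i j : Fin n) :
    Continuous (Function.uncurry fun P X => M P X i j) := hM.matrix_elem i j

theorem continuous_entry_left (hM : Continuous (Function.uncurry M)) (Q : Plane) (i j : Fin n) :
    Continuous fun P => M P Q i j :=
  (continuous_entry hM i j).comp (Continuous.prodMk_left Q)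

theorem hasDerivAt_vecPairing₁ (hs : D.IsSource g h) (hM : Continuous (Function.uncurry M))
    (hM' : Continuous (Function.uncurry M'))
    (hd : ∀ P X, HasDerivAt (fun σ => M P (σ, X.2)) (M' P X) X.1)
    (hQ : Q ∈ D.regularPart) (hμ : D.IsCrossing₁ Q μ) (j : Fin n) :
    HasDerivAt (fun σ => D.vecPairing g h c M (σ, Q.2) j)
      (D.vecPairing g h c M' Q j - D.vecFiber₁ g h μ M Q j) Q.1 := by
  simp only [vecPairing, vecFiber₁, ← Finset.sum_sub_distrib]
  exact HasDerivAt.fun_sum fun i _ => hasDerivAt_pairing₁ (hs.continuous i) (hs.integrableOn i)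
    (hs.continuousOn i) (continuous_entry hM i j) (continuous_entry hM' i j)
    (fun P X => hasDerivAt_matrix.1 (hd P X) i j) hQ hμ

theorem hasDerivAt_vecPairing₂ (hs : D.IsSource g h) (hM : Continuous (Function.uncurry M))
    (hM' : Continuous (Function.uncurry M'))
    (hd : ∀ P X, HasDerivAt (fun τ => M P (X.1, τ)) (M' P X) X.2)
    (hQ : Q ∈ D.regularPart) (hμ : D.IsCrossing₂ Q μ) (j : Fin n) :
    HasDerivAt (fun τ => D.vecPairing g h c M (Q.1, τ) j)
      (D.vecPairing g h c M' Q j - D.vecFiber₂ g h μ M Q j) Q.2 := by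
  simp only [vecPairing, vecFiber₂, ← Finset.sum_sub_distrib]
  exact HasDerivAt.fun_sum fun i _ => hasDerivAt_pairing₂ (hs.continuous i) (hs.integrableOn i)
    (hs.continuousOn i) (continuous_entry hM i j) (continuous_entry hM' i j)
    (fun P X => hasDerivAt_matrix.1 (hd P X) i j) hQ hμ

/-- The moving lower endpoint of the segment contributes the source density at `Q`. The
normalization of the kernel on the diagonal selects its component `j`. -/
theorem hasDerivAt_vecFiber₁ (hs : D.IsSource g h) (hM : Continuous (Function.uncurry M))
    (hM' : Continuous (Function.uncurry M'))
    (hd : ∀ P X, HasDerivAt (fun τ => M P (X.1, τ)) (M' P X) X.2)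
    (h1 : M Q Q = 1) (hQ : Q ∈ D.G) (j : Fin n) :
    HasDerivAt (fun τ => D.vecFiber₁ g h μ M (Q.1, τ) j)
      (D.vecFiber₁ g h μ M' Q j - g j Q) Q.2 := by
  have := HasDerivAt.fun_sum (u := Finset.univ) fun i _ => hasDerivAt_fiber₁ (h := h i) (μ := μ)
    (hs.continuous i) (continuous_entry hM i j) (continuous_entry hM' i j)
    (fun P X => hasDerivAt_matrix.1 (hd P X) i j) hQ
  refine this.congr_deriv ?_
  simp [vecFiber₁, Finset.sum_sub_distrib, h1, Matrix.one_apply]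

theorem hasDerivAt_vecFiber₂ (hs : D.IsSource g h) (hM : Continuous (Function.uncurry M))
    (hM' : Continuous (Function.uncurry M'))
    (hd : ∀ P X, HasDerivAt (fun σ => M P (σ, X.2)) (M' P X) X.1)
    (h1 : M Q Q = 1) (hQ : Q ∈ D.G) (j : Fin n) :
    HasDerivAt (fun σ => D.vecFiber₂ g h μ M (σ, Q.2) j)
      (D.vecFiber₂ g h μ M' Q j - g j Q) Q.1 := by
  have := HasDerivAt.fun_sum (u := Finset.univ) fun i _ => hasDerivAt_fiber₂ (h := h i) (μ := μ)
    (hs.continuous i) (continuous_entry hM i j) (continuous_entry hM' i j)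
    (fun P X => hasDerivAt_matrix.1 (hd P X) i j) hQ
  refine this.congr_deriv ?_
  simp [vecFiber₂, Finset.sum_sub_distrib, h1, Matrix.one_apply]

/-- On the vertical line through `Q` the Goursat data `V = -S B` apply, and `B` is evaluated at the
fixed point `Q`, so it factors out of the density. -/
theorem vecFiber₁_edge (hs : D.IsSource g h) (hS : IsAdjointRiemann B C K S U V)
    (hμ : D.IsCrossing₁ Q μ) (j : Fin n) :
    D.vecFiber₁ g h μ V Q j = -∑ k, D.vecFiber₁ g h μ S Q k * B Q k j := by
  simp only [vecFiber₁, Finset.sum_mul]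
  rw [Finset.sum_comm, ← Finset.sum_neg_distrib]
  refine Finset.sum_congr rfl fun i _ => ?_
  rw [fiber₁_eq_sum (a := fun k => -B Q k j) (l := fun k P X => S P X i k) (hs.continuous i)
    (fun k => continuous_entry_left hS.continuous_S Q i k) hμ fun P hP => ?_,
    ← Finset.sum_neg_distrib]
  · exact Finset.sum_congr rfl fun k _ => by ring
  · have := hS.edge_t P Q.2
    rw [hP] at this
    rw [this, Matrix.neg_apply, Matrix.mul_apply, ← Finset.sum_neg_distrib]
    exact Finset.sum_congr rfl fun k _ => by ring

theorem vecFiber₂_edge (hs : D.IsSource g h) (hS : IsAdjointRiemann B C K S U V)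
    (hμ : D.IsCrossing₂ Q μ) (j : Fin n) :
    D.vecFiber₂ g h μ U Q j = -∑ k, D.vecFiber₂ g h μ S Q k * C Q k j := by
  simp only [vecFiber₂, Finset.sum_mul]
  rw [Finset.sum_comm, ← Finset.sum_neg_distrib]
  refine Finset.sum_congr rfl fun i _ => ?_
  rw [fiber₂_eq_sum (a := fun k => -C Q k j) (l := fun k P X => S P X i k) (hs.continuous i)
    (fun k => continuous_entry_left hS.continuous_S Q i k) hμ fun P hP => ?_,
    ← Finset.sum_neg_distrib]
  · exact Finset.sum_congr rfl fun k _ => by ring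
  · have := hS.edge_s P Q.1
    rw [hP] at this
    rw [this, Matrix.neg_apply, Matrix.mul_apply, ← Finset.sum_neg_distrib]
    exact Finset.sum_congr rfl fun k _ => by ring

/-- The coefficients act on the kernel from the right and depend only on `Q`, not on the variable of
integration. -/
theorem vecPairing_adjointRHS (hs : D.IsSource g h) (hS : IsAdjointRiemann B C K S U V)
    (j : Fin n) :
    D.vecPairing g h c (fun P X => S P X * K X - U P X * B X - V P X * C X) Q j
      = ∑ k, (D.vecPairing g h c S Q k * K Q k j - D.vecPairing g h c U Q k * B Q k j
        - D.vecPairing g h c V Q k * C Q k j) := by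
  simp only [vecPairing, Finset.sum_mul, ← Finset.sum_sub_distrib]
  rw [Finset.sum_comm]
  refine Finset.sum_congr rfl fun i _ => ?_
  -- One sum over three copies of the index set collects the three matrix products.
  rw [pairing_eq_sum (ι := Fin n ⊕ Fin n ⊕ Fin n)
    (a := Sum.elim (fun k => K Q k j) (Sum.elim (fun k => -B Q k j) (fun k => -C Q k j)))
    (l := Sum.elim (fun k P X => S P X i k) (Sum.elim (fun k P X => U P X i k)
      (fun k P X => V P X i k))) (hs.continuous i) (hs.integrableOn i) ?_ fun P => ?_]
  · simp only [Fintype.sum_sum_type, Sum.elim_inl, Sum.elim_inr, ← Finset.sum_add_distrib]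
    exact Finset.sum_congr rfl fun k _ => by ring
  · rintro (k | k | k)
    exacts [continuous_entry_left hS.continuous_S Q i k, continuous_entry_left hS.continuous_U Q i k,
      continuous_entry_left hS.continuous_V Q i k]
  · simp only [Fintype.sum_sum_type, Sum.elim_inl, Sum.elim_inr, ← Finset.sum_add_distrib,
      Matrix.sub_apply, Matrix.mul_apply, ← Finset.sum_sub_distrib]
    exact Finset.sum_congr rfl fun k _ => by ring

theorem IsCrossing₁.congr (hμ : D.IsCrossing₁ Q μ) {X : Plane} (hX : X.1 = Q.1) :
    D.IsCrossing₁ X μ :=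
  ⟨hμ.mem, hμ.eq.trans hX.symm, hμ.deriv_ne, hμ.strict, by rw [hX]; exact hμ.uniq, hμ.notVertex⟩

theorem IsCrossing₂.congr (hμ : D.IsCrossing₂ Q μ) {X : Plane} (hX : X.2 = Q.2) :
    D.IsCrossing₂ X μ :=
  ⟨hμ.mem, hμ.eq.trans hX.symm, hμ.deriv_ne, hμ.strict, by rw [hX]; exact hμ.uniq, hμ.notVertex⟩

/-- The mixed derivative of the pairing with an adjoint Riemann function, at a regular point. -/
theorem hasDerivAt_mixed_vecPairing (hs : D.IsSource g h) (hS : IsAdjointRiemann B C K S U V)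
    (hBc : Continuous B) (hCc : Continuous C) (hKc : Continuous K)
    (hQ : Q ∈ D.regularPart) (j : Fin n) {ψ : Plane → Fin n → ℝ}
    (hψ : ∀ X ∈ D.regularPart, ∀ k, ψ X k = D.vecPairing g h c S X k) :
    (∀ k, DifferentiableAt ℝ (fun s => ψ (s, Q.2) k) Q.1) ∧
    (∀ k, DifferentiableAt ℝ (fun t => ψ (Q.1, t) k) Q.2) ∧
    HasDerivAt (fun t => dS (fun X => ψ X j) (Q.1, t))
      (g j Q + ∑ k, (ψ Q k * K Q k j - dS (fun X => ψ X k) Q * B Q k j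
        - dT (fun X => ψ X k) Q * C Q k j)) Q.2 ∧
    HasDerivAt (fun s => dT (fun X => ψ X j) (s, Q.2))
      (g j Q + ∑ k, (ψ Q k * K Q k j - dS (fun X => ψ X k) Q * B Q k j
        - dT (fun X => ψ X k) Q * C Q k j)) Q.1 := by
  obtain ⟨μ, hμ⟩ := exists_isCrossing₁ hQ
  obtain ⟨ν, hν⟩ := exists_isCrossing₂ hQ
  have hW : Continuous (Function.uncurry fun P X => S P X * K X - U P X * B X - V P X * C X) :=
    ((hS.continuous_S.mul (hKc.comp continuous_snd)).sub
      (hS.continuous_U.mul (hBc.comp continuous_snd))).sub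
      (hS.continuous_V.mul (hCc.comp continuous_snd))
  have ec₁ : ∀ X : Plane, X ∈ D.regularPart → ∀ᶠ s in 𝓝 X.1, (s, X.2) ∈ D.regularPart := fun X hX =>
    (show ContinuousAt (fun s : ℝ => ((s, X.2) : Plane)) X.1 by fun_prop).eventually
      (D.isOpen_regularPart.mem_nhds hX)
  have ec₂ : ∀ X : Plane, X ∈ D.regularPart → ∀ᶠ t in 𝓝 X.2, (X.1, t) ∈ D.regularPart := fun X hX =>
    (show ContinuousAt (fun t : ℝ => ((X.1, t) : Plane)) X.2 by fun_prop).eventually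
      (D.isOpen_regularPart.mem_nhds hX)
  -- The same `μ` serves for every regular point on the vertical line through `Q`, so the formula
  -- for `ψ_s` holds along that line near `Q` and can be differentiated in `t`.
  have d₁ : ∀ X : Plane, X ∈ D.regularPart → X.1 = Q.1 → ∀ k, HasDerivAt (fun s => ψ (s, X.2) k)
      (D.vecPairing g h c U X k - D.vecFiber₁ g h μ S X k) X.1 := fun X hX h1 k =>
    (hasDerivAt_vecPairing₁ hs hS.continuous_S hS.continuous_U hS.deriv_s hX (hμ.congr h1)
      k).congr_of_eventuallyEq ((ec₁ X hX).mono fun s hs => hψ _ hs k)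
  have d₂ : ∀ X : Plane, X ∈ D.regularPart → X.2 = Q.2 → ∀ k, HasDerivAt (fun t => ψ (X.1, t) k)
      (D.vecPairing g h c V X k - D.vecFiber₂ g h ν S X k) X.2 := fun X hX h1 k =>
    (hasDerivAt_vecPairing₂ hs hS.continuous_S hS.continuous_V hS.deriv_t hX (hν.congr h1)
      k).congr_of_eventuallyEq ((ec₂ X hX).mono fun s hs => hψ _ hs k)
  have e₁ : ∀ k, dS (fun X => ψ X k) Q = _ := fun k => (d₁ Q hQ rfl k).deriv
  have e₂ : ∀ k, dT (fun X => ψ X k) Q = _ := fun k => (d₂ Q hQ rfl k).deriv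
  -- The density on each line, rewritten by the edge data, completes the pairings with `U` and `V`
  -- to the full derivatives `ψ_s` and `ψ_t`.
  have hfin : g j Q + ∑ k, (ψ Q k * K Q k j - dS (fun X => ψ X k) Q * B Q k j
        - dT (fun X => ψ X k) Q * C Q k j)
      = D.vecPairing g h c (fun P X => S P X * K X - U P X * B X - V P X * C X) Q j
        - D.vecFiber₁ g h μ V Q j - D.vecFiber₂ g h ν U Q j + g j Q := by
    rw [vecPairing_adjointRHS hs hS, vecFiber₁_edge hs hS hμ, vecFiber₂_edge hs hS hν, add_comm,
      sub_neg_eq_add, sub_neg_eq_add, ← Finset.sum_add_distrib, ← Finset.sum_add_distrib]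
    congr 1
    refine Finset.sum_congr rfl fun k _ => ?_
    rw [e₁, e₂, hψ Q hQ]
    ring
  refine ⟨fun k => (d₁ Q hQ rfl k).differentiableAt, fun k => (d₂ Q hQ rfl k).differentiableAt,
    ?_, ?_⟩
  · have a₁ := hasDerivAt_vecPairing₂ (c := c) hs hS.continuous_U hW hS.deriv_st hQ hν j
    have a₂ := hasDerivAt_vecFiber₁ (μ := μ) hs hS.continuous_S hS.continuous_V hS.deriv_t
      (hS.diagonal Q) hQ.1 j
    refine ((a₁.sub a₂).congr_of_eventuallyEq ?_).congr_deriv ?_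
    · exact (ec₂ Q hQ).mono fun t ht => (d₁ (Q.1, t) ht rfl j).deriv
    · rw [hfin]; ring
  · have a₁ := hasDerivAt_vecPairing₁ (c := c) hs hS.continuous_V hW hS.deriv_ts hQ hμ j
    have a₂ := hasDerivAt_vecFiber₂ (μ := ν) hs hS.continuous_S hS.continuous_U hS.deriv_s
      (hS.diagonal Q) hQ.1 j
    refine ((a₁.sub a₂).congr_of_eventuallyEq ?_).congr_deriv ?_
    · exact (ec₁ Q hQ).mono fun s hs => (d₂ (s, Q.2) hs rfl j).deriv
    · rw [hfin]; ring

end VectorPairing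

end CurvilinearDomain

end Goursat

end

/-! ### The co-state and the Hamiltonian -/

noncomputable section

namespace Goursat

open Filter Topology

section Costate

variable {n m : ℕ} {D : CurvilinearDomain} {C : ControlProblem n m} {x : Plane → Vec n}
  {u : Plane → Vec m} {R : Plane → Plane → Fin n → Fin n → ℝ} {O : Set Plane}
  {S : Plane → Plane → Matrix (Fin n) (Fin n) ℝ} {g : Fin n → Plane → ℝ} {Q : Plane}

open CurvilinearDomain
open scoped Matrix.Norms.Operator

/-- At a regular point, the co-state is the pairing of the sources with any continuous kernel that
agrees with the Riemann function strictly above the diagonal. -/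
theorem costate_eq_vecPairing (hS : Continuous (Function.uncurry S))
    (hRS : ∀ P ∈ D.closedRegion, ∀ Q ∈ D.closedRegion, Q.1 < P.1 → Q.2 < P.2 →
      ∀ i j, R P Q i j = S P Q i j)
    (hs : D.IsSource g (sourceCurve D C x u)) (hg : ∀ i, ∀ P ∈ D.G, g i P = sourceG C x u i P)
    (hQ : Q ∈ D.regularPart) (j : Fin n) :
    costate D C x u R j Q = D.vecPairing g (sourceCurve D C x u)
      (fun i r => sourceVertex D C x i r.succ.castSucc) S Q j := by
  obtain ⟨p1, p2, -⟩ := D.exists_lt_of_mem_G hQ.1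
  have hQc := D.G_subset hQ.1
  obtain ⟨μ, hμ⟩ := exists_isCrossing₁ hQ
  obtain ⟨ν, hν⟩ := exists_isCrossing₂ hQ
  have hE : ∫ P in D.E Q, ∑ i, sourceG C x u i P * R P Q i j
      = ∑ i, ∫ P in D.E Q, g i P * S P Q i j := by
    rw [← integral_finsetSum _ fun i _ =>
      integrableOn_E (hs.continuous i) (continuous_entry_left hS Q i j) Q]
    -- The kernels are only known to agree strictly above the diagonal. The exceptional points form
    -- a null set in the domain and at most two parameters on the curve, and none is a vertex
    -- because `Q` is regular.
    have hne₁ : ∀ᵐ P : Plane, P.1 ≠ Q.1 :=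
      Measure.quasiMeasurePreserving_fst.ae (ae_ne_const Q.1)
    have hne₂ : ∀ᵐ P : Plane, P.2 ≠ Q.2 :=
      Measure.quasiMeasurePreserving_snd.ae (ae_ne_const Q.2)
    refine setIntegral_congr_ae (measurableSet_E p1.le p2.le) ?_
    filter_upwards [hne₁, hne₂] with P h1 h2 hP
    rw [mem_E p1.le p2.le] at hP
    refine Finset.sum_congr rfl fun i _ => ?_
    rw [hg i P hP.1, hRS P (D.G_subset hP.1) Q hQc (lt_of_le_of_ne hP.2.1 h1.symm)
      (lt_of_le_of_ne hP.2.2 h2.symm)]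
  have hA : ∫ θ in D.arc Q, ∑ i, sourceCurve D C x u i θ * R (D.pt θ) Q i j
      = ∑ i, ∫ θ in D.arc Q, sourceCurve D C x u i θ * S (D.pt θ) Q i j := by
    rw [← integral_finsetSum _ fun i _ =>
      integrableOn_arc (hs.integrableOn i) (continuous_entry_left hS Q i j) Q]
    refine setIntegral_congr_ae (measurableSet_arc p1.le p2.le) ?_
    filter_upwards [ae_ne_const μ, ae_ne_const ν] with θ h1 h2 hθ
    rw [mem_arc p1.le p2.le] at hθ
    refine Finset.sum_congr rfl fun i _ => ?_
    rw [hRS (D.pt θ) (D.pt_mem hθ.1) Q hQc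
      (lt_of_le_of_ne hθ.2.1 fun h => h1 (hμ.uniq θ hθ.1 h.symm))
      (lt_of_le_of_ne hθ.2.2 fun h => h2 (hν.uniq θ hθ.1 h.symm))]
  simp only [costate, vecPairing, pairing, Finset.sum_add_distrib]
  rw [hE, hA]
  congr 1
  rw [Finset.sum_comm]
  refine Finset.sum_congr rfl fun i _ => Finset.sum_congr rfl fun r _ => ?_
  by_cases hm : Q ∈ W (D.vertex r.succ.castSucc)
  · rw [hRS (D.vertex r.succ.castSucc) (D.pt_mem (D.vpar_mem _)) Q hQc
      (lt_of_le_of_ne hm.2.1 (hQ.2 _).1) (lt_of_le_of_ne hm.2.2.2 (hQ.2 _).2)]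
  · rw [indicator_of_notMem hm, mul_zero, mul_zero]

/-- The co-state equation, in terms of the coefficients of the linearized equation. -/
theorem hasDerivAt_mixed_costate (hO : IsOpen O) (hDO : D.closedRegion ⊆ O)
    (hf : SmoothOver O C.f) (hΦ : SmoothOver O C.Φ) (hΦ₁ : SmoothAlongArcs D C.Φ₁)
    (hx : ContDiffOn ℝ 2 x O) (hu : ContDiffOn ℝ 1 u O) (hR : IsRiemannFunction D C x u R)
    {ψ : Plane → Vec n} (hψ : ∀ P j, ψ P j = costate D C x u R j P) (hQ : Q ∈ D.regularPart)
    (j : Fin n) :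
    (∀ k, DifferentiableAt ℝ (fun s => ψ (s, Q.2) k) Q.1) ∧
    (∀ k, DifferentiableAt ℝ (fun t => ψ (Q.1, t) k) Q.2) ∧
    ∃ z, z = sourceG C x u j Q + ∑ k, (ψ Q k * (alongX (C.fc k) x u j Q
        - dS (alongP (C.fc k) x u j) Q - dT (alongQ (C.fc k) x u j) Q)
        - dS (fun X => ψ X k) Q * alongP (C.fc k) x u j Q
        - dT (fun X => ψ X k) Q * alongQ (C.fc k) x u j Q) ∧
      HasDerivAt (fun t => dS (fun X => ψ X j) (Q.1, t)) z Q.2 ∧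
      HasDerivAt (fun s => dT (fun X => ψ X j) (s, Q.2)) z Q.1 := by
  obtain ⟨B', C', K, S, U, V, hS, hBc, hCc, hKc, hRS, hcoef⟩ :=
    hR.exists_isAdjointRiemann hO hDO hf hx hu
  -- The source density is continuous only on `O`. The cutoff makes it continuous on the plane
  -- without changing it in `G`.
  obtain ⟨ζ, hζ, -, hζO, hζ1⟩ := exists_cutoff D.isCompact_closedRegion hO hDO
  have hs : D.IsSource (fun i P => ζ P * sourceG C x u i P) (sourceCurve D C x u) := by
    refine ⟨fun i => ?_, fun i => integrableOn_sourceCurve hO hDO hΦ hΦ₁ hx hu i,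
      fun i r => continuousOn_sourceCurve hO hDO hΦ hΦ₁ hx hu i r⟩
    exact (contDiff_cutoff_mul (k := 0) hO (hζ.of_le (by norm_num)) hζO
      (contDiffOn_zero.2 (continuousOn_sourceG hO hΦ hx hu i))).continuous
  have hg : ∀ i, ∀ P ∈ D.G, ζ P * sourceG C x u i P = sourceG C x u i P := fun i P hP => by
    rw [hζ1 P (D.G_subset hP), one_mul]
  obtain ⟨h1, h2, h3, h4⟩ := hasDerivAt_mixed_vecPairing hs hS hBc hCc hKc hQ j (ψ := ψ)
    (c := fun i r => sourceVertex D C x i r.succ.castSucc) fun X hX k =>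
      (hψ X k).trans (costate_eq_vecPairing hS.continuous_S hRS hs hg hX k)
  refine ⟨h1, h2, _, ?_, h3, h4⟩
  rw [hg j Q hQ.1]
  simp only [hcoef Q hQ.1]

end Costate

section Hamiltonian

variable {n m : ℕ} {C : ControlProblem n m} {x ψ : Plane → Vec n} {u : Plane → Vec m}
  {O : Set Plane} {P : Plane}

/-- The weights `w` are constant: in the Hamiltonian the co-state is an independent variable. -/
theorem pd_add_sum {F : Vec n → ℝ} {G : Fin n → Vec n → ℝ} {w : Vec n} {y : Vec n}
    (hF : DifferentiableAt ℝ F y) (hG : ∀ j, DifferentiableAt ℝ (G j) y) (i : Fin n) :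
    pd (fun z => F z + ∑ j, w j * G j z) i y = pd F i y + ∑ j, w j * pd (G j) i y := by
  have h := hF.hasFDerivAt.add (HasFDerivAt.fun_sum (u := Finset.univ) fun j _ =>
    (hG j).hasFDerivAt.const_mul (w j))
  unfold pd
  rw [HasFDerivAt.fderiv (f := fun z => F z + ∑ j, w j * G j z) h]
  simp

theorem HX_eq (hO : IsOpen O) (hf : SmoothOver O C.f) (hΦ : SmoothOver O C.Φ) (hP : P ∈ O)
    (i : Fin n) :
    HX C x ψ u i P = alongX C.Φ x u i P + ∑ j, ψ P j * alongX (C.fc j) x u i P := by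
  have hι : DifferentiableAt ℝ (fun y => (P, y, dS x P, dT x P, u P)) (x P) := by fun_prop
  exact pd_add_sum ((hΦ.differentiableAt hO hP _).comp (x P) hι)
    (fun j => ((smoothOver_fc hf j).differentiableAt hO hP _).comp (x P) hι) i

theorem HP_eq (hO : IsOpen O) (hf : SmoothOver O C.f) (hΦ : SmoothOver O C.Φ) (hP : P ∈ O)
    (i : Fin n) :
    HP C x ψ u i P = alongP C.Φ x u i P + ∑ j, ψ P j * alongP (C.fc j) x u i P := by
  have hι : DifferentiableAt ℝ (fun p => (P, x P, p, dT x P, u P)) (dS x P) := by fun_prop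
  exact pd_add_sum ((hΦ.differentiableAt hO hP _).comp (dS x P) hι)
    (fun j => ((smoothOver_fc hf j).differentiableAt hO hP _).comp (dS x P) hι) i

theorem HQ_eq (hO : IsOpen O) (hf : SmoothOver O C.f) (hΦ : SmoothOver O C.Φ) (hP : P ∈ O)
    (i : Fin n) :
    HQ C x ψ u i P = alongQ C.Φ x u i P + ∑ j, ψ P j * alongQ (C.fc j) x u i P := by
  have hι : DifferentiableAt ℝ (fun q => (P, x P, dS x P, q, u P)) (dT x P) := by fun_prop
  exact pd_add_sum ((hΦ.differentiableAt hO hP _).comp (dT x P) hι)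
    (fun j => ((smoothOver_fc hf j).differentiableAt hO hP _).comp (dT x P) hι) i

/-- The product rule is applied along a horizontal line only, so partial differentiability of `ψ` in
`s` suffices. -/
theorem hasDerivAt_HP (hO : IsOpen O) (hf : SmoothOver O C.f) (hΦ : SmoothOver O C.Φ)
    (hx : ContDiffOn ℝ 2 x O) (hu : ContDiffOn ℝ 1 u O) (hP : P ∈ O)
    (hψ : ∀ k, DifferentiableAt ℝ (fun s => ψ (s, P.2) k) P.1) (i : Fin n) :
    HasDerivAt (fun s => HP C x ψ u i (s, P.2)) (dS (alongP C.Φ x u i) P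
      + ∑ j, (dS (fun X => ψ X j) P * alongP (C.fc j) x u i P
        + ψ P j * dS (alongP (C.fc j) x u i) P)) P.1 := by
  have hd : ∀ {f : Plane → ℝ}, ContDiffOn ℝ 1 f O → DifferentiableAt ℝ f P := fun hf =>
    (hf.contDiffAt (hO.mem_nhds hP)).differentiableAt (by norm_num)
  refine ((hasDerivAt_dS (hd (contDiffOn_alongP hO hΦ hx hu i))).add
    (HasDerivAt.fun_sum fun j _ => (hψ j).hasDerivAt.mul
      (hasDerivAt_dS (hd (contDiffOn_alongP hO (smoothOver_fc hf j) hx hu i))))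
    ).congr_of_eventuallyEq ?_
  have hc : ContinuousAt (fun s : ℝ => ((s, P.2) : Plane)) P.1 := by fun_prop
  filter_upwards [hc.eventually (hO.mem_nhds hP)] with s hs
  exact HP_eq hO hf hΦ hs i

theorem hasDerivAt_HQ (hO : IsOpen O) (hf : SmoothOver O C.f) (hΦ : SmoothOver O C.Φ)
    (hx : ContDiffOn ℝ 2 x O) (hu : ContDiffOn ℝ 1 u O) (hP : P ∈ O)
    (hψ : ∀ k, DifferentiableAt ℝ (fun t => ψ (P.1, t) k) P.2) (i : Fin n) :
    HasDerivAt (fun t => HQ C x ψ u i (P.1, t)) (dT (alongQ C.Φ x u i) P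
      + ∑ j, (dT (fun X => ψ X j) P * alongQ (C.fc j) x u i P
        + ψ P j * dT (alongQ (C.fc j) x u i) P)) P.2 := by
  have hd : ∀ {f : Plane → ℝ}, ContDiffOn ℝ 1 f O → DifferentiableAt ℝ f P := fun hf =>
    (hf.contDiffAt (hO.mem_nhds hP)).differentiableAt (by norm_num)
  refine ((hasDerivAt_dT (hd (contDiffOn_alongQ hO hΦ hx hu i))).add
    (HasDerivAt.fun_sum fun j _ => (hψ j).hasDerivAt.mul
      (hasDerivAt_dT (hd (contDiffOn_alongQ hO (smoothOver_fc hf j) hx hu i))))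
    ).congr_of_eventuallyEq ?_
  have hc : ContinuousAt (fun t : ℝ => ((P.1, t) : Plane)) P.2 := by fun_prop
  filter_upwards [hc.eventually (hO.mem_nhds hP)] with t ht
  exact HQ_eq hO hf hΦ ht i

end Hamiltonian

end Goursat

end

/-! ### The co-state equation -/

theorem theorem3p1 {n m : ℕ} (D : Goursat.CurvilinearDomain) (C : Goursat.ControlProblem n m)
    (x₁ x₂ : ℝ → Goursat.Vec n) (x : Goursat.Plane → Goursat.Vec n)
    (u : Goursat.Plane → Goursat.Vec m)
    (R : Goursat.Plane → Goursat.Plane → Fin n → Fin n → ℝ)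
    (ψ : Goursat.Plane → Goursat.Vec n)
    -- smoothness of the data up to the boundary of the domain
    (O : Set Goursat.Plane) (hO : IsOpen O) (hDO : D.closedRegion ⊆ O)
    (hf : Goursat.SmoothOver O C.f) (hΦ : Goursat.SmoothOver O C.Φ)
    (hΦ₁ : Goursat.SmoothAlongArcs D C.Φ₁)
    (hΦ₀ : ∀ r, ContDiff ℝ 1 (C.Φ₀ (D.vertex r)))
    (hx : ContDiffOn ℝ 2 x O) (hu : ContDiffOn ℝ 1 u O)
    -- the state, the Riemann function and the co-state
    (hstate : Goursat.IsState D C x₁ x₂ x u)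
    (hR : Goursat.IsRiemannFunction D C x u R)
    (hψ : ∀ P j, ψ P j = Goursat.costate D C x u R j P) :
    ∀ P ∈ D.regularPart, ∀ i : Fin n,
      -- the derivatives in the equation exist
      DifferentiableAt ℝ (fun s => ψ (s, P.2) i) P.1 ∧
      DifferentiableAt ℝ (fun t => ψ (P.1, t) i) P.2 ∧
      DifferentiableAt ℝ (fun s => Goursat.HP C x ψ u i (s, P.2)) P.1 ∧
      DifferentiableAt ℝ (fun t => Goursat.HQ C x ψ u i (P.1, t)) P.2 ∧
      -- the equation, for both orders of the mixed derivative
      HasDerivAt (fun s => Goursat.dT (fun P' => ψ P' i) (s, P.2))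
        (Goursat.HX C x ψ u i P - Goursat.dS (Goursat.HP C x ψ u i) P
          - Goursat.dT (Goursat.HQ C x ψ u i) P) P.1 ∧
      HasDerivAt (fun t => Goursat.dS (fun P' => ψ P' i) (P.1, t))
        (Goursat.HX C x ψ u i P - Goursat.dS (Goursat.HP C x ψ u i) P
          - Goursat.dT (Goursat.HQ C x ψ u i) P) P.2 := by
  intro P hP i
  have hPO : P ∈ O := hDO (D.G_subset hP.1)
  obtain ⟨h1, h2, z, hz, h3, h4⟩ :=
    Goursat.hasDerivAt_mixed_costate hO hDO hf hΦ hΦ₁ hx hu hR hψ hP i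
  have hp := Goursat.hasDerivAt_HP hO hf hΦ hx hu hPO h1 i
  have hq := Goursat.hasDerivAt_HQ hO hf hΦ hx hu hPO h2 i
  -- By the product rule, the terms with undifferentiated `ψ` collect into the adjoint coefficient
  -- `f_x - D_s f_p - D_t f_q`, those with `ψ_s` and `ψ_t` into `-ψ_s f_p` and `-ψ_t f_q`, and those
  -- with `Φ` into the source density.
  have hH : Goursat.HX C x ψ u i P - Goursat.dS (Goursat.HP C x ψ u i) P
      - Goursat.dT (Goursat.HQ C x ψ u i) P = z := by
    have ep : Goursat.dS (Goursat.HP C x ψ u i) P = _ := hp.deriv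
    have eq : Goursat.dT (Goursat.HQ C x ψ u i) P = _ := hq.deriv
    rw [ep, eq, Goursat.HX_eq hO hf hΦ hPO, hz, Goursat.sourceG]
    simp only [mul_sub, Finset.sum_sub_distrib, Finset.sum_add_distrib]
    ring
  rw [hH]
  exact ⟨h1 i, h2 i, hp.differentiableAt, hq.differentiableAt, h4, h3⟩
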